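/- Let $n\ge 0$. The cells of the permutocube $B_n$ are the sequences $C_0]C_1|\cdots|C_p$ ($p\ge 0$) of pairwise disjoint non-empty subsets of $\{0,1,\dots,n\}$ with $0\in C_0$; the elements in no block are called deleted. Such a cell is the product $B_{C_0}\times P_{C_1}\times\cdots\times P_{C_p}$ of a permutocube and permutahedra, where the cells of the permutahedron $P_S$ are the ordered partitions $A_1|\cdots|A_p$ of $S$ into non-empty blocks; its dimension is $\sum_j(\#C_j-1)$, and its faces are the concatenations of faces of the factors. Let $P_n=P_{\{1,\dots,n\}}$. The cellular chains $C_*$ (integer coefficients) carry the differential given, for $\mathrm{shuff}(A;M)=(-1)^{\#\{(a,m)\in A\times M:\,m<a\}}$, on top cells by $$d(S)=\sum_{A\sqcup M=S,\;A,M\neq\varnothing}(-1)^{\#A}\,\mathrm{shuff}(A;M)\,A|M\qquad(0\notin S),$$ $$d(S])=\sum_{i\ge1}(-1)^{i+1}\,\big(S\setminus\{s_i\}\big)]\;+\sum_{A\sqcup M=S,\;0\in A,\;M\ne\varnothing}(-1)^{\#A}\,\mathrm{shuff}(A;M)\,A]M\qquad(S=\{0<s_1<s_2<\cdots\}),$$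 and extended to products by the Leibniz rule with the sign $(-1)^{\dim}$ of the preceding factors; $C_*\otimes C_*$ has the usual differential $d\otimes 1+(-1)^{\dim}\otimes d$. *Orthogonal streams.* A vertex $x$ of $P_S$ is an ordering $x_1|\cdots|x_k$ of $S$; let $u_x$ (resp. $v_x$) be the partition whose blocks are the maximal decreasing (resp. increasing) runs of $x$. A vertex of $B_S$ ($0\in S$) is $x=0]x_1|\cdots|x_k$ with $x_1,\dots,x_k$ distinct elements of $S\setminus\{0\}$; let $u_x=A_0]A_1|\cdots|A_p$, where $A_1,\dots,A_p$ are the maximal decreasing runs of $x_1,\dots,x_k$ and $A_0=S\setminus\{x_1,\dots,x_k\}$, and let $v_x=C_0]C_1|\cdots|C_q$, where $C_0,\dots,C_q$ are the maximal increasing runs of $0,x_1,\dots,x_k$. Number the blocks of a partition $a$ as $A_0,\dots,A_\ell$ (for $P_S$ as well). For a proper subset $M_i\subsetneq A_i$ with $M_i=\varnothing$ or $\min M_i>\max A_{i+1}$ let $R_{M_i}(a)$ be obtained from $a$ by moving $M_i$ from $A_i$ to $A_{i+1}$; for a proper subset $N_j\subsetneq A_j$ with $N_j=\varnothing$ or $\min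 N_j>\max A_{j-1}$ let $L_{N_j}(a)$ be obtained by moving $N_j$ from $A_j$ to $A_{j-1}$. The orthogonal stream $OS_x$ of $x$ consists of all pairs $$(u,v)=\big(R_{M_{\ell-1}}\cdots R_{M_0}(u_x),\;L_{N_1}\cdots L_{N_{\ell'}}(v_x)\big),$$ where each operator is applied to the result of the preceding ones, and $OS$ is the union of the $OS_x$ over all vertices $x$. For a cell $e=e_0\times\cdots\times e_p$ with factors as above, $OS(e)$ consists of the pairs $(u_0\times\cdots\times u_p,\;v_0\times\cdots\times v_p)$ with $(u_j,v_j)\in OS(e_j)$. *Signs.* For a partition $a=(A_0,\dots,A_\ell)$ of a subset of $S$ let $\mathrm{psgn}(a)$ be the sign of the permutation of $S$ listing first the elements of $S$ in no block, in decreasing order, and then $A_0,\dots,A_\ell$, each block increasingly. Let $\epsilon_1=\sum_{i=1}^{\ell}i\,\#A_{\ell-i}$, $\epsilon_2=\epsilon_1+\binom{\ell}{2}$, $\mathrm{sgn}_k(a)=(-1)^{\epsilon_k}\mathrm{psgn}(a)$ for $k=1,2$, and, if $a$ is a partition of $S$, $\mathrm{rsgn}(a)=(-1)^{\frac12(\sum_i(\#A_i)^2-\#S)}$.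 For $(u,v)\in OS_x$ on the top cell of $B_S$ or $P_S$, with $v$ having $q+1$ blocks, let $$\mathrm{sgn}(u,v)=(-1)^{\binom{q+1}{2}}\,\mathrm{rsgn}(u_x)\,\mathrm{sgn}_1(v)\,\mathrm{sgn}_2(u)\,\mathrm{sgn}_2(u_x).$$ On a product cell the sign is the product of the signs of the factors and of the Koszul sign of the rearrangement $(u_0\otimes v_0)\cdots(u_p\otimes v_p)\mapsto (u_0\cdots u_p)\otimes(v_0\cdots v_p)$ (so $(-1)^{\dim v_i\dim u_j}$ for each $i<j$). **Theorem.** $(C_*(B_n),d)$ is a chain complex ($d$ sends a cell to a combination of its faces of codimension one, and $d^2=0$), and the formula $$\Delta_B(e)=\sum_{(e_1,e_2)\in OS(e)}\mathrm{sgn}(e_1,e_2)\;e_1\otimes e_2$$ defines a cellular diagonal $\Delta_B:C_*(B_n)\to C_*(B_n)\otimes C_*(B_n)$: it is a chain map of degree $0$, $\Delta_B(e)$ is a combination of terms $e_1\otimes e_2$ with $e_1,e_2$ faces of $e$ and $\dim e_1+\dim e_2=\dim e$, and $\Delta_B(x)=x\otimes x$ for every vertex $x$. Moreover it agrees with the permutahedral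 diagonal $\Delta_P$ (the same formula on the cells of $P_n$): the cellular inclusion $\delta:P_n\to B_n$, $A_1|\cdots|A_p\mapsto 0]A_1|\cdots|A_p$, induces a chain map $C_*(P_n)\to C_*(B_n)$, and $\Delta_B\circ\delta=(\delta\otimes\delta)\circ\Delta_P$. -/

import Mathlib

open scoped TensorProduct

namespace Permutocube

/-! ### Cells of permutahedra and permutocubes

A *word* is a finite list of blocks (finite subsets of `ℕ`).  A block `S` with `0 ∉ S` stands for
the permutahedron `P_S` and a block `S` with `0 ∈ S` stands for the permutocube `B_S`; a word
stands for the Cartesian product of the polytopes of its blocks, in the given order.  The cell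
`C₀]C₁|⋯|C_p` of a permutocube is the word `[C₀, C₁, …, C_p]`, which as a polytope is
`B_{C₀} × P_{C₁} × ⋯ × P_{C_p}`; the cell `A₁|⋯|A_p` of a permutahedron is `[A₁, …, A_p]`. -/

/-- Finite lists of blocks. -/
abbrev Word := List (Finset ℕ)

/-- The union of the blocks of a word. -/
def carrier (c : Word) : Finset ℕ := c.foldr (· ∪ ·) ∅

/-- The dimension of the product of the polytopes of the blocks. -/
def dim (c : Word) : ℕ := (c.map fun A => A.card - 1).sum

/-- `c` is a face of the polytope of the single block `S`.  If `0 ∉ S` these are the ordered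
partitions of `S` into non-empty blocks.  If `0 ∈ S` these are the partitions `C₀]C₁|⋯|C_p` with
`0 ∈ C₀` of the subsets of `S` containing `0`; the elements of `S` not in any block are the
deleted ones. -/
def IsBlockFace (c : Word) (S : Finset ℕ) : Prop :=
  (∀ A ∈ c, A.Nonempty) ∧ c.Pairwise Disjoint ∧
    if 0 ∈ S then (∃ A t, c = A :: t ∧ 0 ∈ A) ∧ carrier c ⊆ S else carrier c = S

/-- `IsFace c e`: the cell `c` is a face of the product polytope `e`, i.e. `c` is a concatenation
of faces of the blocks of `e`. -/
inductive IsFace : Word → Word → Prop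
  | nil : IsFace [] []
  | cons {c₁ c₂ : Word} {S : Finset ℕ} {e : Word} :
      IsBlockFace c₁ S → IsFace c₂ e → IsFace (c₁ ++ c₂) (S :: e)

/-- The cells of the polytope `X`. -/
abbrev Cell (X : Word) := {c : Word // IsFace c X}

/-- The permutahedron `P_n` on `{1, …, n}`. -/
abbrev permutahedron (n : ℕ) : Word := [Finset.Icc 1 n]

/-- The permutocube `B_n` on `{0, 1, …, n}`. -/
abbrev permutocube (n : ℕ) : Word := [Finset.range (n + 1)]

/-- The cellular chains of the polytope `X`. -/
abbrev Chains (X : Word) := Cell X →₀ ℤ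

/-! ### The cellular differential -/

/-- The sign of the unshuffle `(A; M)`. -/
def shuff (A M : Finset ℕ) : ℤ := (-1) ^ ((A ×ˢ M).filter fun p => p.2 < p.1).card

/-- The boundary of the top cell of the polytope of one block.  For the permutocube on `S` it is
`∑ (-1)^(i+1) d_i + ∑ (-1)^#A shuff(A;M) A]M`, where `d_i` deletes the `i`-th element of
`S \ {0}`; for the permutahedron on `S` it is `∑ (-1)^#A shuff(A;M) A|M`. -/
noncomputable def blockBoundary (S : Finset ℕ) : Word →₀ ℤ :=
  if 0 ∈ S then
    (∑ j ∈ S.erase 0, Finsupp.single [S.erase j] ((-1) ^ ((S.filter (· < j)).card + 1))) +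
    ∑ A ∈ S.powerset.filter (fun A => 0 ∈ A ∧ A ≠ S),
      Finsupp.single [A, S \ A] ((-1) ^ A.card * shuff A (S \ A))
  else
    ∑ A ∈ S.powerset.filter (fun A => A ≠ ∅ ∧ A ≠ S),
      Finsupp.single [A, S \ A] ((-1) ^ A.card * shuff A (S \ A))

/-- The boundary of a cell, by the Leibniz rule with the usual sign. -/
noncomputable def cellBoundary : Word → (Word →₀ ℤ)
  | [] => 0
  | S :: e => (blockBoundary S).mapDomain (· ++ e) +
      (-1 : ℤ) ^ (S.card - 1) • (cellBoundary e).mapDomain (S :: ·)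

/-- The differential on the cellular chains of `X`: the value at a cell `e` is `cellBoundary e`,
read as a combination of cells of `X` (all the words occurring in it are cells of `X`, see
`isFace_of_mem_cellBoundary` and `IsFace.trans`). -/
noncomputable def boundary (X : Word) : Chains X →ₗ[ℤ] Chains X :=
  Finsupp.linearCombination ℤ fun e : Cell X =>
    (cellBoundary e.1).subtypeDomain (fun c => IsFace c X)

/-- The map `c ↦ (-1)^{dim c} c`. -/
noncomputable def gradeSign (X : Word) : Chains X →ₗ[ℤ] Chains X :=
  Finsupp.linearCombination ℤ fun e : Cell X => Finsupp.single e ((-1) ^ dim e.1)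

/-- The differential of `C_*(X) ⊗ C_*(X)`: `u ⊗ v ↦ du ⊗ v + (-1)^{dim u} u ⊗ dv`. -/
noncomputable def tensorBoundary (X : Word) :
    Chains X ⊗[ℤ] Chains X →ₗ[ℤ] Chains X ⊗[ℤ] Chains X :=
  TensorProduct.map (boundary X) LinearMap.id + TensorProduct.map (gradeSign X) (boundary X)

/-! ### Orthogonal streams -/

/-- The orderings of a finite set. -/
def orderings (T : Finset ℕ) : Finset (List ℕ) := (T.sort (· ≤ ·)).permutations.toFinset

/-- The vertices of the polytope of the block `S`.  The list `x₁, …, x_k` is the vertex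
`x₁|⋯|x_k` if `0 ∉ S` (then it is an ordering of `S`) and the vertex `0]x₁|⋯|x_k` if `0 ∈ S`
(then it is an ordering of a subset of `S \ {0}`). -/
def blockVertices (S : Finset ℕ) : Finset (List ℕ) :=
  if 0 ∈ S then (S.erase 0).powerset.biUnion orderings else orderings S

/-- The decreasing runs (maximal decreasing consecutive subsequences) of a list, as a word. -/
def decRuns (x : List ℕ) : Word := (x.splitBy fun a b => decide (b < a)).map List.toFinset

/-- The increasing runs of a list, as a word. -/
def incRuns (x : List ℕ) : Word := (x.splitBy fun a b => decide (a < b)).map List.toFinset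

/-- The first member `u_x` of the strong complementary pair of the vertex `x`: its blocks are the
decreasing runs of `x`, preceded, in the case of a permutocube, by the block of `0` and of the
elements not occurring in `x`. -/
def strongLeft (S : Finset ℕ) (x : List ℕ) : Word :=
  if 0 ∈ S then (S \ x.toFinset) :: decRuns x else decRuns x

/-- The second member `v_x` of the strong complementary pair of the vertex `x`: its blocks are the
increasing runs of `x`, where in the case of a permutocube `x` is `0]x₁|⋯|x_k`, read as the
sequence `0, x₁, …, x_k`. -/
def strongRight (S : Finset ℕ) (x : List ℕ) : Word :=
  if 0 ∈ S then incRuns (0 :: x) else incRuns x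

/-- All words `R_{M_{ℓ-1}} ⋯ R_{M_1} R_{M_0} (a)`: the operator `R_{M_i}` moves a proper subset
`M_i` of the `i`-th block to the `(i+1)`-st block, and is allowed if `M_i` is empty or
`min M_i` is greater than the maximum of the `(i+1)`-st block. -/
def rightShifts : Word → Finset Word
  | [] => {[]}
  | [A] => {[A]}
  | A :: B :: t =>
      (A.powerset.filter fun M => M ≠ A ∧ ∀ m ∈ M, ∀ b ∈ B, b < m).biUnion fun M =>
        (rightShifts ((B ∪ M) :: t)).image fun c => (A \ M) :: c
  termination_by a => a.length

/-- All results of one operator `L_{N_1}` applied to a word: it moves a proper subset `N_1` of the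
second block to the first block, and is allowed if `N_1` is empty or `min N_1` is greater than
the maximum of the first block. -/
def leftShiftHead (A : Finset ℕ) : Word → Finset Word
  | [] => {[A]}
  | B :: t => (B.powerset.filter fun N => N ≠ B ∧ ∀ m ∈ N, ∀ a ∈ A, a < m).image fun N =>
      (A ∪ N) :: (B \ N) :: t

/-- All words `L_{N_1} ⋯ L_{N_ℓ} (a)`: the operator `L_{N_j}` moves a proper subset `N_j` of the
`j`-th block to the `(j-1)`-st block, and is allowed if `N_j` is empty or `min N_j` is greater
than the maximum of the `(j-1)`-st block. -/
def leftShifts : Word → Finset Word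
  | [] => {[]}
  | A :: t => (leftShifts t).biUnion (leftShiftHead A)

/-- The triples `(x, u, v)` where `x` is a vertex of the polytope of the block `S` and `(u, v)` is
a complementary pair in the orthogonal stream `OS_x`. -/
def blockStream (S : Finset ℕ) : Finset (List ℕ × Word × Word) :=
  (blockVertices S).biUnion fun x =>
    {x} ×ˢ rightShifts (strongLeft S x) ×ˢ leftShifts (strongRight S x)

/-- The orthogonal streams of a product polytope `e`: a vertex of `e` is a tuple of vertices of
the factors, and a complementary pair of `e` is a tuple of complementary pairs of the factors. -/
def stream : Word → Finset (List (List ℕ × Word × Word))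
  | [] => {[]}
  | S :: e => (blockStream S ×ˢ stream e).image fun p => p.1 :: p.2

/-- The face `e₁` of a complementary pair `(e₁, e₂)` of a product polytope. -/
def left (ts : List (List ℕ × Word × Word)) : Word := (ts.map fun t => t.2.1).flatten

/-- The face `e₂` of a complementary pair `(e₁, e₂)` of a product polytope. -/
def right (ts : List (List ℕ × Word × Word)) : Word := (ts.map fun t => t.2.2).flatten

/-! ### Signs -/

/-- The number of inversions of a list. -/
def inversions : List ℕ → ℕ
  | [] => 0
  | a :: l => l.countP (fun b => decide (b < a)) + inversions l

/-- The sign of the permutation that lists the elements of `S` which are in no block of `a` in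
decreasing order, and then the blocks of `a` in their order, each of them increasingly. -/
def psgn (S : Finset ℕ) (a : Word) : ℤ :=
  (-1) ^ inversions
    ((S \ carrier a).sort (· ≥ ·) ++ a.flatMap fun A => A.sort (· ≤ ·))

/-- `ε₁ = ∑_{i=1}^{p} i · #A_{p-i}` for the word `A₀, …, A_p`. -/
def epsOne (a : Word) : ℕ :=
  ∑ i ∈ Finset.Icc 1 (a.length - 1), i * (a.getD (a.length - 1 - i) ∅).card

/-- `sgn₁ = (-1)^{ε₁} psgn`. -/
def sgnOne (S : Finset ℕ) (a : Word) : ℤ := (-1) ^ epsOne a * psgn S a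

/-- `sgn₂ = (-1)^{ε₂} psgn` with `ε₂ = ε₁ + (p choose 2)` for the word `A₀, …, A_p`. -/
def sgnTwo (S : Finset ℕ) (a : Word) : ℤ :=
  (-1) ^ (epsOne a + (a.length - 1).choose 2) * psgn S a

/-- `rsgn = (-1)^{((#A₀)² + ⋯ + (#A_p)² - #S) / 2}` for a partition `A₀, …, A_p` of `S`. -/
def rsgn (S : Finset ℕ) (a : Word) : ℤ :=
  (-1) ^ (((a.map fun A => A.card ^ 2).sum - S.card) / 2)

/-- The sign of the complementary pair `(u, v)` in the orthogonal stream of the vertex `x`. -/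
def blockSign (S : Finset ℕ) (t : List ℕ × Word × Word) : ℤ :=
  (-1) ^ (t.2.2.length.choose 2) * rsgn S (strongLeft S t.1) * sgnOne S t.2.2 *
    sgnTwo S t.2.1 * sgnTwo S (strongLeft S t.1)

/-- The sign of a complementary pair of a product polytope: the product of the signs of the
factors and of the Koszul sign for `(u₁ ⊗ v₁)(u₂ ⊗ v₂) ↦ u₁u₂ ⊗ v₁v₂`. -/
def streamSign : Word → List (List ℕ × Word × Word) → ℤ
  | S :: e, t :: ts => blockSign S t * streamSign e ts * (-1) ^ (dim t.2.2 * dim (left ts))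
  | _, _ => 1

/-! ### The words in the definitions above are cells -/

theorem mem_carrier {a : ℕ} {c : Word} : a ∈ carrier c ↔ ∃ A ∈ c, a ∈ A := by
  induction c with
  | nil => simp [carrier]
  | cons A t ih =>
    have h : carrier (A :: t) = A ∪ carrier t := rfl
    rw [h, Finset.mem_union, ih]
    simp

theorem IsFace.carrier_subset {c e : Word} (h : IsFace c e) : carrier c ⊆ carrier e := by
  induction h with
  | nil => exact subset_rfl
  | @cons c₁ c₂ S e h₁ _ ih =>
    intro a ha
    obtain ⟨A, hA, haA⟩ := mem_carrier.1 ha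
    rw [mem_carrier]
    rcases List.mem_append.1 hA with hA | hA
    · refine ⟨S, by simp, ?_⟩
      have hac : a ∈ carrier c₁ := mem_carrier.2 ⟨A, hA, haA⟩
      obtain ⟨_, _, h3⟩ := h₁
      split_ifs at h3 with h0
      · exact h3.2 hac
      · exact h3 ▸ hac
    · obtain ⟨B, hB, haB⟩ := mem_carrier.1 (ih (mem_carrier.2 ⟨A, hA, haA⟩))
      exact ⟨B, by simp [hB], haB⟩

theorem IsFace.carrier_eq {c e : Word} (h : IsFace c e) (h0 : 0 ∉ carrier e) :
    carrier c = carrier e := by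
  induction h with
  | nil => rfl
  | @cons c₁ c₂ S e h₁ _ ih =>
    have hS : 0 ∉ S := fun hS => h0 (mem_carrier.2 ⟨S, by simp, hS⟩)
    have he : 0 ∉ carrier e := fun he => h0 (by
      obtain ⟨B, hB, hb⟩ := mem_carrier.1 he
      exact mem_carrier.2 ⟨B, by simp [hB], hb⟩)
    have h3 := h₁.2.2
    rw [if_neg hS] at h3
    have ih := ih he
    ext a
    have e1 : a ∈ carrier (c₁ ++ c₂) ↔ a ∈ carrier c₁ ∨ a ∈ carrier c₂ := by
      simp only [mem_carrier, List.mem_append, or_and_right, exists_or]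
    have e2 : a ∈ carrier (S :: e) ↔ a ∈ S ∨ a ∈ carrier e := Finset.mem_union
    rw [e1, e2, h3, ih]

theorem IsFace.nonempty {c e : Word} (h : IsFace c e) : ∀ A ∈ c, A.Nonempty := by
  induction h with
  | nil => simp
  | cons h₁ _ ih =>
    intro A hA
    rcases List.mem_append.1 hA with hA | hA
    · exact h₁.1 A hA
    · exact ih A hA

theorem IsBlockFace.carrier_subset {c : Word} {S : Finset ℕ} (h : IsBlockFace c S) :
    carrier c ⊆ S := by
  have h3 := h.2.2
  split_ifs at h3 with h0
  · exact h3.2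
  · exact h3.subset

theorem IsFace.pairwise {c e : Word} (h : IsFace c e) (he : e.Pairwise Disjoint) :
    c.Pairwise Disjoint := by
  induction h with
  | nil => simp
  | @cons c₁ c₂ S e h₁ h₂ ih =>
    rw [List.pairwise_cons] at he
    rw [List.pairwise_append]
    refine ⟨h₁.2.1, ih he.2, fun A hA B hB => ?_⟩
    rw [Finset.disjoint_left]
    intro a haA haB
    have h1 := h₁.carrier_subset (mem_carrier.2 ⟨A, hA, haA⟩)
    obtain ⟨C, hC, haC⟩ := mem_carrier.1 (h₂.carrier_subset (mem_carrier.2 ⟨B, hB, haB⟩))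
    exact Finset.disjoint_left.1 (he.1 C hC) h1 haC

theorem IsBlockFace.trans {c f : Word} {S : Finset ℕ} (h : IsFace c f) (h' : IsBlockFace f S) :
    IsBlockFace c S := by
  refine ⟨h.nonempty, h.pairwise h'.2.1, ?_⟩
  have h3 := h'.2.2
  split_ifs at h3 ⊢ with h0
  · obtain ⟨⟨A, t, rfl, hA⟩, hs⟩ := h3
    refine ⟨?_, h.carrier_subset.trans hs⟩
    cases h with
    | @cons c₁ c₂ _ _ h₁ h₂ =>
      have h4 := h₁.2.2
      rw [if_pos hA] at h4
      obtain ⟨⟨A', t', rfl, hA'⟩, _⟩ := h4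
      exact ⟨A', t' ++ c₂, rfl, hA'⟩
  · rw [h.carrier_eq (by rwa [h3]), h3]

theorem IsFace.split {f₁ f₂ c : Word} (h : IsFace c (f₁ ++ f₂)) :
    ∃ c₁ c₂, c = c₁ ++ c₂ ∧ IsFace c₁ f₁ ∧ IsFace c₂ f₂ := by
  induction f₁ generalizing c with
  | nil => exact ⟨[], c, rfl, .nil, h⟩
  | cons S t ih =>
    cases h with
    | @cons c₁ c₂ _ _ h₁ h₂ =>
      obtain ⟨d₁, d₂, rfl, hd₁, hd₂⟩ := ih h₂
      exact ⟨c₁ ++ d₁, d₂, by simp, .cons h₁ hd₁, hd₂⟩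

theorem IsFace.trans {c f e : Word} (h : IsFace c f) (h' : IsFace f e) : IsFace c e := by
  induction h' generalizing c with
  | nil => exact h
  | cons h₁ _ ih =>
    obtain ⟨c₁, c₂, rfl, hc₁, hc₂⟩ := h.split
    exact .cons (h₁.trans hc₁) (ih hc₂)

theorem isFace_singleton {c : Word} {S : Finset ℕ} : IsFace c [S] ↔ IsBlockFace c S := by
  constructor
  · intro h
    cases h with
    | cons h₁ h₂ => cases h₂; simpa using h₁
  · intro h
    simpa using IsFace.cons h .nil

theorem IsBlockFace.refl {S : Finset ℕ} (h : S.Nonempty) : IsBlockFace [S] S := by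
  refine ⟨by simpa using h, by simp, ?_⟩
  split_ifs with h0
  · exact ⟨⟨S, [], rfl, h0⟩, by simp [carrier]⟩
  · simp [carrier]

theorem IsFace.refl {e : Word} (h : ∀ A ∈ e, A.Nonempty) : IsFace e e := by
  induction e with
  | nil => exact .nil
  | cons S t ih =>
    exact .cons (c₁ := [S]) (.refl (h S (by simp))) (ih fun A hA => h A (by simp [hA]))

theorem isBlockFace_of_mem_blockBoundary {S : Finset ℕ} {c : Word}
    (h : c ∈ (blockBoundary S).support) : IsBlockFace c S := by
  have key : ∀ (s : Finset (Finset ℕ)) (k : Finset ℕ → ℤ),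
      c ∈ (∑ A ∈ s, Finsupp.single ([A, S \ A] : Word) (k A)).support →
        ∃ A ∈ s, c = [A, S \ A] := by
    intro s k hc
    obtain ⟨A, hA, hcA⟩ := Finset.mem_biUnion.1 (Finsupp.support_finsetSum hc)
    exact ⟨A, hA, by simpa using Finsupp.support_single_subset hcA⟩
  have two : ∀ A : Finset ℕ, A ⊆ S → A.Nonempty → A ≠ S → (0 ∈ S → 0 ∈ A) →
      IsBlockFace [A, S \ A] S := by
    intro A hAS hA hne h0
    refine ⟨?_, by simp [Finset.disjoint_sdiff], ?_⟩
    · simp only [List.mem_cons, List.not_mem_nil, or_false, forall_eq_or_imp, forall_eq]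
      exact ⟨hA, Finset.sdiff_nonempty.2 fun hs => hne (hAS.antisymm hs)⟩
    · have hc : carrier [A, S \ A] = S := by
        simp [carrier, Finset.union_eq_right.2 hAS]
      split_ifs with hS
      · exact ⟨⟨_, _, rfl, h0 hS⟩, hc.subset⟩
      · exact hc
  unfold blockBoundary at h
  split_ifs at h with h0
  · rcases Finset.mem_union.1 (Finsupp.support_add h) with h | h
    · obtain ⟨j, hj, hcj⟩ := Finset.mem_biUnion.1 (Finsupp.support_finsetSum h)
      have : c = [S.erase j] := by simpa using Finsupp.support_single_subset hcj
      subst this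
      have h0' : 0 ∈ S.erase j :=
        Finset.mem_erase.2 ⟨(Finset.mem_erase.1 hj).1.symm, h0⟩
      refine ⟨by simpa using ⟨0, h0'⟩, by simp, ?_⟩
      rw [if_pos h0]
      exact ⟨⟨_, _, rfl, h0'⟩, by simpa [carrier] using Finset.erase_subset j S⟩
    · obtain ⟨A, hA, rfl⟩ := key _ _ h
      simp only [Finset.mem_filter, Finset.mem_powerset] at hA
      exact two A hA.1 ⟨0, hA.2.1⟩ hA.2.2 fun _ => hA.2.1
  · obtain ⟨A, hA, rfl⟩ := key _ _ h
    simp only [Finset.mem_filter, Finset.mem_powerset] at hA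
    exact two A hA.1 (Finset.nonempty_iff_ne_empty.2 hA.2.1) hA.2.2 fun h => absurd h h0

/-- All words occurring in the boundary of a cell `e` are faces of `e`. -/
theorem isFace_of_mem_cellBoundary {e : Word} (he : ∀ A ∈ e, A.Nonempty) {c : Word}
    (h : c ∈ (cellBoundary e).support) : IsFace c e := by
  induction e generalizing c with
  | nil => simp [cellBoundary] at h
  | cons S t ih =>
    have ht : ∀ A ∈ t, A.Nonempty := fun A hA => he A (by simp [hA])
    rw [cellBoundary] at h
    classical
    rcases Finset.mem_union.1 (Finsupp.support_add h) with h | h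
    · obtain ⟨f, hf, rfl⟩ := Finset.mem_image.1 (Finsupp.mapDomain_support h)
      exact .cons (isBlockFace_of_mem_blockBoundary hf) (.refl ht)
    · obtain ⟨f, hf, rfl⟩ :=
        Finset.mem_image.1 (Finsupp.mapDomain_support (Finsupp.support_smul h))
      exact .cons (c₁ := [S]) (.refl (he S (by simp))) (ih ht hf)

theorem carrier_cons {A : Finset ℕ} {t : Word} : carrier (A :: t) = A ∪ carrier t := rfl

/-- Shifts preserve partitions of a given set, and the place of `0` in the first block. -/
theorem rightShifts_aux (k : ℕ) : ∀ (a c : Word), a.length = k → (∀ A ∈ a, A.Nonempty) →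
    a.Pairwise Disjoint → c ∈ rightShifts a →
    (∀ A ∈ c, A.Nonempty) ∧ c.Pairwise Disjoint ∧ carrier c = carrier a ∧
      ((∃ A t, a = A :: t ∧ 0 ∈ A) → ∃ A t, c = A :: t ∧ 0 ∈ A) := by
  induction k with
  | zero =>
    intro a c hk h1 h2 hc
    obtain rfl := List.length_eq_zero_iff.1 hk
    rw [rightShifts, Finset.mem_singleton] at hc
    subst hc
    exact ⟨h1, h2, rfl, id⟩
  | succ k ih =>
    intro a c hk h1 h2 hc
    match a, hk, h1, h2, hc with
    | [A], hk, h1, h2, hc =>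
      rw [rightShifts, Finset.mem_singleton] at hc
      subst hc
      exact ⟨h1, h2, rfl, id⟩
    | A :: B :: t, hk, h1, h2, hc =>
      rw [rightShifts] at hc
      obtain ⟨M, hM, hc⟩ := Finset.mem_biUnion.1 hc
      obtain ⟨d, hd, rfl⟩ := Finset.mem_image.1 hc
      simp only [Finset.mem_filter, Finset.mem_powerset] at hM
      obtain ⟨hMA, hne, hM⟩ := hM
      simp only [List.pairwise_cons, List.mem_cons, forall_eq_or_imp] at h1 h2
      obtain ⟨hA, hB, ht⟩ := h1
      obtain ⟨⟨hAB, hAt⟩, hBt, htt⟩ := h2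
      obtain ⟨i1, i2, i3, _⟩ := ih ((B ∪ M) :: t) d (by simpa using hk)
        (by
          simp only [List.mem_cons, forall_eq_or_imp]
          exact ⟨hB.mono Finset.subset_union_left, ht⟩)
        (by
          rw [List.pairwise_cons]
          refine ⟨fun C hC => ?_, htt⟩
          rw [Finset.disjoint_union_left]
          exact ⟨hBt C hC, Finset.disjoint_of_subset_left hMA (hAt C hC)⟩) hd
      refine ⟨?_, ?_, ?_, ?_⟩
      · simp only [List.mem_cons, forall_eq_or_imp]
        exact ⟨Finset.sdiff_nonempty.2 fun hs => hne (hMA.antisymm hs), i1⟩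
      · rw [List.pairwise_cons]
        refine ⟨fun C hC => ?_, i2⟩
        rw [Finset.disjoint_left]
        intro a ha haC
        have hac : a ∈ carrier d := mem_carrier.2 ⟨C, hC, haC⟩
        rw [i3, carrier_cons, Finset.mem_union, Finset.mem_union] at hac
        rw [Finset.mem_sdiff] at ha
        rcases hac with (h | h) | h
        · exact Finset.disjoint_left.1 hAB ha.1 h
        · exact ha.2 h
        · obtain ⟨D, hD, haD⟩ := mem_carrier.1 h
          exact Finset.disjoint_left.1 (hAt D hD) ha.1 haD
      · rw [carrier_cons, i3, carrier_cons, carrier_cons, carrier_cons]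
        ext a
        have := @hMA a
        simp only [Finset.mem_union, Finset.mem_sdiff]
        tauto
      · rintro ⟨A', t', h, h0⟩
        obtain ⟨rfl, rfl⟩ := List.cons.inj h
        refine ⟨_, _, rfl, Finset.mem_sdiff.2 ⟨h0, fun h0M => ?_⟩⟩
        obtain ⟨b, hb⟩ := hB
        exact absurd (hM 0 h0M b hb) (Nat.not_lt_zero _)

theorem leftShifts_aux : ∀ (a c : Word), (∀ A ∈ a, A.Nonempty) →
    a.Pairwise Disjoint → c ∈ leftShifts a →
    (∀ A ∈ c, A.Nonempty) ∧ c.Pairwise Disjoint ∧ carrier c = carrier a ∧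
      ((∃ A t, a = A :: t ∧ 0 ∈ A) → ∃ A t, c = A :: t ∧ 0 ∈ A) := by
  intro a
  induction a with
  | nil =>
    intro c h1 h2 hc
    rw [leftShifts, Finset.mem_singleton] at hc
    subst hc
    exact ⟨h1, h2, rfl, id⟩
  | cons A t ih =>
    intro c h1 h2 hc
    rw [leftShifts] at hc
    obtain ⟨d, hd, hc⟩ := Finset.mem_biUnion.1 hc
    simp only [List.pairwise_cons, List.mem_cons, forall_eq_or_imp] at h1 h2
    obtain ⟨i1, i2, i3, _⟩ := ih d h1.2 h2.2 hd
    have hAd : ∀ C ∈ d, Disjoint A C := by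
      intro C hC
      rw [Finset.disjoint_left]
      intro a ha haC
      have hac : a ∈ carrier d := mem_carrier.2 ⟨C, hC, haC⟩
      rw [i3] at hac
      obtain ⟨D, hD, haD⟩ := mem_carrier.1 hac
      exact Finset.disjoint_left.1 (h2.1 D hD) ha haD
    rw [carrier_cons, ← i3]
    match d, i1, i2, hAd, hc with
    | [], i1, i2, hAd, hc =>
      rw [leftShiftHead, Finset.mem_singleton] at hc
      subst hc
      refine ⟨by simpa using h1.1, by simp, rfl, ?_⟩
      rintro ⟨A', t', h, h0⟩
      obtain ⟨rfl, rfl⟩ := List.cons.inj h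
      exact ⟨_, _, rfl, h0⟩
    | B :: s, i1, i2, hAd, hc =>
      rw [leftShiftHead] at hc
      obtain ⟨N, hN, rfl⟩ := Finset.mem_image.1 hc
      simp only [Finset.mem_filter, Finset.mem_powerset] at hN
      obtain ⟨hNB, hne, hN⟩ := hN
      simp only [List.pairwise_cons, List.mem_cons, forall_eq_or_imp] at i1 i2 hAd ⊢
      refine ⟨⟨h1.1.mono Finset.subset_union_left,
        Finset.sdiff_nonempty.2 fun hs => hne (hNB.antisymm hs), i1.2⟩,
        ⟨⟨?_, fun C hC => ?_⟩, fun C hC => ?_, i2.2⟩, ?_, ?_⟩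
      · rw [Finset.disjoint_union_left]
        exact ⟨Finset.disjoint_of_subset_right Finset.sdiff_subset hAd.1,
          Finset.disjoint_sdiff⟩
      · rw [Finset.disjoint_union_left]
        exact ⟨hAd.2 C hC, Finset.disjoint_of_subset_left hNB (i2.1 C hC)⟩
      · exact Finset.disjoint_of_subset_left Finset.sdiff_subset (i2.1 C hC)
      · simp only [carrier_cons]
        ext a
        have := @hNB a
        simp only [Finset.mem_union, Finset.mem_sdiff]
        tauto
      · rintro ⟨A', t', h, h0⟩
        obtain ⟨rfl, rfl⟩ := List.cons.inj h
        exact ⟨_, _, rfl, Finset.mem_union_left _ h0⟩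

theorem isBlockFace_of_mem_rightShifts {S : Finset ℕ} {a c : Word} (ha : IsBlockFace a S)
    (hc : c ∈ rightShifts a) : IsBlockFace c S := by
  obtain ⟨h1, h2, h3⟩ := ha
  obtain ⟨i1, i2, i3, i4⟩ := rightShifts_aux _ a c rfl h1 h2 hc
  refine ⟨i1, i2, ?_⟩
  split_ifs at h3 ⊢ with h0
  · exact ⟨i4 h3.1, i3 ▸ h3.2⟩
  · exact i3.trans h3

theorem isBlockFace_of_mem_leftShifts {S : Finset ℕ} {a c : Word} (ha : IsBlockFace a S)
    (hc : c ∈ leftShifts a) : IsBlockFace c S := by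
  obtain ⟨h1, h2, h3⟩ := ha
  obtain ⟨i1, i2, i3, i4⟩ := leftShifts_aux a c h1 h2 hc
  refine ⟨i1, i2, ?_⟩
  split_ifs at h3 ⊢ with h0
  · exact ⟨i4 h3.1, i3 ▸ h3.2⟩
  · exact i3.trans h3

theorem runs_aux (r : ℕ → ℕ → Bool) {x : List ℕ} (hx : x.Nodup) :
    (∀ A ∈ (x.splitBy r).map List.toFinset, A.Nonempty) ∧
      ((x.splitBy r).map List.toFinset).Pairwise Disjoint ∧
      carrier ((x.splitBy r).map List.toFinset) = x.toFinset := by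
  refine ⟨?_, ?_, ?_⟩
  · intro A hA
    obtain ⟨m, hm, rfl⟩ := List.mem_map.1 hA
    exact List.toFinset_nonempty_iff m |>.2 (List.ne_nil_of_mem_splitBy hm)
  · rw [← List.flatten_splitBy r x, List.nodup_flatten] at hx
    rw [List.pairwise_map]
    refine hx.2.imp fun {l m} h => ?_
    rw [Finset.disjoint_left]
    intro a hl hm
    exact h (List.mem_toFinset.1 hl) (List.mem_toFinset.1 hm)
  · ext a
    rw [mem_carrier, List.mem_toFinset]
    have h := List.mem_flatten (L := x.splitBy r) (a := a)
    rw [List.flatten_splitBy] at h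
    simp [h]

theorem mem_orderings {T : Finset ℕ} {x : List ℕ} (h : x ∈ orderings T) :
    x.Nodup ∧ x.toFinset = T := by
  rw [orderings, List.mem_toFinset, List.mem_permutations] at h
  refine ⟨h.nodup_iff.2 (Finset.sort_nodup _ _), ?_⟩
  rw [List.toFinset_eq_of_perm _ _ h, Finset.sort_toFinset]

theorem isBlockFace_strongLeft {S : Finset ℕ} {x : List ℕ} (hx : x ∈ blockVertices S) :
    IsBlockFace (strongLeft S x) S := by
  unfold blockVertices at hx
  unfold strongLeft decRuns
  split_ifs at hx ⊢ with h0
  · obtain ⟨T, hT, hx⟩ := Finset.mem_biUnion.1 hx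
    rw [Finset.mem_powerset] at hT
    obtain ⟨hn, rfl⟩ := mem_orderings hx
    obtain ⟨h1, h2, h3⟩ := runs_aux (fun a b => decide (b < a)) hn
    have h0x : 0 ∉ x.toFinset := fun h => (Finset.mem_erase.1 (hT h)).1 rfl
    have h0' : 0 ∈ S \ x.toFinset := Finset.mem_sdiff.2 ⟨h0, h0x⟩
    refine ⟨?_, ?_, ?_⟩
    · rw [List.forall_mem_cons]
      exact ⟨⟨0, h0'⟩, h1⟩
    · rw [List.pairwise_cons]
      refine ⟨fun C hC => ?_, h2⟩
      rw [Finset.disjoint_left]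
      intro a ha haC
      exact (Finset.mem_sdiff.1 ha).2 (h3 ▸ mem_carrier.2 ⟨C, hC, haC⟩)
    · rw [if_pos h0, carrier_cons, h3]
      refine ⟨⟨_, _, rfl, h0'⟩, ?_⟩
      exact Finset.union_subset Finset.sdiff_subset (hT.trans (Finset.erase_subset _ _))
  · obtain ⟨hn, rfl⟩ := mem_orderings hx
    obtain ⟨h1, h2, h3⟩ := runs_aux (fun a b => decide (b < a)) hn
    exact ⟨h1, h2, by rw [if_neg h0, h3]⟩

theorem isBlockFace_strongRight {S : Finset ℕ} {x : List ℕ} (hx : x ∈ blockVertices S) :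
    IsBlockFace (strongRight S x) S := by
  unfold blockVertices at hx
  unfold strongRight incRuns
  split_ifs at hx ⊢ with h0
  · obtain ⟨T, hT, hx⟩ := Finset.mem_biUnion.1 hx
    rw [Finset.mem_powerset] at hT
    obtain ⟨hn, rfl⟩ := mem_orderings hx
    have h0x : 0 ∉ x := fun h =>
      (Finset.mem_erase.1 (hT (List.mem_toFinset.2 h))).1 rfl
    obtain ⟨h1, h2, h3⟩ := runs_aux (fun a b => decide (a < b)) (List.nodup_cons.2 ⟨h0x, hn⟩)
    refine ⟨h1, h2, ?_⟩
    rw [if_pos h0, h3]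
    refine ⟨?_, ?_⟩
    · have hhead := List.head_head_splitBy (fun a b : ℕ => decide (a < b))
        (List.cons_ne_nil 0 x)
      have hne : (0 :: x).splitBy (fun a b => decide (a < b)) ≠ [] :=
        List.splitBy_ne_nil.2 (List.cons_ne_nil 0 x)
      obtain ⟨g, gs, hg⟩ := List.exists_cons_of_ne_nil hne
      simp only [hg, List.head_cons] at hhead
      refine ⟨g.toFinset, gs.map List.toFinset, by simp [hg], ?_⟩
      rw [List.mem_toFinset, ← hhead]
      exact List.head_mem _
    · rw [List.toFinset_cons]
      exact Finset.insert_subset h0 (hT.trans (Finset.erase_subset _ _))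
  · obtain ⟨hn, rfl⟩ := mem_orderings hx
    obtain ⟨h1, h2, h3⟩ := runs_aux (fun a b => decide (a < b)) hn
    exact ⟨h1, h2, by rw [if_neg h0, h3]⟩

theorem isFace_of_mem_stream {e : Word} {ts : List (List ℕ × Word × Word)}
    (h : ts ∈ stream e) : IsFace (left ts) e ∧ IsFace (right ts) e := by
  induction e generalizing ts with
  | nil =>
    rw [stream, Finset.mem_singleton] at h
    subst h
    exact ⟨.nil, .nil⟩
  | cons S t ih =>
    rw [stream] at h
    obtain ⟨⟨p, ps⟩, hp, rfl⟩ := Finset.mem_image.1 h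
    obtain ⟨hp, hps⟩ := Finset.mem_product.1 hp
    obtain ⟨x, hx, hp⟩ := Finset.mem_biUnion.1 hp
    simp only [Finset.mem_product, Finset.mem_singleton] at hp
    obtain ⟨_, hu, hv⟩ := hp
    exact ⟨.cons (isBlockFace_of_mem_rightShifts (isBlockFace_strongLeft hx) hu) (ih hps).1,
      .cons (isBlockFace_of_mem_leftShifts (isBlockFace_strongRight hx) hv) (ih hps).2⟩

theorem isFace_zero_cons {n : ℕ} {c : Word} (h : IsFace c (permutahedron n)) :
    IsFace ({0} :: c) (permutocube n) := by
  rw [isFace_singleton] at h ⊢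
  obtain ⟨h1, h2, h3⟩ := h
  rw [if_neg (by simp)] at h3
  refine ⟨by simpa using h1, ?_, ?_⟩
  · rw [List.pairwise_cons]
    refine ⟨fun A hA => ?_, h2⟩
    rw [Finset.disjoint_singleton_left]
    intro h0
    have := h3 ▸ mem_carrier.2 ⟨A, hA, h0⟩
    simp at this
  · rw [if_pos (by simp)]
    refine ⟨⟨_, _, rfl, by simp⟩, ?_⟩
    change {0} ∪ carrier c ⊆ _
    rw [h3]
    intro a
    simp
    omega

/-! ### The diagonal -/

/-- The diagonal on the cellular chains of `X`: on a cell `e` it is the sum over all orthogonal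
streams of `e` of `sgn(e₁, e₂) e₁ ⊗ e₂`.  For `X = permutocube n` this is `Δ_B`, for
`X = permutahedron n` it is `Δ_P`. -/
noncomputable def diagonal (X : Word) : Chains X →ₗ[ℤ] Chains X ⊗[ℤ] Chains X :=
  Finsupp.linearCombination ℤ fun e : Cell X =>
    ∑ ts ∈ (stream e.1).attach, streamSign e.1 ts.1 •
      (Finsupp.single (⟨left ts.1, (isFace_of_mem_stream ts.2).1.trans e.2⟩ : Cell X) (1 : ℤ)
        ⊗ₜ[ℤ]
       Finsupp.single (⟨right ts.1, (isFace_of_mem_stream ts.2).2.trans e.2⟩ : Cell X) (1 : ℤ))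

/-- The inclusion `δ_{0]n}` of the cells of `P_n` into those of `B_n`:
`A₁|⋯|A_p ↦ 0]A₁|⋯|A_p`. -/
def faceInclusion (n : ℕ) (c : Cell (permutahedron n)) : Cell (permutocube n) :=
  ⟨{0} :: c.1, isFace_zero_cons c.2⟩

/-- The inclusion `δ_{0]n} : C_*(P_n) → C_*(B_n)` on chains. -/
noncomputable def chainInclusion (n : ℕ) :
    Chains (permutahedron n) →ₗ[ℤ] Chains (permutocube n) :=
  Finsupp.lmapDomain ℤ ℤ (faceInclusion n)

/-- `d` is a differential on the graded group of cellular chains: it sends a cell to a combination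
of its faces of one dimension less, and `d ∘ d = 0`. -/
structure IsCellularDifferential (X : Word) (d : Chains X →ₗ[ℤ] Chains X) : Prop where
  supported : ∀ e : Cell X, d (Finsupp.single e 1) ∈
    Submodule.span ℤ {w | ∃ f : Cell X, IsFace f.1 e.1 ∧ dim f.1 + 1 = dim e.1 ∧
      w = Finsupp.single f 1}
  comp_self : d ∘ₗ d = 0

/-- `Δ` is a cellular diagonal, i.e. a chain approximation to the geometric diagonal of `X`: it is
a chain map of degree `0` which sends each cell `e` into the chains of `e × e` and each vertex `x`
to `x ⊗ x`. -/
structure IsCellularDiagonal (X : Word) (Δ : Chains X →ₗ[ℤ] Chains X ⊗[ℤ] Chains X) : Prop where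
  supported : ∀ e : Cell X, Δ (Finsupp.single e 1) ∈
    Submodule.span ℤ {w | ∃ u v : Cell X, IsFace u.1 e.1 ∧ IsFace v.1 e.1 ∧
      dim u.1 + dim v.1 = dim e.1 ∧ w = Finsupp.single u (1 : ℤ) ⊗ₜ[ℤ] Finsupp.single v (1 : ℤ)}
  vertex : ∀ x : Cell X, dim x.1 = 0 →
    Δ (Finsupp.single x 1) = Finsupp.single x (1 : ℤ) ⊗ₜ[ℤ] Finsupp.single x (1 : ℤ)
  chain_map : tensorBoundary X ∘ₗ Δ = Δ ∘ₗ boundary X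

end Permutocube

/-!
Every object is expressed in the ring `BiChain` of pairs of words `u ⊗ v` with the Koszul-signed
concatenation as product. In it the diagonal of a product cell is the product of the diagonals of
its blocks (`wordDiag_eq_sum_stream`), the differential of `C_* ⊗ C_*` is an odd derivation, and
`C_*(X) ⊗ C_*(X)` is a subgroup (`toBiChain_injective`). It therefore suffices to treat the top
cell of one block `S`, whose diagonal is written `τ(S)`.

*A recursive diagonal.* For the shuffle-signed convolution `(f * g)(S) = ∑ ± f(A) g(S \ A)` of
functions on finite sets, being a chain map on permutahedra is the twisting equation
`∂τ = (ατ) * τ`, with `(ατ)(S) = (-1)^{#S} τ(S)`. A solution `permDiag` is built by adding a new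
maximal element `n`: the value at `S ∪ {n}` is the convolution at `S` of two extensions of `τ`, one
joining `n` to the blocks of the right factor and one joining it to those of the left factor.
Joining `n` is an odd derivation that anticommutes with `∂` up to the commutator with the block
`{n}` (`defect_joinLeft`, `defect_joinRight`), and this alone propagates the twisting equation
(`der_conv_extend`, `permDer_permDiag`).

*From permutahedra to permutocubes.* If `0 ∈ S`, the permutocube on `S` is a cellular quotient of
the permutahedron on `S`: elements that form singleton blocks before the block of `0` are deleted,
and the other cells with blocks before that of `0` are collapsed. This projection is a chain map
(`projectLin_wordDer`), so that `d² = 0` and the chain map property of the projected diagonal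
`cubeDiag` are inherited (`wordDerLin_blockBoundary`, `cellDer_cubeDiag`). The recursion for
`permDiag` projects to one for `cubeDiag`, with one extra term where `n` is deleted
(`cubeDiag_succ`).

*Orthogonal streams satisfy the recursion.* A vertex on `S ∪ {n}` is either `x₁|n|x₂`, with `x₁` and
`x₂` vertices on the two parts of a splitting of `S`, or a vertex on `S` with `n` deleted. In the
first case `n` joins the last increasing run of `x₁` and the first decreasing run of `x₂`; nothing
can be shifted past the block that contains `n` from one part into the other, and inside a part the
shifts move `n` to an arbitrary later (respectively earlier) block, independently of all other
elements (`sum_rightShifts_insert`, `sum_leftShifts_insertLast`). So the stream of `x₁|n|x₂` is the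
product of the streams of `x₁` and `x₂` with `n` joined to the blocks of the right members of the
first and of the left members of the second; the signs agree by `blockSign_split` and
`blockSign_delete`. This is `streamSum_insert`, and induction on `n` gives `streamSum_eq_permDiag`
and `streamSum_eq_cubeDiag`.
-/

namespace Permutocube

/-! ### The ring of pairs of words -/

/-- The free abelian group on pairs of words `(u, v)`, standing for `u ⊗ v`.  It carries the ring
structure given by concatenation in both factors with the Koszul sign. -/
def BiChain : Type := (Word × Word) →₀ ℤ

namespace BiChain

noncomputable instance : AddCommGroup BiChain :=
  inferInstanceAs (AddCommGroup ((Word × Word) →₀ ℤ))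

/-- The basis element `u ⊗ v`. -/
noncomputable def pair (u v : Word) : BiChain := Finsupp.single (M := ℤ) (u, v) 1

/-- The linear map with prescribed values on the basis elements `u ⊗ v`. -/
noncomputable def lift {M : Type*} [AddCommGroup M] (f : Word → Word → M) : BiChain →ₗ[ℤ] M :=
  Finsupp.linearCombination (α := Word × Word) ℤ fun p => f p.1 p.2

@[simp] theorem lift_pair {M : Type*} [AddCommGroup M] (f : Word → Word → M) (u v : Word) :
    lift f (pair u v) = f u v :=
  (Finsupp.linearCombination_single (α := Word × Word) ℤ _ _).trans (one_smul _ _)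

theorem hom_ext {M : Type*} [AddCommGroup M] {f g : BiChain →ₗ[ℤ] M}
    (h : ∀ u v, f (pair u v) = g (pair u v)) : f = g :=
  Finsupp.lhom_ext' (α := Word × Word) fun p => LinearMap.ext_ring (h p.1 p.2)

@[elab_as_elim]
theorem induction_on {p : BiChain → Prop} (x : BiChain) (pair : ∀ u v, p (pair u v))
    (add : ∀ x y, p x → p y → p (x + y)) (smul : ∀ (k : ℤ) x, p x → p (k • x)) : p x := by
  refine Finsupp.induction_linear (motive := p) x ?_ add fun q k => ?_
  · have := smul 0 _ (pair [] [])
    rwa [zero_smul] at this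
  · have := smul k _ (pair q.1 q.2)
    have h : k • BiChain.pair q.1 q.2 = Finsupp.single (M := ℤ) q k := by
      refine (Finsupp.smul_single (α := Word × Word) k q (1 : ℤ)).trans ?_
      simp
    rwa [h] at this

/-- The Koszul product `(u ⊗ v)(u' ⊗ v') = (-1)^{dim v dim u'} uu' ⊗ vv'`. -/
noncomputable def mulHom : BiChain →ₗ[ℤ] BiChain →ₗ[ℤ] BiChain :=
  lift fun u v => lift fun u' v' => (-1 : ℤ) ^ (dim v * dim u') • pair (u ++ u') (v ++ v')

noncomputable instance : Mul BiChain := ⟨fun x y => mulHom x y⟩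

theorem mul_def (x y : BiChain) : x * y = mulHom x y := rfl

@[simp] theorem _root_.Permutocube.dim_nil : dim [] = 0 := rfl

@[simp] theorem _root_.Permutocube.dim_cons (A : Finset ℕ) (t : Word) :
    dim (A :: t) = (A.card - 1) + dim t := by
  simp [dim]

@[simp] theorem _root_.Permutocube.dim_append (u v : Word) : dim (u ++ v) = dim u + dim v := by
  simp [dim]

theorem pair_mul_pair (u v u' v' : Word) :
    pair u v * pair u' v' = (-1 : ℤ) ^ (dim v * dim u') • pair (u ++ u') (v ++ v') := by
  simp [mul_def, mulHom]

noncomputable instance : Ring BiChain where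
  __ := (inferInstance : AddCommGroup BiChain)
  one := pair [] []
  left_distrib x y z := by simp only [mul_def, map_add]
  right_distrib x y z := by simp only [mul_def, map_add, LinearMap.add_apply]
  zero_mul x := by simp only [mul_def, map_zero, LinearMap.zero_apply]
  mul_zero x := by simp only [mul_def, map_zero]
  one_mul x := by
    change pair [] [] * x = x
    induction x using induction_on with
    | pair u v => simp [pair_mul_pair]
    | add x y hx hy => rw [mul_def] at *; rw [map_add, hx, hy]
    | smul k x hx => rw [mul_def] at *; rw [map_smul, hx]
  mul_one x := by
    change x * pair [] [] = x
    induction x using induction_on with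
    | pair u v => simp [pair_mul_pair]
    | add x y hx hy =>
      rw [mul_def] at *; rw [map_add, LinearMap.add_apply, hx, hy]
    | smul k x hx => rw [mul_def] at *; rw [map_smul, LinearMap.smul_apply, hx]
  mul_assoc x y z := by
    simp only [mul_def]
    induction x using induction_on with
    | add x y hx hy => simp only [map_add, LinearMap.add_apply, hx, hy]
    | smul k x hx => simp only [map_smul, LinearMap.smul_apply, hx]
    | pair u v =>
      induction y using induction_on with
      | add x y hx hy => simp only [map_add, LinearMap.add_apply, hx, hy]
      | smul k x hx => simp only [map_smul, LinearMap.smul_apply, hx]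
      | pair u' v' =>
        induction z using induction_on with
        | add x y hx hy => simp only [map_add, hx, hy]
        | smul k x hx => simp only [map_smul, hx]
        | pair u'' v'' =>
          simp only [← mul_def, pair_mul_pair]
          simp only [mul_def, map_smul, LinearMap.smul_apply]
          simp only [← mul_def, pair_mul_pair, smul_smul, List.append_assoc, ← pow_add, dim_append]
          congr 2
          ring

theorem one_def : (1 : BiChain) = pair [] [] := rfl

/-- Chains on words as the left factor: `u ↦ u ⊗ 1`. -/
noncomputable def inl : (Word →₀ ℤ) →ₗ[ℤ] BiChain :=
  Finsupp.linearCombination ℤ fun u => pair u []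

/-- Chains on words as the right factor: `v ↦ 1 ⊗ v`. -/
noncomputable def inr : (Word →₀ ℤ) →ₗ[ℤ] BiChain :=
  Finsupp.linearCombination ℤ fun v => pair [] v

@[simp] theorem inl_single (u : Word) (k : ℤ) : inl (Finsupp.single u k) = k • pair u [] := by
  simp [inl]

@[simp] theorem inr_single (u : Word) (k : ℤ) : inr (Finsupp.single u k) = k • pair [] u := by
  simp [inr]

theorem inl_mapDomain_append (x : Word →₀ ℤ) (e : Word) :
    inl (x.mapDomain (· ++ e)) = inl x * pair e [] := by
  induction x using Finsupp.induction_linear with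
  | zero => simp
  | add x y hx hy => simp only [Finsupp.mapDomain_add, map_add, hx, hy, add_mul]
  | single u k => simp [Finsupp.mapDomain_single, pair_mul_pair, -zsmul_eq_mul]

theorem inr_mapDomain_append (x : Word →₀ ℤ) (e : Word) :
    inr (x.mapDomain (· ++ e)) = inr x * pair [] e := by
  induction x using Finsupp.induction_linear with
  | zero => simp
  | add x y hx hy => simp only [Finsupp.mapDomain_add, map_add, hx, hy, add_mul]
  | single u k => simp [Finsupp.mapDomain_single, pair_mul_pair, -zsmul_eq_mul]

theorem inl_mapDomain_cons (x : Word →₀ ℤ) (S : Finset ℕ) :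
    inl (x.mapDomain (S :: ·)) = pair [S] [] * inl x := by
  induction x using Finsupp.induction_linear with
  | zero => simp
  | add x y hx hy => simp only [Finsupp.mapDomain_add, map_add, hx, hy, mul_add]
  | single u k => simp [Finsupp.mapDomain_single, pair_mul_pair, -zsmul_eq_mul]

theorem inr_mapDomain_cons (x : Word →₀ ℤ) (S : Finset ℕ) :
    inr (x.mapDomain (S :: ·)) = pair [] [S] * inr x := by
  induction x using Finsupp.induction_linear with
  | zero => simp
  | add x y hx hy => simp only [Finsupp.mapDomain_add, map_add, hx, hy, mul_add]
  | single u k => simp [Finsupp.mapDomain_single, pair_mul_pair, -zsmul_eq_mul]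

/-- The grading automorphism `u ⊗ v ↦ (-1)^{dim u + dim v} u ⊗ v`. -/
noncomputable def grade : BiChain →ₗ[ℤ] BiChain :=
  lift fun u v => (-1 : ℤ) ^ (dim u + dim v) • pair u v

@[simp] theorem grade_pair (u v : Word) :
    grade (pair u v) = (-1 : ℤ) ^ (dim u + dim v) • pair u v := by simp [grade]

theorem grade_mul (x y : BiChain) : grade (x * y) = grade x * grade y := by
  induction x using induction_on with
  | add x y hx hy => simp only [map_add, add_mul, hx, hy]
  | smul k x hx => simp only [map_smul, smul_mul_assoc, hx]
  | pair u v =>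
    induction y using induction_on with
    | add x y hx hy => simp only [map_add, mul_add, hx, hy]
    | smul k x hx => simp only [map_smul, mul_smul_comm, hx]
    | pair u' v' =>
      simp only [pair_mul_pair, map_smul, grade_pair, dim_append, smul_smul, smul_mul_assoc,
        mul_smul_comm, ← pow_add]
      congr 2
      ring

/-! ### Odd derivations -/

/-- `D` is an odd derivation of the graded ring of pairs of words. -/
structure IsOddDerivation (D : BiChain →ₗ[ℤ] BiChain) : Prop where
  leibniz : ∀ x y, D (x * y) = D x * y + grade x * D y
  grade_comm : ∀ x, grade (D x) = -D (grade x)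

end BiChain

open BiChain

/-- The extension of a map `f` from blocks to words by the Leibniz rule, with the sign
`(-1)^{dim}` of the preceding blocks. -/
noncomputable def wordDer (f : Finset ℕ → (Word →₀ ℤ)) : Word → (Word →₀ ℤ)
  | [] => 0
  | S :: e => (f S).mapDomain (· ++ e) +
      (-1 : ℤ) ^ (S.card - 1) • (wordDer f e).mapDomain (S :: ·)

theorem cellBoundary_eq_wordDer (w : Word) : cellBoundary w = wordDer blockBoundary w := by
  induction w with
  | nil => rfl
  | cons S e ih => rw [cellBoundary, wordDer, ih]

/-- The words of `x` have dimension of the parity opposite to `k`. -/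
def OddShift (x : Word →₀ ℤ) (k : ℕ) : Prop := ∀ w ∈ x.support, Odd (dim w + k)

theorem OddShift.single {w : Word} {k : ℕ} (h : Odd (dim w + k)) (c : ℤ) :
    OddShift (Finsupp.single w c) k := by
  intro w' hw'
  rw [Finset.mem_singleton.1 (Finsupp.support_single_subset hw')]
  exact h

theorem OddShift.add {x y : Word →₀ ℤ} {k : ℕ} (hx : OddShift x k) (hy : OddShift y k) :
    OddShift (x + y) k := by
  intro w hw
  classical
  rcases Finset.mem_union.1 (Finsupp.support_add hw) with h | h
  exacts [hx w h, hy w h]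

theorem OddShift.sum {ι : Type*} {s : Finset ι} {x : ι → (Word →₀ ℤ)} {k : ℕ}
    (h : ∀ i ∈ s, OddShift (x i) k) : OddShift (∑ i ∈ s, x i) k := by
  classical
  induction s using Finset.induction_on with
  | empty => intro w hw; simp at hw
  | insert a s ha ih =>
    rw [Finset.sum_insert ha]
    exact (h a (by simp)).add (ih fun i hi => h i (by simp [hi]))

theorem oddShift_wordDer {f : Finset ℕ → (Word →₀ ℤ)} (hf : ∀ S, OddShift (f S) (S.card - 1))
    (w : Word) : OddShift (wordDer f w) (dim w) := by
  classical
  induction w with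
  | nil => intro w hw; simp [wordDer] at hw
  | cons S e ih =>
    rw [wordDer]
    refine OddShift.add ?_ ?_ <;> intro w hw
    · obtain ⟨c, hc, rfl⟩ := Finset.mem_image.1 (Finsupp.mapDomain_support hw)
      have := hf S c hc
      simp only [dim_append, dim_cons, Nat.odd_add, Nat.even_add] at this ⊢
      grind
    · obtain ⟨c, hc, rfl⟩ :=
        Finset.mem_image.1 (Finsupp.mapDomain_support (Finsupp.support_smul hw))
      have := ih c hc
      simp only [dim_cons, Nat.odd_add, Nat.even_add] at this ⊢
      grind

namespace BiChain

/-- An identity that is linear in a chain `x` whose words have parity opposite to `k` may be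
checked on those words. -/
theorem oddShift_induction {x : Word →₀ ℤ} {k : ℕ} (hx : OddShift x k)
    {M : Type*} [AddCommGroup M] (f g : (Word →₀ ℤ) →ₗ[ℤ] M)
    (h : ∀ w, Odd (dim w + k) → f (Finsupp.single w 1) = g (Finsupp.single w 1)) : f x = g x := by
  rw [← Finsupp.sum_single x, Finsupp.sum, map_sum, map_sum]
  refine Finset.sum_congr rfl fun w hw => ?_
  have := h w (hx w hw)
  rw [← mul_one (x w), ← smul_eq_mul, ← Finsupp.smul_single, map_smul, map_smul, this]

theorem pair_nil_mul_inl {x : Word →₀ ℤ} {k : ℕ} (hx : OddShift x k) (v : Word) :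
    pair [] v * inl x = (-1 : ℤ) ^ (dim v * (k + 1)) • (inl x * pair [] v) := by
  refine oddShift_induction hx ((LinearMap.mulLeft ℤ (pair [] v)) ∘ₗ inl)
    ((-1 : ℤ) ^ (dim v * (k + 1)) • ((LinearMap.mulRight ℤ (pair [] v)) ∘ₗ inl)) fun w hw => ?_
  simp only [LinearMap.comp_apply, LinearMap.smul_apply, LinearMap.mulLeft_apply,
    LinearMap.mulRight_apply, inl_single, one_smul, pair_mul_pair, smul_smul, ← pow_add,
    List.nil_append, List.append_nil, dim_nil, zero_mul, add_zero]
  congr 1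
  apply neg_one_pow_congr
  simp only [Nat.odd_add, Nat.even_mul, Nat.even_add] at *
  grind

theorem inr_mul_pair_nil {x : Word →₀ ℤ} {k : ℕ} (hx : OddShift x k) (u : Word) :
    inr x * pair u [] = (-1 : ℤ) ^ ((k + 1) * dim u) • (pair u [] * inr x) := by
  refine oddShift_induction hx ((LinearMap.mulRight ℤ (pair u [])) ∘ₗ inr)
    ((-1 : ℤ) ^ ((k + 1) * dim u) • ((LinearMap.mulLeft ℤ (pair u [])) ∘ₗ inr)) fun w hw => ?_
  simp only [LinearMap.comp_apply, LinearMap.smul_apply, LinearMap.mulLeft_apply,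
    LinearMap.mulRight_apply, inr_single, one_smul, pair_mul_pair, smul_smul, ← pow_add,
    List.nil_append, List.append_nil, dim_nil, zero_mul, add_zero]
  congr 1
  apply neg_one_pow_congr
  simp only [Nat.odd_add, Nat.even_mul, Nat.even_add] at *
  grind

theorem grade_inl {x : Word →₀ ℤ} {k : ℕ} (hx : OddShift x k) :
    grade (inl x) = (-1 : ℤ) ^ (k + 1) • inl x := by
  refine oddShift_induction hx (grade ∘ₗ inl) ((-1 : ℤ) ^ (k + 1) • inl) fun w hw => ?_
  simp only [LinearMap.comp_apply, LinearMap.smul_apply, inl_single, one_smul, grade_pair, dim_nil]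
  congr 1
  apply neg_one_pow_congr
  simp only [Nat.odd_add, Nat.even_add] at *
  grind

theorem grade_inr {x : Word →₀ ℤ} {k : ℕ} (hx : OddShift x k) :
    grade (inr x) = (-1 : ℤ) ^ (k + 1) • inr x := by
  refine oddShift_induction hx (grade ∘ₗ inr) ((-1 : ℤ) ^ (k + 1) • inr) fun w hw => ?_
  simp only [LinearMap.comp_apply, LinearMap.smul_apply, inr_single, one_smul, grade_pair, dim_nil]
  congr 1
  apply neg_one_pow_congr
  simp only [Nat.odd_add, Nat.even_add] at *
  grind

theorem inl_wordDer_append (f : Finset ℕ → (Word →₀ ℤ)) (u u' : Word) :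
    inl (wordDer f (u ++ u')) =
      inl (wordDer f u) * pair u' [] + (-1 : ℤ) ^ dim u • (pair u [] * inl (wordDer f u')) := by
  induction u with
  | nil => simp [wordDer, ← one_def]
  | cons S e ih =>
    have h1 : pair (e ++ u') [] = pair e [] * pair u' [] := by simp [pair_mul_pair]
    have h2 : pair (S :: e) [] = pair [S] [] * pair e [] := by simp [pair_mul_pair]
    simp only [List.cons_append, wordDer, map_add, map_smul, inl_mapDomain_append,
      inl_mapDomain_cons, ih, h1, h2, add_mul, smul_mul_assoc, mul_add, mul_smul_comm, smul_add,
      smul_smul, ← pow_add, dim_cons, mul_assoc, add_assoc]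

theorem inr_wordDer_append (f : Finset ℕ → (Word →₀ ℤ)) (u u' : Word) :
    inr (wordDer f (u ++ u')) =
      inr (wordDer f u) * pair [] u' + (-1 : ℤ) ^ dim u • (pair [] u * inr (wordDer f u')) := by
  induction u with
  | nil => simp [wordDer, ← one_def]
  | cons S e ih =>
    have h1 : pair [] (e ++ u') = pair [] e * pair [] u' := by simp [pair_mul_pair]
    have h2 : pair [] (S :: e) = pair [] [S] * pair [] e := by simp [pair_mul_pair]
    simp only [List.cons_append, wordDer, map_add, map_smul, inr_mapDomain_append,
      inr_mapDomain_cons, ih, h1, h2, add_mul, smul_mul_assoc, mul_add, mul_smul_comm, smul_add,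
      smul_smul, ← pow_add, dim_cons, mul_assoc, add_assoc]

/-- The map `f ⊗ 1 + ε ⊗ g`, where `f` and `g` are extended from blocks to words as derivations
and `ε` is the grading automorphism. -/
noncomputable def der (f g : Finset ℕ → (Word →₀ ℤ)) : BiChain →ₗ[ℤ] BiChain :=
  lift fun u v => inl (wordDer f u) * pair [] v +
    (-1 : ℤ) ^ dim u • (pair u [] * inr (wordDer g v))

theorem der_pair (f g : Finset ℕ → (Word →₀ ℤ)) (u v : Word) :
    der f g (pair u v) = inl (wordDer f u) * pair [] v +
      (-1 : ℤ) ^ dim u • (pair u [] * inr (wordDer g v)) := by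
  simp [der]

theorem isOddDerivation_der {f g : Finset ℕ → (Word →₀ ℤ)}
    (hf : ∀ S, OddShift (f S) (S.card - 1)) (hg : ∀ S, OddShift (g S) (S.card - 1)) :
    IsOddDerivation (der f g) where
  leibniz x y := by
    induction x using induction_on with
    | add x y hx hy => simp only [map_add, add_mul, hx, hy]; abel
    | smul k x hx => simp only [map_smul, smul_mul_assoc, hx, smul_add]
    | pair u v =>
      induction y using induction_on with
      | add x y hx hy => simp only [map_add, mul_add, hx, hy]; abel
      | smul k x hx => simp only [map_smul, mul_smul_comm, hx, smul_add]
      | pair u' v' =>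
        have hp : ∀ a b : Word, pair a b = pair a [] * pair [] b := fun a b => by
          simp [pair_mul_pair]
        have hl : ∀ a b : Word, pair (a ++ b) [] = pair a [] * pair b [] := fun a b => by
          simp [pair_mul_pair]
        have hr : ∀ a b : Word, pair [] (a ++ b) = pair [] a * pair [] b := fun a b => by
          simp [pair_mul_pair]
        have hc : pair [] v * pair u' [] = (-1 : ℤ) ^ (dim v * dim u') • (pair u' [] * pair [] v) :=
          by simp [pair_mul_pair]
        have c1 := pair_nil_mul_inl (oddShift_wordDer hf u') v
        have c2 := inr_mul_pair_nil (oddShift_wordDer hg v) u'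
        have hc' : ∀ z, pair [] v * (pair u' [] * z) =
            (-1 : ℤ) ^ (dim v * dim u') • (pair u' [] * (pair [] v * z)) := fun z => by
          rw [← mul_assoc, hc, smul_mul_assoc, mul_assoc]
        have c1' : ∀ z, pair [] v * (inl (wordDer f u') * z) =
            (-1 : ℤ) ^ (dim v * (dim u' + 1)) • (inl (wordDer f u') * (pair [] v * z)) := by
          intro z
          rw [← mul_assoc, c1, smul_mul_assoc, mul_assoc]
        have c2' : ∀ z, inr (wordDer g v) * (pair u' [] * z) =
            (-1 : ℤ) ^ ((dim v + 1) * dim u') • (pair u' [] * (inr (wordDer g v) * z)) := by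
          intro z
          rw [← mul_assoc, c2, smul_mul_assoc, mul_assoc]
        rw [pair_mul_pair, map_smul, grade_pair, der_pair, der_pair, der_pair,
          inl_wordDer_append, inr_wordDer_append, hl, hr, hp u v, hp u' v']
        simp only [add_mul, mul_add, smul_mul_assoc, mul_smul_comm, smul_add, smul_smul, mul_assoc,
          hc', c1', c2', ← pow_add, dim_append]
        have e1 : (-1 : ℤ) ^ (dim u + dim v + (dim v * dim u' + dim v * 1)) =
            (-1) ^ (dim v * dim u' + dim u) := by
          apply neg_one_pow_congr; simp only [Nat.even_add, Nat.even_mul]; grind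
        have e2 : (-1 : ℤ) ^ (dim u + (dim v * dim u' + 1 * dim u')) =
            (-1) ^ (dim v * dim u' + (dim u + dim u')) := by
          congr 1; ring
        have e3 : (-1 : ℤ) ^ (dim u' + (dim u + dim v + dim v * dim u')) =
            (-1) ^ (dim v * dim u' + (dim u + dim u' + dim v)) := by
          congr 1; ring
        rw [e1, e2, e3]
        abel
  grade_comm x := by
    induction x using induction_on with
    | add x y hx hy => simp only [map_add, hx, hy]; abel
    | smul k x hx => simp only [map_smul, hx, smul_neg]
    | pair u v =>
      rw [grade_pair, map_smul, der_pair, map_add, map_smul, grade_mul, grade_mul, grade_pair,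
        grade_pair, grade_inl (oddShift_wordDer hf u), grade_inr (oddShift_wordDer hg v)]
      simp only [smul_mul_assoc, mul_smul_comm, smul_smul, smul_add, ← pow_add, dim_nil, zero_add,
        neg_add, ← neg_smul, ← neg_one_mul ((-1 : ℤ) ^ _), ← pow_succ']
      congr 2
      · congr 1; omega
      · apply neg_one_pow_congr; simp only [Nat.even_add]; grind

/-- An even derivation vanishes on `u ⊗ v` if it vanishes on the blocks of `u` and `v`. -/
theorem eq_zero_of_derivation {E : BiChain →ₗ[ℤ] BiChain}
    (hE : ∀ x y, E (x * y) = E x * y + x * E y) {u v : Word} (hl : ∀ S ∈ u, E (pair [S] []) = 0)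
    (hr : ∀ S ∈ v, E (pair [] [S]) = 0) : E (pair u v) = 0 := by
  have h1 : E (pair [] []) = 0 := by
    have := hE 1 1
    simpa [← one_def] using this
  induction u with
  | nil =>
    induction v with
    | nil => exact h1
    | cons S v ih =>
      have : pair [] (S :: v) = pair [] [S] * pair [] v := by simp [pair_mul_pair]
      rw [this, hE, ih fun T hT => hr T (by simp [hT]), hr S (by simp)]; simp
  | cons S u ih =>
    have : pair (S :: u) v = pair [S] [] * pair u v := by simp [pair_mul_pair]
    rw [this, hE, ih fun T hT => hl T (by simp [hT]), hl S (by simp)]; simp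

theorem grade_grade (x : BiChain) : grade (grade x) = x := by
  induction x using induction_on with
  | add x y hx hy => simp only [map_add, hx, hy]
  | smul k x hx => simp only [map_smul, hx]
  | pair u v => simp [smul_smul, ← mul_pow, -zsmul_eq_mul]

theorem IsOddDerivation.sq {D : BiChain →ₗ[ℤ] BiChain} (hD : IsOddDerivation D)
    (x y : BiChain) : D (D (x * y)) = D (D x) * y + x * D (D y) := by
  simp only [hD.leibniz, map_add, hD.grade_comm, grade_grade, neg_mul]
  abel

theorem IsOddDerivation.anticomm {D E : BiChain →ₗ[ℤ] BiChain} (hD : IsOddDerivation D)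
    (hE : IsOddDerivation E) (x y : BiChain) :
    D (E (x * y)) + E (D (x * y)) = (D (E x) + E (D x)) * y + x * (D (E y) + E (D y)) := by
  simp only [hD.leibniz, hE.leibniz, map_add, hD.grade_comm, hE.grade_comm, add_mul, mul_add,
    grade_grade,
    neg_mul]
  abel

end BiChain

/-! ### Signs of unshuffles and convolution -/

theorem shuff_eq_prod (A M : Finset ℕ) :
    shuff A M = ∏ a ∈ A, ∏ m ∈ M, if m < a then (-1 : ℤ) else 1 := by
  rw [← Finset.prod_product', Finset.prod_ite]
  simp [shuff]

theorem shuff_union_left {A B : Finset ℕ} (h : Disjoint A B) (M : Finset ℕ) :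
    shuff (A ∪ B) M = shuff A M * shuff B M := by
  simp only [shuff_eq_prod, Finset.prod_union h]

theorem shuff_union_right (A : Finset ℕ) {M N : Finset ℕ} (h : Disjoint M N) :
    shuff A (M ∪ N) = shuff A M * shuff A N := by
  simp only [shuff_eq_prod, Finset.prod_union h, Finset.prod_mul_distrib]

@[simp] theorem shuff_empty_left (M : Finset ℕ) : shuff ∅ M = 1 := by simp [shuff_eq_prod]

@[simp] theorem shuff_empty_right (A : Finset ℕ) : shuff A ∅ = 1 := by simp [shuff_eq_prod]

theorem shuff_insert_right {n : ℕ} {A M : Finset ℕ} (hA : ∀ a ∈ A, a < n) (hn : n ∉ M) :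
    shuff A (insert n M) = shuff A M := by
  simp only [shuff_eq_prod, Finset.prod_insert hn]
  refine Finset.prod_congr rfl fun a ha => ?_
  rw [if_neg (hA a ha).not_gt, one_mul]

theorem shuff_insert_left {n : ℕ} {A M : Finset ℕ} (hM : ∀ a ∈ M, a < n) (hn : n ∉ A) :
    shuff (insert n A) M = (-1) ^ M.card * shuff A M := by
  simp only [shuff_eq_prod, Finset.prod_insert hn]
  rw [Finset.prod_congr rfl fun m hm => if_pos (hM m hm), Finset.prod_const]

/-- The convolution `(f * g)(S) = ∑_{A ⊔ M = S} shuff(A;M) f(A) g(M)` of functions on finite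
sets. -/
noncomputable def conv (f g : Finset ℕ → BiChain) (S : Finset ℕ) : BiChain :=
  ∑ A ∈ S.powerset, shuff A (S \ A) • (f A * g (S \ A))

/-- The twist `f ↦ (-1)^{#S} f(S)` of functions on finite sets. -/
noncomputable def alt (f : Finset ℕ → BiChain) (S : Finset ℕ) : BiChain :=
  (-1 : ℤ) ^ S.card • f S

theorem alt_apply (f : Finset ℕ → BiChain) (S : Finset ℕ) : alt f S = (-1 : ℤ) ^ S.card • f S := rfl

theorem alt_alt (f : Finset ℕ → BiChain) : alt (alt f) = f := by
  funext S
  simp [alt, smul_smul, ← mul_pow, -zsmul_eq_mul]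

theorem conv_congr {f f' g g' : Finset ℕ → BiChain} {S : Finset ℕ}
    (hf : ∀ A ⊆ S, f A = f' A) (hg : ∀ A ⊆ S, g A = g' A) : conv f g S = conv f' g' S := by
  refine Finset.sum_congr rfl fun A hA => ?_
  rw [hf A (Finset.mem_powerset.1 hA), hg _ Finset.sdiff_subset]

theorem conv_sub_left (f f' g : Finset ℕ → BiChain) : conv (f - f') g = conv f g - conv f' g := by
  funext S
  simp only [conv, Pi.sub_apply, sub_mul, smul_sub, Finset.sum_sub_distrib]

theorem conv_sub_right (f g g' : Finset ℕ → BiChain) : conv f (g - g') = conv f g - conv f g' := by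
  funext S
  simp only [conv, Pi.sub_apply, mul_sub, smul_sub, Finset.sum_sub_distrib]

theorem conv_neg_left (f g : Finset ℕ → BiChain) : conv (-f) g = -conv f g := by
  funext S
  simp only [conv, Pi.neg_apply, neg_mul, smul_neg, Finset.sum_neg_distrib]

theorem conv_assoc (f g h : Finset ℕ → BiChain) : conv (conv f g) h = conv f (conv g h) := by
  funext S
  simp only [conv, Finset.sum_mul, Finset.mul_sum, Finset.smul_sum]
  rw [Finset.sum_sigma', Finset.sum_sigma']
  refine Finset.sum_bij' (fun p _ => ⟨p.2, p.1 \ p.2⟩) (fun p _ => ⟨p.1 ∪ p.2, p.1⟩) ?_ ?_ ?_ ?_ ?_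
  · rintro ⟨A, B⟩ h
    simp only [Finset.mem_sigma, Finset.mem_powerset] at h ⊢
    exact ⟨h.2.trans h.1, Finset.sdiff_subset_sdiff h.1 subset_rfl⟩
  · rintro ⟨A, B⟩ h
    simp only [Finset.mem_sigma, Finset.mem_powerset] at h ⊢
    exact ⟨Finset.union_subset h.1 (h.2.trans Finset.sdiff_subset), Finset.subset_union_left⟩
  · rintro ⟨A, B⟩ h
    simp only [Finset.mem_sigma, Finset.mem_powerset] at h ⊢
    rw [Finset.union_sdiff_of_subset h.2]
  · rintro ⟨A, B⟩ h
    simp only [Finset.mem_sigma, Finset.mem_powerset] at h ⊢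
    rw [Finset.union_sdiff_cancel_left]
    exact Finset.disjoint_of_subset_right h.2 Finset.disjoint_sdiff
  · rintro ⟨A, B⟩ h
    simp only [Finset.mem_sigma, Finset.mem_powerset] at h ⊢
    have e1 : (S \ B) \ (A \ B) = S \ A := by
      ext x; have := @h.2 x; simp only [Finset.mem_sdiff]; tauto
    have e2 : shuff A (S \ A) = shuff B (S \ A) * shuff (A \ B) (S \ A) := by
      rw [← shuff_union_left Finset.disjoint_sdiff, Finset.union_sdiff_of_subset h.2]
    have e3 : shuff B (S \ B) = shuff B (A \ B) * shuff B (S \ A) := by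
      rw [← shuff_union_right]
      · congr 1
        ext x; have := @h.2 x; have := @h.1 x; simp only [Finset.mem_sdiff, Finset.mem_union]; tauto
      · exact Finset.disjoint_of_subset_left Finset.sdiff_subset Finset.disjoint_sdiff
    simp only [smul_mul_assoc, mul_smul_comm, smul_smul, mul_assoc, e1]
    rw [e2, e3]
    congr 1
    ring

theorem alt_conv (f g : Finset ℕ → BiChain) : alt (conv f g) = conv (alt f) (alt g) := by
  funext S
  simp only [conv, alt, Finset.smul_sum]
  refine Finset.sum_congr rfl fun A hA => ?_
  rw [← Finset.card_sdiff_add_card_eq_card (Finset.mem_powerset.1 hA), smul_mul_smul_comm,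
    smul_smul, smul_smul]
  congr 1
  ring

theorem BiChain.IsOddDerivation.map_conv {D : BiChain →ₗ[ℤ] BiChain} (hD : IsOddDerivation D)
    (f g : Finset ℕ → BiChain) (S : Finset ℕ) :
    D (conv f g S) =
      conv (fun A => D (f A)) g S + conv (fun A => grade (f A)) (fun A => D (g A)) S := by
  simp only [conv, map_sum, map_smul, hD.leibniz, smul_add, Finset.sum_add_distrib]

/-- The function on finite sets with value `b` at `∅` and `0` elsewhere. -/
noncomputable def atEmpty (b : BiChain) (S : Finset ℕ) : BiChain := if S = ∅ then b else 0

theorem conv_atEmpty_left (b : BiChain) (f : Finset ℕ → BiChain) (S : Finset ℕ) :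
    conv (atEmpty b) f S = b * f S := by
  rw [conv, Finset.sum_eq_single ∅]
  · simp [atEmpty]
  · intro A _ hA
    simp [atEmpty, hA]
  · simp

theorem conv_atEmpty_right (b : BiChain) (f : Finset ℕ → BiChain) (S : Finset ℕ) :
    conv f (atEmpty b) S = f S * b := by
  rw [conv, Finset.sum_eq_single S]
  · simp [atEmpty]
  · intro A hA hne
    have : S \ A ≠ ∅ := fun h =>
      hne ((Finset.mem_powerset.1 hA).antisymm (Finset.sdiff_eq_empty_iff_subset.1 h))
    simp [atEmpty, this]
  · simp

theorem alt_atEmpty (b : BiChain) : alt (atEmpty b) = atEmpty b := by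
  funext S
  by_cases h : S = ∅ <;> simp [alt, atEmpty, h]

theorem alt_sub (f g : Finset ℕ → BiChain) : alt (f - g) = alt f - alt g := by
  funext S
  simp only [alt, Pi.sub_apply, smul_sub]

/-- The extension of `τ` by a letter: `b` at the empty set and `-(-1)^{#S} D(τ(S))` elsewhere. -/
noncomputable def extend (D : BiChain →ₗ[ℤ] BiChain) (b : BiChain) (τ : Finset ℕ → BiChain) :
    Finset ℕ → BiChain := atEmpty b - alt fun S => D (τ S)

/-- If `τ` satisfies the twisting equation `∂τ = (ατ) * τ` on the subsets of `U`, and `∂D + D∂` is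
the commutator with `b` on the values of `τ`, then `∂` acts on the extension of `τ` by
`D` and `b` as a twisted commutator with `τ`. -/
theorem der_extend {d D : BiChain →ₗ[ℤ] BiChain} (hD : IsOddDerivation D)
    {b : BiChain} (hb : d b = 0) {τ : Finset ℕ → BiChain} {U : Finset ℕ}
    (hτ : ∀ S ⊆ U, d (τ S) = conv (alt τ) τ S) (hg : ∀ S, grade (τ S) = -alt τ S)
    (hc : ∀ S ⊆ U, d (D (τ S)) + D (d (τ S)) = b * τ S - τ S * b) {S : Finset ℕ} (hS : S ⊆ U) :
    d (extend D b τ S) =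
      conv (alt τ) (extend D b τ) S - conv (alt (extend D b τ)) (alt τ) S := by
  have h1 : d (extend D b τ S) = -((-1 : ℤ) ^ S.card • d (D (τ S))) := by
    have : d (atEmpty b S) = 0 := by
      unfold atEmpty; split_ifs <;> simp [hb]
    rw [extend, Pi.sub_apply, map_sub, this, alt, map_smul, zero_sub]
  have h2 : D (conv (alt τ) τ S) =
      conv (alt fun A => D (τ A)) τ S - conv τ (fun A => D (τ A)) S := by
    rw [hD.map_conv]
    have e1 : (fun A => D (alt τ A)) = alt fun A => D (τ A) := by
      funext A; simp only [alt, map_smul]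
    have e2 : (fun A => grade (alt τ A)) = -τ := by
      funext A
      rw [alt, map_smul, hg, smul_neg, ← alt_apply, alt_alt]; rfl
    rw [e1, e2, conv_neg_left]
    simp [sub_eq_add_neg]
  have h3 : ∀ f g, (-1 : ℤ) ^ S.card • conv f g S = conv (alt f) (alt g) S := fun f g => by
    rw [← alt_conv]; rfl
  have h4 : d (D (τ S)) = b * τ S - τ S * b - D (conv (alt τ) τ S) := by
    rw [← hc S hS, hτ S hS]; abel
  rw [h1, h4, h2]
  simp only [smul_sub, h3, alt_alt]
  rw [extend, alt_sub, alt_atEmpty, alt_alt, conv_sub_right, conv_sub_left]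
  simp only [Pi.sub_apply, conv_atEmpty_left, conv_atEmpty_right, alt_apply, smul_mul_assoc,
    mul_smul_comm]
  abel

theorem grade_extend {D : BiChain →ₗ[ℤ] BiChain} (hD : IsOddDerivation D)
    {b : BiChain} (hb : grade b = b) {τ : Finset ℕ → BiChain}
    (hg : ∀ S, grade (τ S) = -alt τ S) (S : Finset ℕ) :
    grade (extend D b τ S) = alt (extend D b τ) S := by
  have : grade (atEmpty b S) = atEmpty b S := by
    unfold atEmpty; split_ifs <;> simp [hb]
  rw [extend, alt_sub, alt_atEmpty, Pi.sub_apply, Pi.sub_apply, map_sub, this]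
  simp only [alt, map_smul, hD.grade_comm, hg, map_neg, neg_neg, map_smul]

/-- The convolution of two extensions of `τ` satisfies the linear equation that makes the twisting
equation hold for the sets with one more element. -/
theorem der_conv_extend {d D E : BiChain →ₗ[ℤ] BiChain} (hd : IsOddDerivation d)
    (hD : IsOddDerivation D) (hE : IsOddDerivation E)
    {b a : BiChain} (hb : d b = 0) (hgb : grade b = b) (ha : d a = 0)
    {τ : Finset ℕ → BiChain} {U : Finset ℕ}
    (hτ : ∀ S ⊆ U, d (τ S) = conv (alt τ) τ S) (hg : ∀ S, grade (τ S) = -alt τ S)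
    (hcD : ∀ S ⊆ U, d (D (τ S)) + D (d (τ S)) = b * τ S - τ S * b)
    (hcE : ∀ S ⊆ U, d (E (τ S)) + E (d (τ S)) = a * τ S - τ S * a)
    {S : Finset ℕ} (hS : S ⊆ U) :
    d (conv (extend D b τ) (extend E a τ) S) =
      conv (alt τ) (conv (extend D b τ) (extend E a τ)) S -
        conv (alt (conv (extend D b τ) (extend E a τ))) (alt τ) S := by
  rw [hd.map_conv]
  rw [conv_congr (f' := conv (alt τ) (extend D b τ) - conv (alt (extend D b τ)) (alt τ))
      (fun A hA => der_extend hD hb hτ hg hcD (hA.trans hS)) (fun A hA => rfl),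
    conv_congr (f := fun A => grade (extend D b τ A)) (f' := alt (extend D b τ))
      (g' := conv (alt τ) (extend E a τ) - conv (alt (extend E a τ)) (alt τ))
      (fun A hA => grade_extend hD hgb hg A)
      (fun A hA => der_extend hE ha hτ hg hcE (hA.trans hS))]
  simp only [conv_sub_left, conv_sub_right, alt_conv, conv_assoc, Pi.sub_apply]
  abel

/-! ### The twisting equation -/

theorem insert_sdiff_insert_of_notMem {n : ℕ} {A : Finset ℕ} (hn : n ∉ A) (N : Finset ℕ) :
    insert n A \ insert n N = A \ N := by
  ext x
  simp only [Finset.mem_sdiff, Finset.mem_insert]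
  constructor
  · tauto
  · rintro ⟨h1, h2⟩
    refine ⟨Or.inr h1, ?_⟩
    rintro (rfl | h)
    exacts [hn h1, h2 h]

theorem conv_insert (f g : Finset ℕ → BiChain) {n : ℕ} {S : Finset ℕ} (hS : ∀ s ∈ S, s < n) :
    conv f g (insert n S) =
      conv f (fun A => g (insert n A)) S + conv (fun A => f (insert n A)) (alt g) S := by
  have hn : n ∉ S := fun h => lt_irrefl n (hS n h)
  have hnA : ∀ A ∈ S.powerset, n ∉ A := fun A hA h => hn (Finset.mem_powerset.1 hA h)
  rw [conv, Finset.sum_powerset_insert hn]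
  congr 1
  · refine Finset.sum_congr rfl fun A hA => ?_
    rw [Finset.insert_sdiff_of_notMem _ (hnA A hA), shuff_insert_right
      (fun a ha => hS a (Finset.mem_powerset.1 hA ha)) (fun h => hn (Finset.mem_sdiff.1 h).1)]
  · refine Finset.sum_congr rfl fun A hA => ?_
    rw [insert_sdiff_insert_of_notMem hn,
      shuff_insert_left (fun a ha => hS a (Finset.mem_sdiff.1 ha).1) (hnA A hA), alt_apply,
      mul_smul_comm, smul_smul, mul_comm]

/-- The convolution of `alt τ` and `τ` at a set `S ∪ {n}`, where `n` exceeds all elements of `S`. -/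
theorem conv_alt_insert (τ : Finset ℕ → BiChain) {n : ℕ} {S : Finset ℕ} (hS : ∀ s ∈ S, s < n) :
    conv (alt τ) τ (insert n S) = conv (alt τ) (fun A => τ (insert n A)) S -
      conv (alt fun A => τ (insert n A)) (alt τ) S := by
  rw [conv_insert _ _ hS, sub_eq_add_neg, ← Pi.neg_apply, ← conv_neg_left]
  congr 1
  refine conv_congr (fun A hA => ?_) fun _ _ => rfl
  have hn : n ∉ A := fun h => lt_irrefl n (hS n (hA h))
  simp [alt, Finset.card_insert_of_notMem hn, pow_succ, -zsmul_eq_mul]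

/-- A solution of the twisting equation consists of cycles for the square of the differential. -/
theorem der_der_of_twisting {d : BiChain →ₗ[ℤ] BiChain} (hd : IsOddDerivation d)
    {τ : Finset ℕ → BiChain} (hτ : ∀ S, d (τ S) = conv (alt τ) τ S)
    (hg : ∀ S, grade (τ S) = -alt τ S) (S : Finset ℕ) : d (d (τ S)) = 0 := by
  rw [hτ, hd.map_conv]
  have e1 : (fun A => d (alt τ A)) = conv τ (alt τ) := by
    funext A
    rw [alt, map_smul, hτ, ← alt_apply, alt_conv, alt_alt]
  have e2 : (fun A => grade (alt τ A)) = -τ := by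
    funext A
    rw [alt, map_smul, hg, smul_neg, ← alt_apply, alt_alt]; rfl
  have e3 : (fun A => d (τ A)) = conv (alt τ) τ := funext hτ
  rw [e1, e2, e3, conv_neg_left, conv_assoc]
  simp

/-- The anticommutator of the differential with the operation adding a new maximal element `n`
to a block is the commutator with the block of `n`; here `l` is the function sending a set to the
corresponding block. -/
theorem anticomm_block {d D : BiChain →ₗ[ℤ] BiChain} (hD : IsOddDerivation D) {b : BiChain}
    {l : Finset ℕ → BiChain} (hl : ∀ S, d (l S) = conv (alt l) l S)
    (hg : ∀ S, grade (l S) = -alt l S) {n : ℕ}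
    (hn : ∀ S, n ∉ S → extend D b l S = l (insert n S)) {S : Finset ℕ} (h0 : S.Nonempty)
    (hS : ∀ s ∈ S, s < n) : d (D (l S)) + D (d (l S)) = b * l S - l S * b := by
  have hnS : n ∉ S := fun h => lt_irrefl n (hS n h)
  have e0 : ∀ A ⊆ S, alt (fun A => D (l A)) A = (atEmpty b - fun A => l (insert n A)) A := by
    intro A hA
    have := hn A fun h => hnS (hA h)
    rw [Pi.sub_apply, ← this, extend, Pi.sub_apply]
    abel
  have e1 : ∀ A ⊆ S, D (l A) = (atEmpty b - alt fun A => l (insert n A)) A := by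
    intro A hA
    have := congrArg (fun x => (-1 : ℤ) ^ A.card • x) (e0 A hA)
    simp only [← alt_apply, alt_alt, alt_sub, alt_atEmpty] at this
    exact this
  have h1 : D (d (l S)) = conv (alt fun A => D (l A)) l S - conv l (fun A => D (l A)) S := by
    rw [hl, hD.map_conv]
    have e1 : (fun A => D (alt l A)) = alt fun A => D (l A) := by
      funext A; simp only [alt, map_smul]
    have e2 : (fun A => grade (alt l A)) = -l := by
      funext A
      rw [alt, map_smul, hg, smul_neg, ← alt_apply, alt_alt]; rfl
    rw [e1, e2, conv_neg_left]
    simp [sub_eq_add_neg]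
  have h2 : d (D (l S)) = -((-1 : ℤ) ^ S.card • d (l (insert n S))) := by
    rw [e1 S subset_rfl, Pi.sub_apply, map_sub, alt_apply, map_smul, atEmpty, if_neg h0.ne_empty]
    simp
  have h3 : ∀ f g, (-1 : ℤ) ^ S.card • conv f g S = conv (alt f) (alt g) S := fun f g => by
    rw [← alt_conv]; rfl
  rw [h2, hl, conv_alt_insert _ hS, smul_sub, h3, h3, alt_alt, alt_alt, h1,
    conv_congr e0 fun _ _ => rfl, conv_congr (f := l) (fun _ _ => rfl) e1, conv_sub_left,
    conv_sub_right]
  simp only [Pi.sub_apply, conv_atEmpty_left, conv_atEmpty_right]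
  abel

/-! ### Joining a new maximal element to a factor -/

/-- The boundary of the top cell of the permutahedron on `S`, also when `0 ∈ S`. -/
noncomputable def permBoundary (S : Finset ℕ) : Word →₀ ℤ :=
  ∑ A ∈ S.powerset.filter (fun A => A ≠ ∅ ∧ A ≠ S),
    Finsupp.single [A, S \ A] ((-1) ^ A.card * shuff A (S \ A))

theorem blockBoundary_of_notMem {S : Finset ℕ} (h : 0 ∉ S) : blockBoundary S = permBoundary S :=
  if_neg h

/-- The letter map that adds the new element `n` to a block, with the sign `(-1)^{dim}`. -/
noncomputable def joinLetter (n : ℕ) (S : Finset ℕ) : Word →₀ ℤ :=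
  if n ∈ S ∨ S = ∅ then 0 else Finsupp.single [insert n S] ((-1) ^ (S.card - 1))

theorem oddShift_zero (k : ℕ) : OddShift 0 k := fun w hw => by simp at hw

theorem oddShift_permBoundary (S : Finset ℕ) : OddShift (permBoundary S) (S.card - 1) := by
  refine OddShift.sum fun A hA => OddShift.single ?_ _
  simp only [Finset.mem_filter, Finset.mem_powerset] at hA
  obtain ⟨h1, h2, h3⟩ := hA
  have c1 := Finset.card_pos.2 (Finset.nonempty_iff_ne_empty.2 h2)
  have c2 := Finset.card_pos.2 (Finset.sdiff_nonempty.2 fun h => h3 (h1.antisymm h))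
  have c3 := Finset.card_sdiff_add_card_eq_card h1
  simp only [dim_cons, dim_nil]
  rw [Nat.odd_iff]
  omega

theorem oddShift_joinLetter (n : ℕ) (S : Finset ℕ) : OddShift (joinLetter n S) (S.card - 1) := by
  unfold joinLetter
  split_ifs with h
  · exact oddShift_zero _
  · push Not at h
    refine OddShift.single ?_ _
    have := Finset.card_pos.2 h.2
    rw [dim_cons, dim_nil, Finset.card_insert_of_notMem h.1, Nat.odd_iff]
    omega

/-- The differential of pairs of words in which all blocks stand for permutahedra. -/
noncomputable abbrev permDer : BiChain →ₗ[ℤ] BiChain := der permBoundary permBoundary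

theorem isOddDerivation_permDer : IsOddDerivation permDer :=
  isOddDerivation_der oddShift_permBoundary oddShift_permBoundary

/-- The operation joining `n` to the left factor. -/
noncomputable abbrev joinLeft (n : ℕ) : BiChain →ₗ[ℤ] BiChain := der (joinLetter n) 0

/-- The operation joining `n` to the right factor. -/
noncomputable abbrev joinRight (n : ℕ) : BiChain →ₗ[ℤ] BiChain := der 0 (joinLetter n)

theorem isOddDerivation_joinLeft (n : ℕ) : IsOddDerivation (joinLeft n) :=
  isOddDerivation_der (oddShift_joinLetter n) fun _ => oddShift_zero _

theorem isOddDerivation_joinRight (n : ℕ) : IsOddDerivation (joinRight n) :=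
  isOddDerivation_der (fun _ => oddShift_zero _) (oddShift_joinLetter n)

theorem wordDer_singleton (f : Finset ℕ → (Word →₀ ℤ)) (S : Finset ℕ) : wordDer f [S] = f S := by
  have := Finsupp.mapDomain_id (v := f S)
  simp only [wordDer, Finsupp.mapDomain_zero, smul_zero, add_zero, List.append_nil]
  exact this

@[simp] theorem wordDer_zero (w : Word) : wordDer 0 w = 0 := by
  induction w with
  | nil => rfl
  | cons S e ih => simp [wordDer, ih]

theorem der_pair_left (f g : Finset ℕ → (Word →₀ ℤ)) (S : Finset ℕ) :
    der f g (pair [S] []) = inl (f S) := by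
  rw [der_pair, wordDer_singleton]
  simp [wordDer, ← one_def]

theorem der_pair_right (f g : Finset ℕ → (Word →₀ ℤ)) (S : Finset ℕ) :
    der f g (pair [] [S]) = inr (g S) := by
  rw [der_pair, wordDer_singleton]
  simp [wordDer, ← one_def]

/-- The block `S` as a left factor; `0` if `S` is empty. -/
noncomputable def leftBlock (S : Finset ℕ) : BiChain := if S = ∅ then 0 else pair [S] []

/-- The block `S` as a right factor; `0` if `S` is empty. -/
noncomputable def rightBlock (S : Finset ℕ) : BiChain := if S = ∅ then 0 else pair [] [S]

theorem grade_leftBlock (S : Finset ℕ) : grade (leftBlock S) = -alt leftBlock S := by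
  rcases S.eq_empty_or_nonempty with rfl | h
  · simp [leftBlock, alt]
  · obtain ⟨k, hk⟩ := Nat.exists_eq_add_of_lt (Finset.card_pos.2 h)
    simp [leftBlock, alt, h.ne_empty, hk, pow_succ, -zsmul_eq_mul]

theorem grade_rightBlock (S : Finset ℕ) : grade (rightBlock S) = -alt rightBlock S := by
  rcases S.eq_empty_or_nonempty with rfl | h
  · simp [rightBlock, alt]
  · obtain ⟨k, hk⟩ := Nat.exists_eq_add_of_lt (Finset.card_pos.2 h)
    simp [rightBlock, alt, h.ne_empty, hk, pow_succ, -zsmul_eq_mul]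

theorem permBoundary_empty : permBoundary ∅ = 0 := by
  simp [permBoundary, Finset.filter_singleton]

theorem permDer_leftBlock (S : Finset ℕ) :
    permDer (leftBlock S) = conv (alt leftBlock) leftBlock S := by
  rw [conv]
  have h1 : permDer (leftBlock S) = inl (permBoundary S) := by
    unfold leftBlock; split_ifs with h
    · rw [h, permBoundary_empty]; simp
    · exact der_pair_left _ _ _
  rw [h1, permBoundary, map_sum, Finset.sum_filter]
  refine Finset.sum_congr rfl fun A hA => ?_
  rw [Finset.mem_powerset] at hA
  by_cases h2 : A = ∅
  · simp [h2, leftBlock, alt]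
  by_cases h3 : A = S
  · simp [h3, leftBlock]
  have h4 : S \ A ≠ ∅ := (Finset.sdiff_nonempty.2 fun h => h3 (hA.antisymm h)).ne_empty
  rw [if_pos ⟨h2, h3⟩, inl_single, alt, leftBlock, leftBlock, if_neg h2, if_neg h4, smul_mul_assoc,
    pair_mul_pair, smul_smul, mul_comm]
  simp

theorem permDer_rightBlock (S : Finset ℕ) :
    permDer (rightBlock S) = conv (alt rightBlock) rightBlock S := by
  rw [conv]
  have h1 : permDer (rightBlock S) = inr (permBoundary S) := by
    unfold rightBlock; split_ifs with h
    · rw [h, permBoundary_empty]; simp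
    · exact der_pair_right _ _ _
  rw [h1, permBoundary, map_sum, Finset.sum_filter]
  refine Finset.sum_congr rfl fun A hA => ?_
  rw [Finset.mem_powerset] at hA
  by_cases h2 : A = ∅
  · simp [h2, rightBlock, alt]
  by_cases h3 : A = S
  · simp [h3, rightBlock]
  have h4 : S \ A ≠ ∅ := (Finset.sdiff_nonempty.2 fun h => h3 (hA.antisymm h)).ne_empty
  rw [if_pos ⟨h2, h3⟩, inr_single, alt, rightBlock, rightBlock, if_neg h2, if_neg h4,
    smul_mul_assoc, pair_mul_pair, smul_smul, mul_comm]
  simp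

theorem permDer_permDer (x : BiChain) : permDer (permDer x) = 0 := by
  induction x using induction_on with
  | add x y hx hy => simp only [map_add, hx, hy, add_zero]
  | smul k x hx => simp only [map_smul, hx, smul_zero]
  | pair u v =>
    have hl : ∀ S, permDer (permDer (pair [S] [])) = 0 := fun S => by
      by_cases h : S = ∅
      · rw [h, der_pair_left, permBoundary_empty]; simp
      · have := der_der_of_twisting isOddDerivation_permDer permDer_leftBlock grade_leftBlock S
        rwa [leftBlock, if_neg h] at this
    have hr : ∀ S, permDer (permDer (pair [] [S])) = 0 := fun S => by
      by_cases h : S = ∅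
      · rw [h, der_pair_right, permBoundary_empty]; simp
      · have := der_der_of_twisting isOddDerivation_permDer permDer_rightBlock grade_rightBlock S
        rwa [rightBlock, if_neg h] at this
    exact eq_zero_of_derivation (E := permDer ∘ₗ permDer) (isOddDerivation_permDer.sq)
      (fun S _ => hl S) (fun S _ => hr S)

theorem der_zero_inr (f : Finset ℕ → (Word →₀ ℤ)) (x : Word →₀ ℤ) : der f 0 (inr x) = 0 := by
  induction x using Finsupp.induction_linear with
  | zero => simp
  | add x y hx hy => simp only [map_add, hx, hy, add_zero]
  | single w k => rw [inr_single, map_smul, der_pair, wordDer_zero]; simp [wordDer]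

theorem der_zero_inl (f : Finset ℕ → (Word →₀ ℤ)) (x : Word →₀ ℤ) : der 0 f (inl x) = 0 := by
  induction x using Finsupp.induction_linear with
  | zero => simp
  | add x y hx hy => simp only [map_add, hx, hy, add_zero]
  | single w k => rw [inl_single, map_smul, der_pair, wordDer_zero]; simp [wordDer]

theorem extend_joinLeft (n : ℕ) (S : Finset ℕ) (hn : n ∉ S) :
    extend (joinLeft n) (pair [{n}] []) leftBlock S = leftBlock (insert n S) := by
  by_cases h : S = ∅
  · subst h
    simp [extend, atEmpty, alt, leftBlock]
  · obtain ⟨k, hk⟩ := Nat.exists_eq_add_of_lt (Finset.card_pos.2 (Finset.nonempty_iff_ne_empty.2 h))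
    simp only [extend, atEmpty, alt, leftBlock, h, Pi.sub_apply, if_false, der_pair_left,
      Finset.insert_ne_empty, joinLetter, hn, or_self, inl_single, smul_smul, ← pow_add, zero_sub,
      ← neg_smul]
    rw [Odd.neg_one_pow (by rw [Nat.odd_iff]; omega)]
    simp

theorem extend_joinRight (n : ℕ) (S : Finset ℕ) (hn : n ∉ S) :
    extend (joinRight n) (pair [] [{n}]) rightBlock S = rightBlock (insert n S) := by
  by_cases h : S = ∅
  · subst h
    simp [extend, atEmpty, alt, rightBlock]
  · obtain ⟨k, hk⟩ := Nat.exists_eq_add_of_lt (Finset.card_pos.2 (Finset.nonempty_iff_ne_empty.2 h))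
    simp only [extend, atEmpty, alt, rightBlock, h, Pi.sub_apply, if_false, der_pair_right,
      Finset.insert_ne_empty, joinLetter, hn, or_self, inr_single, smul_smul, ← pow_add, zero_sub,
      ← neg_smul]
    rw [Odd.neg_one_pow (by rw [Nat.odd_iff]; omega)]
    simp

/-- The operator `∂D + D∂ - [b, ·]`, whose vanishing expresses that `D` commutes with `∂` up to an
inner derivation. -/
noncomputable def defect (D : BiChain →ₗ[ℤ] BiChain) (b : BiChain) : BiChain →ₗ[ℤ] BiChain :=
  permDer ∘ₗ D + D ∘ₗ permDer - (LinearMap.mulLeft ℤ b - LinearMap.mulRight ℤ b)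

theorem defect_apply (D : BiChain →ₗ[ℤ] BiChain) (b x : BiChain) :
    defect D b x = permDer (D x) + D (permDer x) - (b * x - x * b) := rfl

theorem defect_mul {D : BiChain →ₗ[ℤ] BiChain} (hD : IsOddDerivation D) (b x y : BiChain) :
    defect D b (x * y) = defect D b x * y + x * defect D b y := by
  simp only [defect_apply, isOddDerivation_permDer.anticomm hD, sub_mul, mul_sub, add_mul, mul_add,
    mul_assoc]
  abel

/-- Joining `n` to the left factor anticommutes with the differential up to the commutator with the
block `{n}`. -/
theorem defect_joinLeft {n : ℕ} {u v : Word} (hu : ∀ A ∈ u, A.Nonempty ∧ ∀ a ∈ A, a < n) :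
    defect (joinLeft n) (pair [{n}] []) (pair u v) = 0 := by
  refine eq_zero_of_derivation (defect_mul (isOddDerivation_joinLeft n) _) (fun S hS => ?_)
    fun S _ => ?_
  · have := anticomm_block (isOddDerivation_joinLeft n) permDer_leftBlock grade_leftBlock
      (extend_joinLeft n) (hu S hS).1 (hu S hS).2
    rw [leftBlock, if_neg (hu S hS).1.ne_empty] at this
    rw [defect_apply, this, sub_self]
  · rw [defect_apply, der_pair_right, der_pair_right, der_zero_inr]
    simp [pair_mul_pair]

theorem defect_joinRight {n : ℕ} {u v : Word} (hv : ∀ A ∈ v, A.Nonempty ∧ ∀ a ∈ A, a < n) :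
    defect (joinRight n) (pair [] [{n}]) (pair u v) = 0 := by
  refine eq_zero_of_derivation (defect_mul (isOddDerivation_joinRight n) _) (fun S _ => ?_)
    fun S hS => ?_
  · rw [defect_apply, der_pair_left, der_pair_left, der_zero_inl]
    simp [pair_mul_pair]
  · have := anticomm_block (isOddDerivation_joinRight n) permDer_rightBlock grade_rightBlock
      (extend_joinRight n) (hv S hS).1 (hv S hS).2
    rw [rightBlock, if_neg (hv S hS).1.ne_empty] at this
    rw [defect_apply, this, sub_self]

/-! ### Partitions and the chains they span -/

/-- `w` is an ordered partition of `S` into non-empty blocks. -/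
def IsPartition (S : Finset ℕ) (w : Word) : Prop :=
  (∀ A ∈ w, A.Nonempty) ∧ w.Pairwise Disjoint ∧ carrier w = S

theorem carrier_append (u v : Word) : carrier (u ++ v) = carrier u ∪ carrier v := by
  ext a
  simp only [mem_carrier, List.mem_append, Finset.mem_union, or_and_right, exists_or]

theorem IsPartition.append {S T : Finset ℕ} {u v : Word} (hu : IsPartition S u)
    (hv : IsPartition T v) (h : Disjoint S T) : IsPartition (S ∪ T) (u ++ v) := by
  obtain ⟨hu1, hu2, rfl⟩ := hu
  obtain ⟨hv1, hv2, rfl⟩ := hv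
  refine ⟨?_, ?_, carrier_append u v⟩
  · intro A hA
    rcases List.mem_append.1 hA with h | h
    exacts [hu1 A h, hv1 A h]
  · rw [List.pairwise_append]
    refine ⟨hu2, hv2, fun A hA B hB => ?_⟩
    exact Finset.disjoint_of_subset_left (fun a ha => mem_carrier.2 ⟨A, hA, ha⟩)
      (Finset.disjoint_of_subset_right (fun b hb => mem_carrier.2 ⟨B, hB, hb⟩) h)

theorem isPartition_nil : IsPartition ∅ [] := ⟨by simp, by simp, rfl⟩

theorem isPartition_singleton {S : Finset ℕ} (h : S.Nonempty) : IsPartition S [S] :=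
  ⟨by simpa using h, by simp, by simp [carrier]⟩

theorem IsPartition.cons_inv {S A : Finset ℕ} {w : Word} (h : IsPartition S (A :: w)) :
    A.Nonempty ∧ Disjoint A (carrier w) ∧ S = A ∪ carrier w ∧ IsPartition (carrier w) w := by
  obtain ⟨h1, h2, rfl⟩ := h
  rw [List.pairwise_cons] at h2
  refine ⟨h1 A (by simp), ?_, carrier_cons, fun B hB => h1 B (by simp [hB]), h2.2, rfl⟩
  rw [Finset.disjoint_left]
  intro a ha haw
  obtain ⟨B, hB, haB⟩ := mem_carrier.1 haw
  exact Finset.disjoint_left.1 (h2.1 B hB) ha haB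

theorem IsPartition.subset {S : Finset ℕ} {w : Word} (h : IsPartition S w) :
    ∀ A ∈ w, A ⊆ S := by
  obtain ⟨_, _, rfl⟩ := h
  exact fun A hA a ha => mem_carrier.2 ⟨A, hA, ha⟩

theorem mem_support_wordDer_joinLetter {n : ℕ} {u : Word} : ∀ {S : Finset ℕ} {w : Word},
    IsPartition S u → n ∉ S → w ∈ (wordDer (joinLetter n) u).support →
    IsPartition (insert n S) w ∧ dim w = dim u + 1 := by
  classical
  induction u with
  | nil => intro S w _ _ hw; simp [wordDer] at hw
  | cons A u ih =>
    intro S w hS hn hw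
    obtain ⟨hA, hd, rfl, hu⟩ := hS.cons_inv
    simp only [Finset.mem_union, not_or] at hn
    rw [wordDer] at hw
    rcases Finset.mem_union.1 (Finsupp.support_add hw) with hw | hw
    · obtain ⟨c, hc, rfl⟩ := Finset.mem_image.1 (Finsupp.mapDomain_support hw)
      rw [joinLetter, if_neg (by simp [hn.1, hA.ne_empty])] at hc
      obtain rfl := Finset.mem_singleton.1 (Finsupp.support_single_subset hc)
      constructor
      · rw [← Finset.insert_union]
        refine (isPartition_singleton (Finset.insert_nonempty n A)).append hu ?_
        rw [Finset.disjoint_insert_left]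
        exact ⟨hn.2, hd⟩
      · have := Finset.card_pos.2 hA
        simp only [dim_append, dim_cons, dim_nil, Finset.card_insert_of_notMem hn.1]
        omega
    · obtain ⟨c, hc, rfl⟩ :=
        Finset.mem_image.1 (Finsupp.mapDomain_support (Finsupp.support_smul hw))
      obtain ⟨h1, h2⟩ := ih hu hn.2 hc
      constructor
      · rw [← Finset.union_insert]
        refine (isPartition_singleton hA).append h1 ?_
        rw [Finset.disjoint_insert_right]
        exact ⟨hn.1, hd⟩
      · simp only [dim_cons, h2]; omega

/-- The span of the pairs `u ⊗ v` of partitions of `S` and `T` of total dimension `k`. -/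
noncomputable def partSpan (S T : Finset ℕ) (k : ℕ) : Submodule ℤ BiChain :=
  Submodule.span ℤ {x | ∃ u v, IsPartition S u ∧ IsPartition T v ∧ dim u + dim v = k ∧ x = pair u v}

theorem pair_mem_partSpan {S T : Finset ℕ} {k : ℕ} {u v : Word} (hu : IsPartition S u)
    (hv : IsPartition T v) (hk : dim u + dim v = k) : pair u v ∈ partSpan S T k :=
  Submodule.subset_span ⟨u, v, hu, hv, hk, rfl⟩

theorem mul_mem_partSpan {S T S' T' : Finset ℕ} {k k' : ℕ} {x y : BiChain}
    (hS : Disjoint S S') (hT : Disjoint T T') (hx : x ∈ partSpan S T k)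
    (hy : y ∈ partSpan S' T' k') : x * y ∈ partSpan (S ∪ S') (T ∪ T') (k + k') := by
  induction hx using Submodule.span_induction with
  | zero => simp
  | add x z _ _ hx hz => rw [add_mul]; exact add_mem hx hz
  | smul c x _ hx => rw [smul_mul_assoc]; exact Submodule.smul_mem _ _ hx
  | mem x hx =>
    obtain ⟨u, v, hu, hv, hk, rfl⟩ := hx
    induction hy using Submodule.span_induction with
    | zero => simp
    | add x z _ _ hx hz => rw [mul_add]; exact add_mem hx hz
    | smul c x _ hx => rw [mul_smul_comm]; exact Submodule.smul_mem _ _ hx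
    | mem y hy =>
      obtain ⟨u', v', hu', hv', hk', rfl⟩ := hy
      rw [pair_mul_pair]
      refine Submodule.smul_mem _ _ (pair_mem_partSpan (hu.append hu' hS) (hv.append hv' hT) ?_)
      simp only [dim_append]; omega

theorem joinLeft_mem_partSpan {S T : Finset ℕ} {k n : ℕ} (hn : n ∉ S) {x : BiChain}
    (hx : x ∈ partSpan S T k) : joinLeft n x ∈ partSpan (insert n S) T (k + 1) := by
  induction hx using Submodule.span_induction with
  | zero => simp
  | add x z _ _ hx hz => rw [map_add]; exact add_mem hx hz
  | smul c x _ hx => rw [map_smul]; exact Submodule.smul_mem _ _ hx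
  | mem x hx =>
    obtain ⟨u, v, hu, hv, hk, rfl⟩ := hx
    rw [der_pair, wordDer_zero, map_zero, mul_zero, smul_zero, add_zero, ← Finsupp.sum_single
      (wordDer (joinLetter n) u), Finsupp.sum, map_sum, Finset.sum_mul]
    refine Submodule.sum_mem _ fun w hw => ?_
    obtain ⟨h1, h2⟩ := mem_support_wordDer_joinLetter hu hn hw
    rw [inl_single, smul_mul_assoc, pair_mul_pair, List.append_nil, List.nil_append, dim_nil,
      zero_mul, pow_zero, one_smul]
    exact Submodule.smul_mem _ _ (pair_mem_partSpan h1 hv (by omega))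

theorem joinRight_mem_partSpan {S T : Finset ℕ} {k n : ℕ} (hn : n ∉ T) {x : BiChain}
    (hx : x ∈ partSpan S T k) : joinRight n x ∈ partSpan S (insert n T) (k + 1) := by
  induction hx using Submodule.span_induction with
  | zero => simp
  | add x z _ _ hx hz => rw [map_add]; exact add_mem hx hz
  | smul c x _ hx => rw [map_smul]; exact Submodule.smul_mem _ _ hx
  | mem x hx =>
    obtain ⟨u, v, hu, hv, hk, rfl⟩ := hx
    rw [der_pair, wordDer_zero, map_zero, zero_mul, zero_add, ← Finsupp.sum_single
      (wordDer (joinLetter n) v), Finsupp.sum, map_sum, Finset.mul_sum]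
    refine Submodule.smul_mem _ _ (Submodule.sum_mem _ fun w hw => ?_)
    obtain ⟨h1, h2⟩ := mem_support_wordDer_joinLetter hv hn hw
    rw [inr_single, mul_smul_comm, pair_mul_pair, List.append_nil, List.nil_append, dim_nil,
      zero_mul, pow_zero, one_smul]
    exact Submodule.smul_mem _ _ (pair_mem_partSpan hu h1 (by omega))

/-! ### The recursive permutahedral diagonal -/

/-- The first factor of the recursion: `n` is joined to the right factor. -/
noncomputable abbrev extendRight (n : ℕ) (τ : Finset ℕ → BiChain) : Finset ℕ → BiChain :=
  extend (joinRight n) (pair [] [{n}]) τ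

/-- The second factor of the recursion: `n` is joined to the left factor. -/
noncomputable abbrev extendLeft (n : ℕ) (τ : Finset ℕ → BiChain) : Finset ℕ → BiChain :=
  extend (joinLeft n) (pair [{n}] []) τ

/-- The diagonal of the top cell of the permutahedron on a non-empty subset `S` of
`{0, …, n - 1}`, defined by recursion on the maximal element of `S`. The value `0` at `∅` makes
empty blocks contribute nothing to convolutions. -/
noncomputable def permDiag : ℕ → Finset ℕ → BiChain
  | 0, _ => 0
  | n + 1, S =>
    if n ∈ S then
      conv (extendRight n (permDiag n)) (extendLeft n (permDiag n)) (S.erase n)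
    else permDiag n S

theorem permDiag_empty (n : ℕ) : permDiag n ∅ = 0 := by
  induction n with
  | zero => rfl
  | succ n ih => simpa [permDiag] using ih

theorem extendRight_mem_partSpan {n : ℕ} {τ : Finset ℕ → BiChain} {S : Finset ℕ} (hn : n ∉ S)
    (h0 : τ ∅ = 0) (hτ : τ S ∈ partSpan S S (S.card - 1)) :
    extendRight n τ S ∈ partSpan S (insert n S) S.card := by
  rw [extendRight, extend, Pi.sub_apply, alt_apply]
  by_cases h : S = ∅
  · subst h
    rw [h0]
    simpa [atEmpty] using pair_mem_partSpan isPartition_nil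
      (isPartition_singleton (Finset.singleton_nonempty n)) (by simp)
  · have hc := Finset.card_pos.2 (Finset.nonempty_iff_ne_empty.2 h)
    have := joinRight_mem_partSpan hn hτ
    rw [Nat.sub_add_cancel hc] at this
    rw [atEmpty, if_neg h, zero_sub]
    exact neg_mem (Submodule.smul_mem _ _ this)

theorem extendLeft_mem_partSpan {n : ℕ} {τ : Finset ℕ → BiChain} {S : Finset ℕ} (hn : n ∉ S)
    (h0 : τ ∅ = 0) (hτ : τ S ∈ partSpan S S (S.card - 1)) :
    extendLeft n τ S ∈ partSpan (insert n S) S S.card := by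
  rw [extendLeft, extend, Pi.sub_apply, alt_apply]
  by_cases h : S = ∅
  · subst h
    rw [h0]
    simpa [atEmpty] using pair_mem_partSpan (isPartition_singleton (Finset.singleton_nonempty n))
      isPartition_nil (by simp)
  · have hc := Finset.card_pos.2 (Finset.nonempty_iff_ne_empty.2 h)
    have := joinLeft_mem_partSpan hn hτ
    rw [Nat.sub_add_cancel hc] at this
    rw [atEmpty, if_neg h, zero_sub]
    exact neg_mem (Submodule.smul_mem _ _ this)

theorem permDiag_mem_partSpan (n : ℕ) : ∀ S, permDiag n S ∈ partSpan S S (S.card - 1) := by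
  induction n with
  | zero => intro S; rw [permDiag]; exact zero_mem _
  | succ n ih =>
    intro S
    rw [permDiag]
    split_ifs with hS
    · refine Submodule.sum_mem _ fun A hA => Submodule.smul_mem _ _ ?_
      rw [Finset.mem_powerset] at hA
      have hnA : n ∉ A := fun h => Finset.notMem_erase n S (hA h)
      have hnM : n ∉ S.erase n \ A := fun h => Finset.notMem_erase n S (Finset.mem_sdiff.1 h).1
      have := mul_mem_partSpan (S := A) (T := insert n A) (S' := insert n (S.erase n \ A))
        (T' := S.erase n \ A) (by
          rw [Finset.disjoint_insert_right]; exact ⟨hnA, Finset.disjoint_sdiff⟩) (by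
          rw [Finset.disjoint_insert_left]; exact ⟨hnM, Finset.disjoint_sdiff⟩)
        (extendRight_mem_partSpan hnA (permDiag_empty n) (ih A))
        (extendLeft_mem_partSpan hnM (permDiag_empty n) (ih _))
      rw [Finset.union_insert, Finset.insert_union, Finset.union_sdiff_of_subset hA,
        Finset.insert_erase hS] at this
      have hc := Finset.card_sdiff_add_card_eq_card hA
      rw [Finset.card_erase_of_mem hS] at hc
      rwa [show A.card + (S.erase n \ A).card = S.card - 1 by omega] at this
    · exact ih S

theorem grade_of_mem_partSpan {S T : Finset ℕ} {k : ℕ} {x : BiChain} (hx : x ∈ partSpan S T k) :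
    grade x = (-1 : ℤ) ^ k • x := by
  induction hx using Submodule.span_induction with
  | zero => simp
  | add x z _ _ hx hz => simp only [map_add, hx, hz, smul_add]
  | smul c x _ hx => rw [map_smul, hx, smul_comm]
  | mem x hx =>
    obtain ⟨u, v, hu, hv, hk, rfl⟩ := hx
    rw [grade_pair, hk]

theorem grade_permDiag (n : ℕ) (S : Finset ℕ) : grade (permDiag n S) = -alt (permDiag n) S := by
  by_cases h : S = ∅
  · subst h
    simp [alt, permDiag_empty]
  · rw [grade_of_mem_partSpan (permDiag_mem_partSpan n S), alt_apply]
    obtain ⟨k, hk⟩ := Nat.exists_eq_add_of_lt (Finset.card_pos.2 (Finset.nonempty_iff_ne_empty.2 h))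
    simp [hk, pow_succ, -zsmul_eq_mul]

/-- The vanishing of the defect on pairs of partitions, in the form required by `der_extend`. -/
theorem eq_of_defect {D : BiChain →ₗ[ℤ] BiChain} {b : BiChain} {S T : Finset ℕ} {k : ℕ}
    (h : ∀ u v, IsPartition S u → IsPartition T v → defect D b (pair u v) = 0) {x : BiChain}
    (hx : x ∈ partSpan S T k) : permDer (D x) + D (permDer x) = b * x - x * b := by
  rw [← sub_eq_zero, ← defect_apply]
  induction hx using Submodule.span_induction with
  | zero => simp
  | add x z _ _ hx hz => simp only [map_add, hx, hz, add_zero]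
  | smul c x _ hx => rw [map_smul, hx, smul_zero]
  | mem x hx =>
    obtain ⟨u, v, hu, hv, hk, rfl⟩ := hx
    exact h u v hu hv

theorem permBoundary_singleton (n : ℕ) : permBoundary {n} = 0 := by
  rw [permBoundary, Finset.sum_filter]
  refine Finset.sum_eq_zero fun A hA => ?_
  rw [Finset.mem_powerset, Finset.subset_singleton_iff] at hA
  rw [if_neg (by tauto)]

/-- The permutahedral diagonal is a chain map: it satisfies the twisting equation. -/
theorem permDer_permDiag (n : ℕ) : ∀ S ⊆ Finset.range n,
    permDer (permDiag n S) = conv (alt (permDiag n)) (permDiag n) S := by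
  induction n with
  | zero =>
    intro S _
    simp [permDiag, conv]
  | succ n ih =>
    intro S hS
    by_cases hn : n ∈ S
    · have hS' : S.erase n ⊆ Finset.range n := by
        intro x hx
        rw [Finset.mem_erase] at hx
        have := Finset.mem_range.1 (hS hx.2)
        rw [Finset.mem_range]; omega
      have hlt : ∀ s ∈ S.erase n, s < n := fun s hs => Finset.mem_range.1 (hS' hs)
      have hpart : ∀ (T : Finset ℕ), T ⊆ Finset.range n → ∀ w, IsPartition T w →
          ∀ A ∈ w, A.Nonempty ∧ ∀ a ∈ A, a < n := fun T hT w hw A hA =>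
        ⟨hw.1 A hA, fun a ha => Finset.mem_range.1 (hT (hw.subset A hA ha))⟩
      have key := der_conv_extend isOddDerivation_permDer (isOddDerivation_joinRight n)
        (isOddDerivation_joinLeft n) (b := pair [] [{n}]) (a := pair [{n}] [])
        (by rw [der_pair_right, permBoundary_singleton, map_zero]) (by simp)
        (by rw [der_pair_left, permBoundary_singleton, map_zero])
        ih (grade_permDiag n)
        (fun T hT => eq_of_defect (fun u v hu hv => defect_joinRight (hpart T hT v hv))
          (permDiag_mem_partSpan n T))
        (fun T hT => eq_of_defect (fun u v hu hv => defect_joinLeft (hpart T hT u hu))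
          (permDiag_mem_partSpan n T)) hS'
      have e1 : ∀ A ⊆ S.erase n, permDiag (n + 1) A = permDiag n A := fun A hA => by
        rw [permDiag, if_neg fun h => Finset.notMem_erase n S (hA h)]
      have e2 : ∀ A ⊆ S.erase n, permDiag (n + 1) (insert n A) =
          conv (extendRight n (permDiag n)) (extendLeft n (permDiag n)) A := fun A hA => by
        rw [permDiag, if_pos (Finset.mem_insert_self n A),
          Finset.erase_insert fun h => Finset.notMem_erase n S (hA h)]
      have e1' : ∀ A ⊆ S.erase n, alt (permDiag (n + 1)) A = alt (permDiag n) A := fun A hA => by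
        rw [alt, alt, e1 A hA]
      conv_lhs => rw [permDiag, if_pos hn, key]
      rw [← Finset.insert_erase hn, conv_alt_insert _ hlt, Finset.insert_erase hn]
      congr 1
      · exact conv_congr (fun A hA => (e1' A hA).symm) fun A hA => (e2 A hA).symm
      · exact conv_congr (fun A hA => by rw [alt, alt, e2 A hA]) fun A hA => (e1' A hA).symm
    · have hS' : S ⊆ Finset.range n := by
        intro x hx
        have := Finset.mem_range.1 (hS hx)
        have : x ≠ n := fun h => hn (h ▸ hx)
        rw [Finset.mem_range]; omega
      have e1 : ∀ A ⊆ S, permDiag (n + 1) A = permDiag n A := fun A hA => by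
        rw [permDiag, if_neg fun h => hn (hA h)]
      rw [e1 S subset_rfl, ih S hS']
      exact conv_congr (fun A hA => by rw [alt, alt, e1 A hA]) fun A hA => (e1 A hA).symm

/-! ### The projection of permutahedra onto permutocubes -/

/-- The cellular projection of the permutahedron on a set containing `0` onto the permutocube: the
elements in singleton blocks before the block of `0` are deleted, and cells with a bigger block
before the block of `0` are collapsed. -/
noncomputable def project : Word → (Word →₀ ℤ)
  | [] => 0
  | A :: t => if 0 ∈ A then Finsupp.single (A :: t) 1 else if A.card = 1 then project t else 0

/-- The linear extension of `project`. -/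
noncomputable def projectLin : (Word →₀ ℤ) →ₗ[ℤ] (Word →₀ ℤ) := Finsupp.linearCombination ℤ project

/-- The linear extension of a derivation of words. -/
noncomputable def wordDerLin (f : Finset ℕ → (Word →₀ ℤ)) : (Word →₀ ℤ) →ₗ[ℤ] (Word →₀ ℤ) :=
  Finsupp.linearCombination ℤ (wordDer f)

@[simp] theorem projectLin_single (w : Word) (k : ℤ) :
    projectLin (Finsupp.single w k) = k • project w := by simp [projectLin]

@[simp] theorem wordDerLin_single (f : Finset ℕ → (Word →₀ ℤ)) (w : Word) (k : ℤ) :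
    wordDerLin f (Finsupp.single w k) = k • wordDer f w := by simp [wordDerLin]

theorem projectLin_mapDomain_cons_of_mem {A : Finset ℕ} (h : 0 ∈ A) (x : Word →₀ ℤ) :
    projectLin (x.mapDomain (A :: ·)) = x.mapDomain (A :: ·) := by
  induction x using Finsupp.induction_linear with
  | zero => simp
  | add x y hx hy => simp only [Finsupp.mapDomain_add, map_add, hx, hy]
  | single u k => simp [Finsupp.mapDomain_single, project, h]

theorem projectLin_mapDomain_cons_of_card {A : Finset ℕ} (h : 0 ∉ A) (h1 : A.card = 1)
    (x : Word →₀ ℤ) : projectLin (x.mapDomain (A :: ·)) = projectLin x := by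
  induction x using Finsupp.induction_linear with
  | zero => simp
  | add x y hx hy => simp only [Finsupp.mapDomain_add, map_add, hx, hy]
  | single u k => simp [Finsupp.mapDomain_single, project, h, h1]

theorem projectLin_mapDomain_cons_eq_zero {A : Finset ℕ} (h : 0 ∉ A) (h1 : A.card ≠ 1)
    (x : Word →₀ ℤ) : projectLin (x.mapDomain (A :: ·)) = 0 := by
  induction x using Finsupp.induction_linear with
  | zero => simp
  | add x y hx hy => simp only [Finsupp.mapDomain_add, map_add, hx, hy, add_zero]
  | single u k => simp [Finsupp.mapDomain_single, project, h, h1]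

theorem wordDer_congr {f g : Finset ℕ → (Word →₀ ℤ)} {w : Word} (h : ∀ A ∈ w, f A = g A) :
    wordDer f w = wordDer g w := by
  induction w with
  | nil => rfl
  | cons A t ih => rw [wordDer, wordDer, h A (by simp), ih fun B hB => h B (by simp [hB])]

theorem shuff_singleton_left {j : ℕ} {M : Finset ℕ} :
    shuff {j} M = (-1) ^ (M.filter (· < j)).card := by
  rw [shuff_eq_prod, Finset.prod_singleton, Finset.prod_ite]
  simp

theorem shuff_singleton_add {x y : ℕ} (h : x ≠ y) : shuff {x} {y} + shuff {y} {x} = 0 := by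
  rcases h.lt_or_gt with h | h
  · simp [shuff_eq_prod, h, h.not_gt]
  · simp [shuff_eq_prod, h, h.not_gt]

theorem mapDomain_permBoundary (A : Finset ℕ) (t : Word) :
    (permBoundary A).mapDomain (· ++ t) =
      ∑ B ∈ A.powerset.filter (fun B => B ≠ ∅ ∧ B ≠ A),
        Finsupp.single (B :: (A \ B) :: t) ((-1) ^ B.card * shuff B (A \ B)) := by
  simp only [permBoundary, Finsupp.mapDomain_finsetSum, Finsupp.mapDomain_single]
  rfl

/-- On a block containing `0`, the boundary of the permutahedron is projected to that of the
permutocube. -/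
theorem projectLin_mapDomain_permBoundary {A : Finset ℕ} (h0 : 0 ∈ A) (t : Word) :
    projectLin ((permBoundary A).mapDomain (· ++ t)) = (blockBoundary A).mapDomain (· ++ t) := by
  rw [mapDomain_permBoundary, blockBoundary, if_pos h0, Finsupp.mapDomain_add,
    Finsupp.mapDomain_finsetSum, Finsupp.mapDomain_finsetSum, map_sum,
    ← Finset.sum_filter_not_add_sum_filter _ (fun B => 0 ∈ B)]
  congr 1
  · rw [← Finset.sum_filter_add_sum_filter_not _ (fun B => B.card = 1)]
    have hz : ∀ B ∈ ((A.powerset.filter fun B => B ≠ ∅ ∧ B ≠ A).filter fun B => 0 ∉ B).filter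
        (fun B => ¬ B.card = 1),
        projectLin (Finsupp.single (B :: (A \ B) :: t) ((-1) ^ B.card * shuff B (A \ B))) = 0 := by
      intro B hB
      simp only [Finset.mem_filter] at hB
      rw [projectLin_single, project, if_neg hB.1.2, if_neg hB.2, smul_zero]
    rw [Finset.sum_eq_zero hz, add_zero]
    symm
    refine Finset.sum_bij (fun j _ => {j}) ?_ ?_ ?_ ?_
    · intro j hj
      rw [Finset.mem_erase] at hj
      simp only [Finset.mem_filter, Finset.mem_powerset, Finset.singleton_subset_iff,
        Finset.mem_singleton, Finset.card_singleton, and_true]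
      refine ⟨⟨hj.2, Finset.singleton_ne_empty j, fun h => hj.1 ?_⟩, fun h => hj.1 h.symm⟩
      rw [← h, Finset.mem_singleton] at h0
      exact h0.symm
    · intro a _ b _ h
      exact Finset.singleton_injective h
    · intro B hB
      simp only [Finset.mem_filter, Finset.mem_powerset] at hB
      obtain ⟨j, rfl⟩ := Finset.card_eq_one.1 hB.2
      refine ⟨j, Finset.mem_erase.2 ⟨fun h => hB.1.2 (by simp [h]), by simpa using hB.1.1.1⟩, rfl⟩
    · intro j hj
      rw [Finset.mem_erase] at hj
      have h0j : 0 ∉ ({j} : Finset ℕ) := fun h => hj.1 (Finset.mem_singleton.1 h).symm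
      have h0A : 0 ∈ A \ {j} := Finset.mem_sdiff.2 ⟨h0, h0j⟩
      rw [projectLin_single, project, if_neg h0j, if_pos (Finset.card_singleton j), project,
        if_pos h0A, shuff_singleton_left, Finsupp.mapDomain_single, Finset.card_singleton,
        Finset.sdiff_singleton_eq_erase, Finsupp.smul_single, smul_eq_mul, mul_one, pow_succ]
      congr 1
      have : (A.erase j).filter (· < j) = A.filter (· < j) := by
        ext x; simp only [Finset.mem_filter, Finset.mem_erase]; constructor
        · tauto
        · rintro ⟨h1, h2⟩; exact ⟨⟨h2.ne, h1⟩, h2⟩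
      rw [this]
      ring
  · refine Finset.sum_congr ?_ fun B hB => ?_
    · ext B
      simp only [Finset.mem_filter, Finset.mem_powerset]
      constructor
      · rintro ⟨⟨h1, h2, h3⟩, h4⟩; exact ⟨h1, h4, h3⟩
      · rintro ⟨h1, h2, h3⟩
        exact ⟨⟨h1, Finset.nonempty_iff_ne_empty.1 ⟨0, h2⟩, h3⟩, h2⟩
    · simp only [Finset.mem_filter] at hB
      rw [projectLin_single, project, if_pos hB.2.1, Finsupp.mapDomain_single,
        Finsupp.smul_single, smul_eq_mul, mul_one]
      rfl

/-- The boundary of a block of at least two elements before the block of `0` is collapsed; for two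
elements the two terms cancel. -/
theorem projectLin_mapDomain_permBoundary_eq_zero {A : Finset ℕ} (h0 : 0 ∉ A) (t : Word) :
    projectLin ((permBoundary A).mapDomain (· ++ t)) = 0 := by
  rw [mapDomain_permBoundary, map_sum]
  have hcard : ∀ B ⊆ A, A \ (A \ B) = B := fun B hB => by
    rw [Finset.sdiff_sdiff_eq_self hB]
  have hf : ∀ B ⊆ A, projectLin (Finsupp.single (B :: (A \ B) :: t)
      ((-1) ^ B.card * shuff B (A \ B))) =
      if B.card = 1 ∧ (A \ B).card = 1 then -shuff B (A \ B) • project t else 0 := by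
    intro B hB
    have h1 : 0 ∉ B := fun h => h0 (hB h)
    have h2 : 0 ∉ A \ B := fun h => h0 (Finset.mem_sdiff.1 h).1
    rw [projectLin_single, project, if_neg h1, project, if_neg h2]
    split_ifs <;> simp_all
  refine Finset.sum_involution (fun B _ => A \ B) ?_ ?_ ?_ ?_
  · intro B hB
    simp only [Finset.mem_filter, Finset.mem_powerset] at hB
    rw [hf B hB.1, hf _ Finset.sdiff_subset, hcard B hB.1]
    by_cases h : B.card = 1 ∧ (A \ B).card = 1
    · rw [if_pos h, if_pos h.symm, ← add_smul, ← neg_add]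
      obtain ⟨x, hx⟩ := Finset.card_eq_one.1 h.1
      obtain ⟨y, hy⟩ := Finset.card_eq_one.1 h.2
      have hxy : x ≠ y := by
        rintro rfl
        have : x ∈ A \ B := by rw [hy]; simp
        exact (Finset.mem_sdiff.1 this).2 (by rw [hx]; simp)
      rw [hy, hx, shuff_singleton_add hxy, neg_zero, zero_smul]
    · rw [if_neg h, if_neg fun h' => h h'.symm, add_zero]
  · intro B hB _ h
    simp only [Finset.mem_filter, Finset.mem_powerset] at hB
    obtain ⟨x, hx⟩ := Finset.nonempty_iff_ne_empty.2 hB.2.1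
    have := hx
    rw [← h, Finset.mem_sdiff] at this
    exact this.2 hx
  · intro B hB
    simp only [Finset.mem_filter, Finset.mem_powerset] at hB ⊢
    refine ⟨Finset.sdiff_subset, fun h => hB.2.2 ?_, fun h => hB.2.1 ?_⟩
    · exact hB.1.antisymm (Finset.sdiff_eq_empty_iff_subset.1 h)
    · have := hcard B hB.1
      rw [h, Finset.sdiff_self] at this
      exact this.symm
  · intro B hB
    simp only [Finset.mem_filter, Finset.mem_powerset] at hB
    exact hcard B hB.1

/-- The projection is a chain map. Dropping a singleton block does not change signs, as its
dimension is zero. -/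
theorem projectLin_wordDer {w : Word} : ∀ {S : Finset ℕ}, IsPartition S w →
    projectLin (wordDer permBoundary w) = wordDerLin blockBoundary (project w) := by
  induction w with
  | nil => intro S _; simp [wordDer, project]
  | cons A t ih =>
    intro S hS
    obtain ⟨hA, hd, rfl, ht⟩ := hS.cons_inv
    rw [wordDer, map_add, map_smul]
    by_cases h0 : 0 ∈ A
    · have h0t : ∀ B ∈ t, permBoundary B = blockBoundary B := fun B hB =>
        (blockBoundary_of_notMem fun h => Finset.disjoint_left.1 hd h0
          (mem_carrier.2 ⟨B, hB, h⟩)).symm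
      rw [projectLin_mapDomain_permBoundary h0, projectLin_mapDomain_cons_of_mem h0, project,
        if_pos h0, wordDerLin_single, one_smul, wordDer, wordDer_congr h0t]
    · rw [projectLin_mapDomain_permBoundary_eq_zero h0, project, if_neg h0, zero_add]
      split_ifs with h1
      · rw [projectLin_mapDomain_cons_of_card h0 h1, h1, ih ht]
        simp
      · rw [projectLin_mapDomain_cons_eq_zero h0 h1, smul_zero, map_zero]

/-- The projection commutes with joining `n` to the blocks: a collapsed cell stays collapsed, and a
deleted singleton becomes a collapsed block of two elements. -/
theorem projectLin_wordDer_joinLetter {n : ℕ} (hn : n ≠ 0) (w : Word) :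
    projectLin (wordDer (joinLetter n) w) = wordDerLin (joinLetter n) (project w) := by
  induction w with
  | nil => simp [wordDer, project]
  | cons A t ih =>
    rw [wordDer, map_add, map_smul]
    by_cases h0 : 0 ∈ A
    · have : projectLin ((joinLetter n A).mapDomain (· ++ t)) =
          (joinLetter n A).mapDomain (· ++ t) := by
        unfold joinLetter
        split_ifs with h
        · simp
        · simp [Finsupp.mapDomain_single, project, h0]
      rw [this, projectLin_mapDomain_cons_of_mem h0, project,
        if_pos h0, wordDerLin_single, one_smul, wordDer]
    · have : projectLin ((joinLetter n A).mapDomain (· ++ t)) = 0 := by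
        unfold joinLetter
        split_ifs with h
        · simp
        · push Not at h
          have h1 : (insert n A).card ≠ 1 := by
            have := Finset.card_pos.2 h.2
            rw [Finset.card_insert_of_notMem h.1]
            omega
          have h2 : 0 ∉ insert n A := by
            rw [Finset.mem_insert]; push Not; exact ⟨hn.symm, h0⟩
          simp only [Finsupp.mapDomain_single, List.cons_append, projectLin_single, project]
          rw [if_neg h2, if_neg h1, smul_zero]
      rw [this, project, if_neg h0, zero_add]
      split_ifs with h1
      · rw [projectLin_mapDomain_cons_of_card h0 h1, h1, ih]
        simp
      · rw [projectLin_mapDomain_cons_eq_zero h0 h1, smul_zero, map_zero]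

theorem project_append_of_mem {u : Word} (h : 0 ∈ carrier u) (u' : Word) :
    project (u ++ u') = (project u).mapDomain (· ++ u') := by
  induction u with
  | nil => simp [carrier] at h
  | cons A t ih =>
    rw [List.cons_append, project, project]
    split_ifs with h0 h1
    · simp [Finsupp.mapDomain_single]
    · rw [carrier_cons, Finset.mem_union] at h
      exact ih (h.resolve_left h0)
    · simp

theorem project_append_of_notMem {u : Word} (h : 0 ∉ carrier u) (h1 : ∀ A ∈ u, A.Nonempty)
    (u' : Word) : project (u ++ u') = if dim u = 0 then project u' else 0 := by
  induction u with
  | nil => simp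
  | cons A t ih =>
    rw [carrier_cons, Finset.mem_union, not_or] at h
    rw [List.cons_append, project, if_neg h.1, ih h.2 fun B hB => h1 B (by simp [hB]), dim_cons]
    have := Finset.card_pos.2 (h1 A (by simp))
    split_ifs <;> first | rfl | omega

/-- The projection of a cell is zero or a cell of the same dimension. -/
theorem project_eq (u : Word) : project u = 0 ∨
    ∃ w, project u = Finsupp.single w 1 ∧ dim w = dim u ∧ ∀ A ∈ w, A ∈ u := by
  induction u with
  | nil => exact Or.inl rfl
  | cons A t ih =>
    rw [project]
    split_ifs with h0 h1
    · exact Or.inr ⟨_, rfl, rfl, fun _ h => h⟩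
    · rcases ih with h | ⟨w, h2, h3, h4⟩
      · exact Or.inl h
      · exact Or.inr ⟨w, h2, by simp [h3, h1], fun B hB => List.mem_cons_of_mem _ (h4 B hB)⟩
    · exact Or.inl rfl

/-- The projection applied to both factors of a pair of words. -/
noncomputable def biProject : BiChain →ₗ[ℤ] BiChain :=
  lift fun u v => inl (project u) * inr (project v)

theorem biProject_pair (u v : Word) :
    biProject (pair u v) = inl (project u) * inr (project v) := by simp [biProject]

theorem biProject_inl_mul_inr (x y : Word →₀ ℤ) :
    biProject (inl x * inr y) = inl (projectLin x) * inr (projectLin y) := by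
  induction x using Finsupp.induction_linear with
  | zero => simp
  | add x z hx hz => simp only [map_add, add_mul, hx, hz]
  | single u k =>
    induction y using Finsupp.induction_linear with
    | zero => simp
    | add x z hx hz => simp only [map_add, mul_add, hx, hz]
    | single v l =>
      simp only [inl_single, inr_single, smul_mul_assoc, mul_smul_comm, map_smul, pair_mul_pair,
        projectLin_single]
      simp [biProject_pair, -zsmul_eq_mul]

theorem der_inl_mul_inr (f g : Finset ℕ → (Word →₀ ℤ)) (u v : Word) :
    der f g (inl (project u) * inr (project v)) =
      inl (wordDerLin f (project u)) * inr (project v) +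
        (-1 : ℤ) ^ dim u • (inl (project u) * inr (wordDerLin g (project v))) := by
  rcases project_eq u with h | ⟨w, h, hd, -⟩
  · simp [h]
  rcases project_eq v with h' | ⟨w', h', hd', -⟩
  · simp [h']
  rw [h, h', inl_single, inr_single, one_smul, one_smul, pair_mul_pair, wordDerLin_single,
    wordDerLin_single, one_smul, one_smul, ← hd]
  simp [der_pair]

theorem biProject_der {f g f' g' : Finset ℕ → (Word →₀ ℤ)} {u v : Word}
    (hu : projectLin (wordDer f u) = wordDerLin f' (project u))
    (hv : projectLin (wordDer g v) = wordDerLin g' (project v)) :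
    biProject (der f g (pair u v)) = der f' g' (biProject (pair u v)) := by
  have h1 : ∀ a, pair a [] = inl (Finsupp.single a 1) := fun a => by simp
  have h2 : ∀ a, pair [] a = inr (Finsupp.single a 1) := fun a => by simp
  rw [biProject_pair, der_inl_mul_inr, der_pair, map_add, map_smul, h1, h2,
    biProject_inl_mul_inr, biProject_inl_mul_inr, hu, hv, projectLin_single, projectLin_single,
    one_smul, one_smul]

theorem oddShift_blockBoundary (S : Finset ℕ) : OddShift (blockBoundary S) (S.card - 1) := by
  unfold blockBoundary
  split_ifs with h0
  · refine OddShift.add (OddShift.sum fun j hj => OddShift.single ?_ _)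
      (OddShift.sum fun A hA => OddShift.single ?_ _)
    · rw [Finset.mem_erase] at hj
      have h1 : 0 ∈ S.erase j := Finset.mem_erase.2 ⟨hj.1.symm, h0⟩
      have := Finset.card_pos.2 ⟨0, h1⟩
      have h2 := Finset.card_erase_of_mem hj.2
      simp only [dim_cons, dim_nil]
      rw [Nat.odd_iff]
      omega
    · simp only [Finset.mem_filter, Finset.mem_powerset] at hA
      obtain ⟨h1, h2, h3⟩ := hA
      have c1 := Finset.card_pos.2 ⟨0, h2⟩
      have c2 := Finset.card_pos.2 (Finset.sdiff_nonempty.2 fun h => h3 (h1.antisymm h))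
      have c3 := Finset.card_sdiff_add_card_eq_card h1
      simp only [dim_cons, dim_nil]
      rw [Nat.odd_iff]
      omega
  · exact oddShift_permBoundary S

/-- The differential of pairs of words. -/
noncomputable abbrev cellDer : BiChain →ₗ[ℤ] BiChain := der blockBoundary blockBoundary

theorem isOddDerivation_cellDer : IsOddDerivation cellDer :=
  isOddDerivation_der oddShift_blockBoundary oddShift_blockBoundary

theorem eqOn_partSpan {S T : Finset ℕ} {k : ℕ} {M : Type*} [AddCommGroup M]
    {f g : BiChain →ₗ[ℤ] M}
    (h : ∀ u v, IsPartition S u → IsPartition T v → dim u + dim v = k →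
      f (pair u v) = g (pair u v))
    {x : BiChain} (hx : x ∈ partSpan S T k) : f x = g x := by
  refine LinearMap.eqOn_span (R := ℤ) ?_ hx
  rintro _ ⟨u, v, hu, hv, hk, rfl⟩
  exact h u v hu hv hk

theorem biProject_permDer {S T : Finset ℕ} {k : ℕ} {x : BiChain} (hx : x ∈ partSpan S T k) :
    biProject (permDer x) = cellDer (biProject x) :=
  eqOn_partSpan (f := biProject ∘ₗ permDer) (g := cellDer ∘ₗ biProject) (fun _ _ hu hv _ =>
    biProject_der (projectLin_wordDer hu) (projectLin_wordDer hv)) hx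

theorem cellDer_eq_permDer {S T : Finset ℕ} {k : ℕ} {x : BiChain} (hS : 0 ∉ S) (hT : 0 ∉ T)
    (hx : x ∈ partSpan S T k) : cellDer x = permDer x := by
  refine eqOn_partSpan (fun u v hu hv _ => ?_) hx
  rw [der_pair, der_pair,
    wordDer_congr (w := u) fun A hA => blockBoundary_of_notMem fun h => hS (hu.subset A hA h),
    wordDer_congr (w := v) fun A hA => blockBoundary_of_notMem fun h => hT (hv.subset A hA h)]

theorem wordDer_zero_comm (w : Word) : projectLin (wordDer 0 w) = wordDerLin 0 (project w) := by
  rcases project_eq w with h | ⟨w', h, -, -⟩ <;> simp [h]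

theorem biProject_joinLeft {n : ℕ} (hn : n ≠ 0) (x : BiChain) :
    biProject (joinLeft n x) = joinLeft n (biProject x) := by
  have : biProject ∘ₗ joinLeft n = joinLeft n ∘ₗ biProject :=
    hom_ext fun u v => biProject_der (projectLin_wordDer_joinLetter hn u) (wordDer_zero_comm v)
  exact LinearMap.congr_fun this x

theorem biProject_joinRight {n : ℕ} (hn : n ≠ 0) (x : BiChain) :
    biProject (joinRight n x) = joinRight n (biProject x) := by
  have : biProject ∘ₗ joinRight n = joinRight n ∘ₗ biProject :=
    hom_ext fun u v => biProject_der (wordDer_zero_comm u) (projectLin_wordDer_joinLetter hn v)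
  exact LinearMap.congr_fun this x

/-- If `0` occurs in the first factor of a product, the second factor is not affected by the
projection. -/
theorem biProject_mul_of_mem {S T : Finset ℕ} {k : ℕ} (hS : 0 ∈ S) (hT : 0 ∈ T) {x : BiChain}
    (hx : x ∈ partSpan S T k) (y : BiChain) : biProject (x * y) = biProject x * y := by
  refine eqOn_partSpan (f := biProject ∘ₗ LinearMap.mulRight ℤ y)
    (g := LinearMap.mulRight ℤ y ∘ₗ biProject) (fun u v hu hv _ => ?_) hx
  simp only [LinearMap.comp_apply, LinearMap.mulRight_apply]
  induction y using induction_on with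
  | add x y hx hy => simp only [map_add, mul_add, hx, hy]
  | smul k x hx => simp only [map_smul, mul_smul_comm, hx]
  | pair u' v' =>
    rw [pair_mul_pair, map_smul, biProject_pair, biProject_pair,
      project_append_of_mem (by rwa [hu.2.2]), project_append_of_mem (by rwa [hv.2.2]),
      inl_mapDomain_append, inr_mapDomain_append]
    rcases project_eq v with h | ⟨w, h, hd, -⟩
    · simp [h]
    · rw [h, inr_single, one_smul, ← hd]
      have h1 : pair [] w * pair u' [] = (-1 : ℤ) ^ (dim w * dim u') • (pair u' [] * pair [] w) :=
        by simp [pair_mul_pair]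
      have h2 : pair u' v' = pair u' [] * pair [] v' := by simp [pair_mul_pair]
      rw [h2, mul_assoc, mul_assoc, ← mul_assoc (pair [] w), h1]
      simp only [smul_mul_assoc, mul_smul_comm, mul_assoc]

/-- If the first factor of a product has positive total dimension and does not contain `0`, then one
of the two members has a block of at least two elements before the block of `0` and is
collapsed. -/
theorem biProject_mul_eq_zero {S T : Finset ℕ} {k : ℕ} (hS : 0 ∉ S) (hT : 0 ∉ T) (hk : k ≠ 0)
    {x : BiChain} (hx : x ∈ partSpan S T k) (y : BiChain) : biProject (x * y) = 0 := by
  refine eqOn_partSpan (f := biProject ∘ₗ LinearMap.mulRight ℤ y) (g := 0)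
    (fun u v hu hv huv => ?_) hx
  simp only [LinearMap.comp_apply, LinearMap.mulRight_apply, LinearMap.zero_apply]
  induction y using induction_on with
  | add x y hx hy => simp only [map_add, mul_add, hx, hy, add_zero]
  | smul k x hx => simp only [map_smul, mul_smul_comm, hx, smul_zero]
  | pair u' v' =>
    rw [pair_mul_pair, map_smul, biProject_pair, project_append_of_notMem (by rwa [hu.2.2]) hu.1,
      project_append_of_notMem (by rwa [hv.2.2]) hv.1]
    by_cases h : dim u = 0
    · rw [if_neg (show dim v ≠ 0 by omega)]; simp
    · rw [if_neg h]; simp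

/-- If the first factor of a product consists of singleton blocks without `0`, it is deleted. -/
theorem biProject_pair_mul {S T : Finset ℕ} (hS : 0 ∉ S) (hT : 0 ∉ T) {u v : Word}
    (hu : IsPartition S u) (hv : IsPartition T v) (hdu : dim u = 0) (hdv : dim v = 0)
    (y : BiChain) : biProject (pair u v * y) = biProject y := by
  induction y using induction_on with
  | add x y hx hy => simp only [map_add, mul_add, hx, hy]
  | smul k x hx => simp only [map_smul, mul_smul_comm, hx]
  | pair u' v' =>
    rw [pair_mul_pair, hdv, zero_mul, pow_zero, one_smul, biProject_pair, biProject_pair,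
      project_append_of_notMem (by rwa [hu.2.2]) hu.1,
      project_append_of_notMem (by rwa [hv.2.2]) hv.1, if_pos hdu, if_pos hdv]

/-! ### The recursive permutocube diagonal -/

theorem permDiag_singleton {n s : ℕ} (h : s < n) : permDiag n {s} = pair [{s}] [{s}] := by
  induction n with
  | zero => omega
  | succ n ih =>
    rw [permDiag]
    split_ifs with hs
    · obtain rfl := Finset.mem_singleton.1 hs
      rw [Finset.erase_eq_empty_iff _ _ |>.2 (Or.inr rfl), conv]
      simp [extend, atEmpty, alt, permDiag_empty, pair_mul_pair]
    · exact ih (by rw [Finset.mem_singleton] at hs; omega)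

/-- The diagonal of the top cell of the permutocube on a set `S` of numbers less than `n`, with
`0 ∈ S`, as the projection of the diagonal of the permutahedron on `S`. -/
noncomputable def cubeDiag (n : ℕ) (S : Finset ℕ) : BiChain := biProject (permDiag n S)

/-- The permutocube diagonal satisfies the same recursion as the permutahedral one, with an
additional term for the deletion of the maximal element. -/
theorem cubeDiag_succ {n : ℕ} (hn : n ≠ 0) {S : Finset ℕ} (h0 : 0 ∈ S) (hnS : n ∉ S) :
    cubeDiag (n + 1) (insert n S) =
      ∑ A ∈ S.powerset.filter (0 ∈ ·), shuff A (S \ A) •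
        (extendRight n (cubeDiag n) A * extendLeft n (permDiag n) (S \ A)) +
      extendLeft n (cubeDiag n) S := by
  rw [cubeDiag, permDiag, if_pos (Finset.mem_insert_self n S), Finset.erase_insert hnS, conv,
    map_sum, ← Finset.sum_filter_add_sum_filter_not _ (0 ∈ ·)]
  congr 1
  · refine Finset.sum_congr rfl fun A hA => ?_
    rw [Finset.mem_filter, Finset.mem_powerset] at hA
    have hne : A ≠ ∅ := Finset.nonempty_iff_ne_empty.1 ⟨0, hA.2⟩
    rw [map_smul, biProject_mul_of_mem hA.2 (Finset.mem_insert_of_mem hA.2)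
      (extendRight_mem_partSpan (fun h => hnS (hA.1 h)) (permDiag_empty n)
        (permDiag_mem_partSpan n A))]
    congr 2
    simp only [extend, Pi.sub_apply, atEmpty, if_neg hne, zero_sub, map_neg, alt, map_smul,
      biProject_joinRight hn, cubeDiag]
  · rw [Finset.sum_eq_single ∅]
    · have h1 : extendRight n (permDiag n) ∅ = pair [] [{n}] := by
        simp [extend, atEmpty, alt, permDiag_empty]
      have hne : S ≠ ∅ := Finset.nonempty_iff_ne_empty.1 ⟨0, h0⟩
      rw [shuff_empty_left, one_smul, h1, Finset.sdiff_empty, biProject_pair_mul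
        (S := ∅) (T := {n}) (by simp) (by simpa using hn.symm)
        isPartition_nil (isPartition_singleton (Finset.singleton_nonempty n)) (by simp) (by simp)]
      simp only [extend, Pi.sub_apply, atEmpty, if_neg hne, zero_sub, map_neg, alt, map_smul,
        biProject_joinLeft hn, cubeDiag]
    · intro A hA hne
      rw [Finset.mem_filter, Finset.mem_powerset] at hA
      have h0' : 0 ∉ insert n A := by
        rw [Finset.mem_insert]; push Not; exact ⟨hn.symm, hA.2⟩
      rw [map_smul, biProject_mul_eq_zero hA.2 h0' (Finset.card_ne_zero.2
        (Finset.nonempty_iff_ne_empty.2 hne)) (extendRight_mem_partSpan (fun h => hnS (hA.1 h))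
          (permDiag_empty n) (permDiag_mem_partSpan n A)), smul_zero]
    · intro h
      exact absurd (Finset.mem_filter.2 ⟨Finset.empty_mem_powerset S, Finset.notMem_empty 0⟩) h

/-- The permutocube diagonal is a chain map on the top cell. -/
theorem cellDer_cubeDiag {n : ℕ} {S : Finset ℕ} (hS : S ⊆ Finset.range n) (h0 : 0 ∈ S) :
    cellDer (cubeDiag n S) =
      ∑ j ∈ S.erase 0, (-1 : ℤ) ^ ((S.filter (· < j)).card + 1) • cubeDiag n (S.erase j) +
      ∑ A ∈ S.powerset.filter (fun A => 0 ∈ A ∧ A ≠ S), ((-1 : ℤ) ^ A.card * shuff A (S \ A)) •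
        (cubeDiag n A * permDiag n (S \ A)) := by
  rw [cubeDiag, ← biProject_permDer (permDiag_mem_partSpan n S), permDer_permDiag n S hS, conv,
    map_sum, ← Finset.sum_filter_not_add_sum_filter _ (0 ∈ ·)]
  congr 1
  · rw [← Finset.sum_filter_add_sum_filter_not _ (fun B => B.card = 1)]
    have hz : ∀ B ∈ (S.powerset.filter fun B => 0 ∉ B).filter (fun B => ¬ B.card = 1),
        biProject (shuff B (S \ B) • (alt (permDiag n) B * permDiag n (S \ B))) = 0 := by
      intro B hB
      simp only [Finset.mem_filter] at hB
      rw [map_smul, alt_apply, smul_mul_assoc, map_smul]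
      by_cases h : B = ∅
      · rw [h, permDiag_empty]; simp
      · have := Finset.card_pos.2 (Finset.nonempty_iff_ne_empty.2 h)
        rw [biProject_mul_eq_zero hB.1.2 hB.1.2 (by omega) (permDiag_mem_partSpan n B)]
        simp
    rw [Finset.sum_eq_zero hz, add_zero]
    symm
    refine Finset.sum_bij (fun j _ => {j}) ?_ ?_ ?_ ?_
    · intro j hj
      rw [Finset.mem_erase] at hj
      simp only [Finset.mem_filter, Finset.mem_powerset, Finset.singleton_subset_iff,
        Finset.mem_singleton, Finset.card_singleton, and_true]
      exact ⟨hj.2, fun h => hj.1 h.symm⟩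
    · intro a _ b _ h
      exact Finset.singleton_injective h
    · intro B hB
      simp only [Finset.mem_filter, Finset.mem_powerset] at hB
      obtain ⟨j, rfl⟩ := Finset.card_eq_one.1 hB.2
      refine ⟨j, Finset.mem_erase.2 ⟨fun h => hB.1.2 (by simp [h]), by simpa using hB.1.1⟩, rfl⟩
    · intro j hj
      rw [Finset.mem_erase] at hj
      have h0j : 0 ∉ ({j} : Finset ℕ) := fun h => hj.1 (Finset.mem_singleton.1 h).symm
      have hp := isPartition_singleton (Finset.singleton_nonempty j)
      rw [map_smul, alt_apply, smul_mul_assoc, map_smul,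
        permDiag_singleton (Finset.mem_range.1 (hS hj.2)),
        biProject_pair_mul h0j h0j hp hp (by simp) (by simp), smul_smul, shuff_singleton_left,
        Finset.card_singleton, Finset.sdiff_singleton_eq_erase, pow_succ, cubeDiag, pow_one]
      have : (S.erase j).filter (· < j) = S.filter (· < j) := by
        ext x; simp only [Finset.mem_filter, Finset.mem_erase]; constructor
        · tauto
        · rintro ⟨h1, h2⟩; exact ⟨⟨h2.ne, h1⟩, h2⟩
      rw [this]
  · rw [← Finset.sum_filter_of_ne (p := (· ≠ S)), Finset.filter_filter]
    · refine Finset.sum_congr rfl fun A hA => ?_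
      simp only [Finset.mem_filter] at hA
      rw [map_smul, alt_apply, smul_mul_assoc, map_smul,
        biProject_mul_of_mem hA.2.1 hA.2.1 (permDiag_mem_partSpan n A), smul_smul, mul_comm,
        cubeDiag]
    · rintro A _ h rfl
      rw [Finset.sdiff_self, permDiag_empty, mul_zero, smul_zero, map_zero] at h
      exact h rfl

/-! ### Joining a new maximal element to a block -/

/-- The words obtained from `w` by joining `n` to one of its blocks, each together with the
dimension of the part of `w` after that block. -/
def joins (n : ℕ) : Word → List (ℕ × Word)
  | [] => []
  | A :: t => (dim t, insert n A :: t) :: (joins n t).map fun p => (p.1, A :: p.2)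

/-- The word `w` with `n` joined to its first block; `[{n}]` if `w` is empty. -/
def insertHead (n : ℕ) : Word → Word
  | [] => [{n}]
  | A :: t => insert n A :: t

/-- The word `w` with `n` joined to its last block; `[{n}]` if `w` is empty. -/
def insertLast (n : ℕ) : Word → Word
  | [] => [{n}]
  | [A] => [insert n A]
  | A :: B :: t => A :: insertLast n (B :: t)

/-- The variant of `joins` for which joining `n` to the empty word gives the word `[{n}]`. -/
def joinsNew (n : ℕ) (w : Word) : List (ℕ × Word) := if w = [] then [(0, [{n}])] else joins n w

section Sums

variable {M : Type*} [AddCommMonoid M]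

theorem sum_joins_cons (n : ℕ) (A : Finset ℕ) (t : Word) (f : Word → M) :
    ((joins n (A :: t)).map fun p => f p.2).sum =
      f (insert n A :: t) + ((joins n t).map fun p => f (A :: p.2)).sum := by
  simp [joins, Function.comp_def]

/-! ### Sums over right shifts -/

theorem sum_rightShifts_cons_cons (A B : Finset ℕ) (t : Word) (f : Word → M) :
    ∑ c ∈ rightShifts (A :: B :: t), f c =
      ∑ N ∈ A.powerset.filter (fun N => N ≠ A ∧ ∀ m ∈ N, ∀ b ∈ B, b < m),
        ∑ d ∈ rightShifts ((B ∪ N) :: t), f ((A \ N) :: d) := by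
  rw [rightShifts, Finset.sum_biUnion]
  · refine Finset.sum_congr rfl fun N _ => ?_
    rw [Finset.sum_image fun x _ y _ h => (List.cons.inj h).2]
  · intro N hN N' hN' hne
    simp only [Finset.coe_filter, Finset.mem_powerset, Set.mem_ofPred_eq] at hN hN'
    rw [Function.onFun, Finset.disjoint_left]
    rintro c hc hc'
    obtain ⟨d, _, rfl⟩ := Finset.mem_image.1 hc
    obtain ⟨d', _, h⟩ := Finset.mem_image.1 hc'
    apply hne
    rw [← Finset.sdiff_sdiff_eq_self hN.1, ← Finset.sdiff_sdiff_eq_self hN'.1, (List.cons.inj h).1]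

@[simp] theorem rightShifts_nil : rightShifts [] = {[]} := by rw [rightShifts]

@[simp] theorem rightShifts_singleton (A : Finset ℕ) : rightShifts [A] = {[A]} := by
  rw [rightShifts]

/-- Sums over the moves of a block to which a new maximal element is joined: either `n` stays or it
moves along.  A move of all elements but `n` is excluded, as not all elements can move. -/
theorem sum_moves_insert {n : ℕ} {A B : Finset ℕ} (hA : ∀ a ∈ A, a < n) (hB : ∀ b ∈ B, b < n)
    (hAB : ∃ a ∈ A, ∃ b ∈ B, a ≤ b) (g : Finset ℕ → M) :
    ∑ N ∈ (insert n A).powerset.filter (fun N => N ≠ insert n A ∧ ∀ m ∈ N, ∀ b ∈ B, b < m), g N =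
      ∑ N ∈ A.powerset.filter (fun N => N ≠ A ∧ ∀ m ∈ N, ∀ b ∈ B, b < m),
        (g N + g (insert n N)) := by
  have hn : n ∉ A := fun h => lt_irrefl n (hA n h)
  rw [Finset.sum_filter, Finset.sum_powerset_insert hn, Finset.sum_filter, ← Finset.sum_add_distrib]
  refine Finset.sum_congr rfl fun N hN => ?_
  rw [Finset.mem_powerset] at hN
  have hnN : n ∉ N := fun h => hn (hN h)
  have h1 : (N ≠ insert n A ∧ ∀ m ∈ N, ∀ b ∈ B, b < m) ↔ (N ≠ A ∧ ∀ m ∈ N, ∀ b ∈ B, b < m) := by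
    refine and_congr_left fun h => ⟨fun _ => ?_, fun _ => ?_⟩
    · rintro rfl
      obtain ⟨a, ha, b, hb, hab⟩ := hAB
      exact (h a ha b hb).not_ge hab
    · rintro rfl
      exact hnN (Finset.mem_insert_self _ _)
  have h2 : (insert n N ≠ insert n A ∧ ∀ m ∈ insert n N, ∀ b ∈ B, b < m) ↔
      (N ≠ A ∧ ∀ m ∈ N, ∀ b ∈ B, b < m) := by
    refine and_congr (not_congr ⟨fun h => ?_, fun h => by rw [h]⟩) ?_
    · rw [← Finset.erase_insert hnN, h, Finset.erase_insert hn]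
    · rw [Finset.forall_mem_insert]
      exact and_iff_right hB
  simp only [h1, h2]
  split_ifs <;> simp

/-- Shifting to the right a word with a new maximal element `n` in the first block moves `n` to an
arbitrary block, independently of the other elements. -/
theorem sum_rightShifts_insert {n : ℕ} (t : Word) : ∀ (A : Finset ℕ) (f : Word → M),
    (∀ C ∈ A :: t, ∀ a ∈ C, a < n) →
    (A :: t).IsChain (fun A B => ∃ a ∈ A, ∃ b ∈ B, a ≤ b) →
    ∑ c ∈ rightShifts (insert n A :: t), f c =
      ∑ c ∈ rightShifts (A :: t), ((joins n c).map fun p => f p.2).sum := by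
  induction t with
  | nil => intro A f _ _; simp [joins]
  | cons B t ih =>
    intro A f hlt hch
    have hA := hlt A (by simp)
    have hB := hlt B (by simp)
    have hn : n ∉ A := fun h => lt_irrefl n (hA n h)
    rw [List.isChain_cons_cons] at hch
    rw [sum_rightShifts_cons_cons, sum_moves_insert hA hB hch.1, sum_rightShifts_cons_cons]
    refine Finset.sum_congr rfl fun N hN => ?_
    simp only [Finset.mem_filter, Finset.mem_powerset] at hN
    have hnN : n ∉ N := fun h => hn (hN.1 h)
    have h1 : insert n A \ N = insert n (A \ N) := Finset.insert_sdiff_of_notMem _ hnN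
    have h2 := insert_sdiff_insert_of_notMem hn N
    rw [h1, h2, Finset.union_insert, ih (B ∪ N) (fun d => f ((A \ N) :: d)), ←
      Finset.sum_add_distrib]
    · exact Finset.sum_congr rfl fun d _ => (sum_joins_cons n (A \ N) d f).symm
    · intro C hC
      rcases List.mem_cons.1 hC with rfl | hC
      · intro a ha
        rcases Finset.mem_union.1 ha with h | h
        exacts [hB a h, hA a (hN.1 h)]
      · exact hlt C (by simp [hC])
    · cases t with
      | nil => simp
      | cons C t =>
        rw [List.isChain_cons_cons] at hch ⊢
        obtain ⟨a, ha, b, hb, hab⟩ := hch.2.1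
        exact ⟨⟨a, Finset.mem_union_left _ ha, b, hb, hab⟩, hch.2.2⟩

/-- Nothing can be shifted from `a` into `b` if the first block of `b` has an element that exceeds
all elements of `a`. -/
theorem sum_rightShifts_append (k : ℕ) : ∀ (a b : Word) (f : Word → M), a.length = k →
    (∀ A ∈ a, A.Nonempty) → (∀ B ∈ b.head?, ∃ y ∈ B, ∀ x ∈ carrier a, x < y) →
    ∑ c ∈ rightShifts (a ++ b), f c =
      ∑ c₁ ∈ rightShifts a, ∑ c₂ ∈ rightShifts b, f (c₁ ++ c₂) := by
  induction k with
  | zero =>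
    intro a b f hk _ _
    obtain rfl := List.length_eq_zero_iff.1 hk
    simp
  | succ k ih =>
    intro a b f hk ha hb
    match a, hk, ha, hb with
    | [A], hk, ha, hb =>
      match b, hb with
      | [], hb => simp
      | B :: t, hb =>
        obtain ⟨y, hy, hxy⟩ := hb B (by simp)
        have : A.powerset.filter (fun N => N ≠ A ∧ ∀ m ∈ N, ∀ b ∈ B, b < m) = {∅} := by
          ext N
          simp only [Finset.mem_filter, Finset.mem_powerset, Finset.mem_singleton]
          constructor
          · rintro ⟨h1, _, h3⟩
            rw [Finset.eq_empty_iff_forall_notMem]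
            intro m hm
            exact lt_asymm (h3 m hm y hy) (hxy m (mem_carrier.2 ⟨A, by simp, h1 hm⟩))
          · rintro rfl
            exact ⟨by simp, (ha A (by simp)).ne_empty.symm, by simp⟩
        rw [List.cons_append, List.nil_append, sum_rightShifts_cons_cons, this]
        simp
    | A :: A' :: t, hk, ha, hb =>
      rw [List.cons_append, List.cons_append, sum_rightShifts_cons_cons, sum_rightShifts_cons_cons]
      refine Finset.sum_congr rfl fun N hN => ?_
      simp only [Finset.mem_filter, Finset.mem_powerset] at hN
      rw [← List.cons_append, ih ((A' ∪ N) :: t) b (fun d => f ((A \ N) :: d)) (by simpa using hk)]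
      · rfl
      · intro C hC
        rcases List.mem_cons.1 hC with rfl | hC
        · exact (ha A' (by simp)).mono Finset.subset_union_left
        · exact ha C (by simp [hC])
      · intro B hB
        obtain ⟨y, hy, h⟩ := hb B hB
        refine ⟨y, hy, fun x hx => h x ?_⟩
        simp only [carrier_cons, Finset.mem_union] at hx ⊢
        rcases hx with (h | h) | h
        · tauto
        · exact Or.inl (hN.1 h)
        · tauto

/-! ### Sums over left shifts -/

theorem sum_leftShiftHead_cons (A B : Finset ℕ) (t : Word) (f : Word → M) :
    ∑ c ∈ leftShiftHead A (B :: t), f c =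
      ∑ N ∈ B.powerset.filter (fun N => N ≠ B ∧ ∀ m ∈ N, ∀ a ∈ A, a < m),
        f ((A ∪ N) :: (B \ N) :: t) := by
  rw [leftShiftHead, Finset.sum_image]
  intro N hN N' hN' h
  simp only [Finset.coe_filter, Finset.mem_powerset, Set.mem_ofPred_eq] at hN hN'
  have := (List.cons.inj (List.cons.inj h).2).1
  rw [← Finset.sdiff_sdiff_eq_self hN.1, ← Finset.sdiff_sdiff_eq_self hN'.1, this]

theorem sum_leftShifts_cons (A : Finset ℕ) (t : Word) (f : Word → M) :
    ∑ c ∈ leftShifts (A :: t), f c =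
      ∑ d ∈ leftShifts t, ∑ c ∈ leftShiftHead A d, f c := by
  rw [leftShifts, Finset.sum_biUnion]
  intro d _ d' _ hne
  rw [Function.onFun, Finset.disjoint_left]
  intro c hc hc'
  apply hne
  have key : ∀ N : Finset ℕ, (∀ m ∈ N, ∀ a ∈ A, a < m) → (A ∪ N) \ A = N := by
    intro N hN
    rw [Finset.union_sdiff_cancel_left]
    rw [Finset.disjoint_left]
    intro a ha haN
    exact lt_irrefl a (hN a haN a ha)
  match d, d', hc, hc' with
  | [], [], _, _ => rfl
  | [], B :: t, hc, hc' =>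
    rw [leftShiftHead, Finset.mem_singleton] at hc
    rw [leftShiftHead] at hc'
    obtain ⟨N, _, h⟩ := Finset.mem_image.1 hc'
    rw [hc] at h
    simp at h
  | B :: t, [], hc, hc' =>
    rw [leftShiftHead, Finset.mem_singleton] at hc'
    rw [leftShiftHead] at hc
    obtain ⟨N, _, h⟩ := Finset.mem_image.1 hc
    rw [hc'] at h
    simp at h
  | B :: t, B' :: t', hc, hc' =>
    rw [leftShiftHead] at hc hc'
    obtain ⟨N, hN, rfl⟩ := Finset.mem_image.1 hc
    obtain ⟨N', hN', h⟩ := Finset.mem_image.1 hc'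
    simp only [Finset.mem_filter, Finset.mem_powerset] at hN hN'
    simp only [List.cons.injEq] at h
    obtain ⟨h1, h2, rfl⟩ := h
    have h3 : N' = N := by rw [← key N hN.2.2, ← key N' hN'.2.2, h1]
    subst h3
    rw [← Finset.sdiff_union_of_subset hN.1, ← Finset.sdiff_union_of_subset hN'.1, h2]

/-- Left shifts only add elements to the first block. -/
theorem leftShifts_cons_head {A : Finset ℕ} {t c : Word} (hc : c ∈ leftShifts (A :: t)) :
    ∃ A' t', c = A' :: t' ∧ A ⊆ A' := by
  rw [leftShifts] at hc
  obtain ⟨d, _, hc⟩ := Finset.mem_biUnion.1 hc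
  match d, hc with
  | [], hc =>
    rw [leftShiftHead, Finset.mem_singleton] at hc
    exact ⟨A, [], hc, subset_rfl⟩
  | B :: s, hc =>
    rw [leftShiftHead] at hc
    obtain ⟨N, _, rfl⟩ := Finset.mem_image.1 hc
    exact ⟨_, _, rfl, Finset.subset_union_left⟩

theorem carrier_of_mem_leftShifts {a c : Word} (h1 : ∀ A ∈ a, A.Nonempty)
    (h2 : a.Pairwise Disjoint) (hc : c ∈ leftShifts a) : carrier c = carrier a :=
  (leftShifts_aux a c h1 h2 hc).2.2.1

@[simp] theorem leftShifts_nil : leftShifts [] = {[]} := rfl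

@[simp] theorem leftShifts_singleton (A : Finset ℕ) : leftShifts [A] = {[A]} := by
  simp [leftShifts, leftShiftHead]

/-- Shifting to the left a word with a new maximal element `n` in the last block moves `n` to an
arbitrary block, independently of the other elements. -/
theorem sum_leftShifts_insertLast {n : ℕ} (t : Word) : ∀ (f : Word → M), t ≠ [] →
    (∀ C ∈ t, C.Nonempty) → t.Pairwise Disjoint → (∀ C ∈ t, ∀ a ∈ C, a < n) →
    t.IsChain (fun A B => ∃ a ∈ A, ∃ b ∈ B, b ≤ a) →
    ∑ c ∈ leftShifts (insertLast n t), f c =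
      ∑ c ∈ leftShifts t, ((joins n c).map fun p => f p.2).sum := by
  induction t with
  | nil => intro f h; exact absurd rfl h
  | cons A t ih =>
    intro f _ hne hd hlt hch
    match t with
    | [] => simp [insertLast, joins]
    | B₀ :: t =>
      have hA := hlt A (by simp)
      rw [List.isChain_cons_cons] at hch
      rw [List.pairwise_cons] at hd
      have hne' : ∀ C ∈ B₀ :: t, C.Nonempty := fun C hC => hne C (List.mem_cons_of_mem _ hC)
      rw [insertLast, sum_leftShifts_cons, sum_leftShifts_cons,
        ih _ (by simp) hne' hd.2
          (fun C hC => hlt C (List.mem_cons_of_mem _ hC)) hch.2]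
      refine Finset.sum_congr rfl fun d hd' => ?_
      have hcar := carrier_of_mem_leftShifts hne' hd.2 hd'
      obtain ⟨B, s, rfl, hB₀⟩ := leftShifts_cons_head hd'
      have hB : ∀ b ∈ B, b < n := by
        intro b hb
        have : b ∈ carrier (B₀ :: t) := hcar ▸ mem_carrier.2 ⟨B, by simp, hb⟩
        obtain ⟨C, hC, hbC⟩ := mem_carrier.1 this
        exact hlt C (List.mem_cons_of_mem _ hC) b hbC
      have hn : n ∉ B := fun h => lt_irrefl n (hB n h)
      have hBA : ∃ b ∈ B, ∃ a ∈ A, b ≤ a := by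
        obtain ⟨a, ha, b, hb, hab⟩ := hch.1
        exact ⟨b, hB₀ hb, a, ha, hab⟩
      rw [sum_joins_cons n B s (fun d => ∑ c ∈ leftShiftHead A d, f c), sum_leftShiftHead_cons,
        sum_moves_insert hB hA hBA, sum_leftShiftHead_cons]
      simp only [sum_leftShiftHead_cons]
      have hswap : ∀ (L : List (ℕ × Word)) (T : Finset (Finset ℕ)) (g : Finset ℕ → Word → M),
          (L.map fun p => ∑ N ∈ T, g N p.2).sum = ∑ N ∈ T, (L.map fun p => g N p.2).sum := by
        intro L T g
        induction L with
        | nil => simp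
        | cons p L ih => simp [ih, Finset.sum_add_distrib]
      rw [hswap _ _ fun N w => f ((A ∪ N) :: (B \ N) :: w), ← Finset.sum_add_distrib]
      refine Finset.sum_congr rfl fun N hN => ?_
      simp only [Finset.mem_filter, Finset.mem_powerset] at hN
      have hnN : n ∉ N := fun h => hn (hN.1 h)
      have h1 : insert n B \ N = insert n (B \ N) := Finset.insert_sdiff_of_notMem _ hnN
      have h2 := insert_sdiff_insert_of_notMem hn N
      rw [sum_joins_cons n _ _ f, sum_joins_cons n _ _ (fun w => f ((A ∪ N) :: w)), h1, h2,
        Finset.union_insert]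
      abel

/-- Nothing can be shifted from `b` into `a` if the last block of `a` has an element that exceeds
all elements of `b`. -/
theorem sum_leftShifts_append {b : Word} (hb1 : ∀ B ∈ b, B.Nonempty) (hb2 : b.Pairwise Disjoint)
    (a : Word) : ∀ f : Word → M, (∀ A ∈ a, A.Nonempty) →
    (∀ A ∈ a.getLast?, ∃ y ∈ A, ∀ x ∈ carrier b, x < y) →
    ∑ c ∈ leftShifts (a ++ b), f c =
      ∑ c₁ ∈ leftShifts a, ∑ c₂ ∈ leftShifts b, f (c₁ ++ c₂) := by
  induction a with
  | nil => intro f _ _; simp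
  | cons A a ih =>
    intro f ha hy
    match a with
    | [] =>
      obtain ⟨y, hyA, hy⟩ := hy A (by simp)
      rw [List.cons_append, List.nil_append, sum_leftShifts_cons, leftShifts_singleton,
        Finset.sum_singleton]
      refine Finset.sum_congr rfl fun d hd => ?_
      have hcar := carrier_of_mem_leftShifts hb1 hb2 hd
      have hne := (leftShifts_aux b d hb1 hb2 hd).1
      match d, hcar, hne with
      | [], _, _ => simp [leftShiftHead]
      | B :: s, hcar, hne =>
        have : B.powerset.filter (fun N => N ≠ B ∧ ∀ m ∈ N, ∀ a ∈ A, a < m) = {∅} := by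
          ext N
          simp only [Finset.mem_filter, Finset.mem_powerset, Finset.mem_singleton]
          constructor
          · rintro ⟨h1, _, h3⟩
            rw [Finset.eq_empty_iff_forall_notMem]
            intro m hm
            exact lt_asymm (h3 m hm y hyA)
              (hy m (hcar ▸ mem_carrier.2 ⟨B, by simp, h1 hm⟩))
          · rintro rfl
            exact ⟨by simp, (hne B (by simp)).ne_empty.symm, by simp⟩
        rw [sum_leftShiftHead_cons, this]
        simp
    | A' :: a =>
      rw [List.cons_append, sum_leftShifts_cons, sum_leftShifts_cons,
        ih _ (fun C hC => ha C (List.mem_cons_of_mem _ hC)) (by simpa using hy)]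
      refine Finset.sum_congr rfl fun d hd => ?_
      obtain ⟨B, s, rfl, -⟩ := leftShifts_cons_head hd
      rw [sum_leftShiftHead_cons]
      simp only [List.cons_append, sum_leftShiftHead_cons]
      rw [Finset.sum_comm]

end Sums

theorem length_of_mem_rightShifts (k : ℕ) : ∀ a c : Word, a.length = k → c ∈ rightShifts a →
    c.length = k := by
  induction k with
  | zero =>
    intro a c hk hc
    obtain rfl := List.length_eq_zero_iff.1 hk
    rw [rightShifts_nil, Finset.mem_singleton] at hc
    simp [hc]
  | succ k ih =>
    intro a c hk hc
    match a, hk, hc with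
    | [A], hk, hc =>
      rw [rightShifts_singleton, Finset.mem_singleton] at hc
      simpa [hc] using hk
    | A :: B :: t, hk, hc =>
      rw [rightShifts] at hc
      obtain ⟨N, _, hc⟩ := Finset.mem_biUnion.1 hc
      obtain ⟨d, hd, rfl⟩ := Finset.mem_image.1 hc
      rw [List.length_cons, ih _ d (by simpa using hk) hd]

theorem length_of_mem_leftShifts (a : Word) : ∀ c ∈ leftShifts a, c.length = a.length := by
  induction a with
  | nil => intro c hc; rw [leftShifts_nil, Finset.mem_singleton] at hc; rw [hc]
  | cons A t ih =>
    intro c hc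
    rw [leftShifts] at hc
    obtain ⟨d, hd, hc⟩ := Finset.mem_biUnion.1 hc
    have := ih d hd
    match d, hc, this with
    | [], hc, h =>
      rw [leftShiftHead, Finset.mem_singleton] at hc
      subst hc
      simpa [eq_comm] using h
    | B :: s, hc, h =>
      rw [leftShiftHead] at hc
      obtain ⟨N, _, rfl⟩ := Finset.mem_image.1 hc
      simpa using h

theorem IsPartition.rightShift {S : Finset ℕ} {a c : Word} (h : IsPartition S a)
    (hc : c ∈ rightShifts a) : IsPartition S c := by
  obtain ⟨h1, h2, h3, -⟩ := rightShifts_aux _ a c rfl h.1 h.2.1 hc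
  exact ⟨h1, h2, h3.trans h.2.2⟩

theorem IsPartition.leftShift {S : Finset ℕ} {a c : Word} (h : IsPartition S a)
    (hc : c ∈ leftShifts a) : IsPartition S c := by
  obtain ⟨h1, h2, h3, -⟩ := leftShifts_aux a c h.1 h.2.1 hc
  exact ⟨h1, h2, h3.trans h.2.2⟩

theorem IsPartition.dim_add_length {w : Word} : ∀ {S : Finset ℕ}, IsPartition S w →
    dim w + w.length = S.card := by
  induction w with
  | nil => intro S h; simp [← h.2.2, carrier]
  | cons A t ih =>
    intro S h
    obtain ⟨hA, hd, rfl, ht⟩ := h.cons_inv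
    have := ih ht
    have := Finset.card_pos.2 hA
    rw [Finset.card_union_of_disjoint hd, dim_cons, List.length_cons]
    omega

/-! ### Runs of lists -/

theorem splitBy_cons_cons_of_rel {r : ℕ → ℕ → Bool} {a b : ℕ} {l : List ℕ} (h : r a b = true) :
    ∃ g gs, (b :: l).splitBy r = g :: gs ∧ (a :: b :: l).splitBy r = (a :: g) :: gs := by
  obtain ⟨g, gs, hg⟩ := List.exists_cons_of_ne_nil
    (List.splitBy_ne_nil (r := r).2 (List.cons_ne_nil b l))
  refine ⟨g, gs, hg, ?_⟩
  obtain ⟨h1, h2, h3, h4⟩ := List.splitBy_eq_iff.1 hg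
  rw [List.splitBy_eq_iff]
  have hgne : g ≠ [] := fun h => h2 (by simp [h])
  obtain ⟨c, g', rfl⟩ := List.exists_cons_of_ne_nil hgne
  have hc : b = c := by simpa using (List.cons.inj h1).1
  subst hc
  refine ⟨by simp [h1], ?_, ?_, ?_⟩
  · intro h
    rcases List.mem_cons.1 h with h | h
    · simp at h
    · exact h2 (List.mem_cons_of_mem _ h)
  · intro m hm
    rcases List.mem_cons.1 hm with rfl | hm
    · exact List.IsChain.cons_cons h (h3 _ (by simp))
    · exact h3 m (List.mem_cons_of_mem _ hm)
  · rw [List.isChain_cons] at h4 ⊢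
    refine ⟨fun y hy => ?_, h4.2⟩
    obtain ⟨_, hb, h5⟩ := h4.1 y hy
    exact ⟨by simp, hb, by simpa using h5⟩

theorem splitBy_append_singleton_of_rel {r : ℕ → ℕ → Bool} {n : ℕ} {l : List ℕ} (hl : l ≠ [])
    (h : ∀ b ∈ l, r b n = true) :
    ∃ g gs, l.splitBy r = gs ++ [g] ∧ (l ++ [n]).splitBy r = gs ++ [g ++ [n]] := by
  have hne := List.splitBy_ne_nil (r := r).2 hl
  obtain ⟨gs, g, hg⟩ : ∃ gs g, l.splitBy r = gs ++ [g] :=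
    ⟨_, _, (List.dropLast_append_getLast hne).symm⟩
  refine ⟨g, gs, hg, ?_⟩
  obtain ⟨h1, h2, h3, h4⟩ := List.splitBy_eq_iff.1 hg
  have hgne : g ≠ [] := fun h => h2 (by simp [h])
  rw [List.splitBy_eq_iff]
  refine ⟨by simp [h1], ?_, ?_, ?_⟩
  · intro h
    rcases List.mem_append.1 h with h | h
    · exact h2 (by simp [h])
    · simp at h
  · intro m hm
    rcases List.mem_append.1 hm with hm | hm
    · exact h3 m (by simp [hm])
    · obtain rfl := List.mem_singleton.1 hm
      rw [List.isChain_append]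
      refine ⟨h3 g (by simp), List.isChain_singleton n, fun x hx y hy => ?_⟩
      obtain rfl : n = y := by simpa using hy
      exact h x (by rw [h1]; simp [List.mem_of_mem_getLast? hx])
  · rw [List.isChain_append] at h4 ⊢
    refine ⟨h4.1, List.isChain_singleton _, fun x hx y hy => ?_⟩
    obtain ⟨ha, hb, h5⟩ := h4.2.2 x hx g (by simp)
    obtain rfl : g ++ [n] = y := by simpa using hy
    refine ⟨ha, by simp, ?_⟩
    rw [List.head_append_of_ne_nil hgne]
    exact h5

theorem decRuns_append_cons {n : ℕ} {x y : List ℕ} (hx : ∀ a ∈ x, a < n) (hy : ∀ a ∈ y, a < n) :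
    decRuns (x ++ n :: y) = decRuns x ++ insertHead n (decRuns y) := by
  have h1 : (x ++ n :: y).splitBy (fun a b => decide (b < a)) =
      x.splitBy (fun a b => decide (b < a)) ++ (n :: y).splitBy (fun a b => decide (b < a)) := by
    refine List.splitBy_append_cons _ fun a ha => ?_
    have := hx a (List.mem_of_mem_getLast? ha)
    simpa using this.le
  rw [decRuns, h1, List.map_append]
  congr 1
  match y, hy with
  | [], _ => simp [decRuns, insertHead, List.splitBy, List.splitBy.loop]
  | b :: l, hy =>
    obtain ⟨g, gs, h2, h3⟩ := splitBy_cons_cons_of_rel (r := fun a b => decide (b < a)) (a := n)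
      (b := b) (l := l) (by simpa using hy b (by simp))
    rw [decRuns, h2, h3]
    simp [insertHead]

theorem insertLast_append_singleton (n : ℕ) (w : Word) (A : Finset ℕ) :
    insertLast n (w ++ [A]) = w ++ [insert n A] := by
  induction w with
  | nil => rfl
  | cons B t ih =>
    obtain ⟨C, s, hs⟩ := List.exists_cons_of_ne_nil (show t ++ [A] ≠ [] by simp)
    rw [List.cons_append, hs, insertLast, ← hs, ih, List.cons_append]

theorem incRuns_append_cons {n : ℕ} {x y : List ℕ} (hx : ∀ a ∈ x, a < n) (hy : ∀ a ∈ y, a < n) :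
    incRuns (x ++ n :: y) = insertLast n (incRuns x) ++ incRuns y := by
  have h1 : (x ++ n :: y).splitBy (fun a b => decide (a < b)) =
      (x ++ [n]).splitBy (fun a b => decide (a < b)) ++ y.splitBy (fun a b => decide (a < b)) := by
    rw [← List.splitBy_append]
    · simp
    · intro a ha b hb
      obtain rfl : n = a := by simpa using ha
      simpa using (hy b (List.mem_of_mem_head? hb)).le
  rw [incRuns, h1, List.map_append]
  congr 1
  by_cases hx0 : x = []
  · subst hx0; simp [incRuns, insertLast, List.splitBy, List.splitBy.loop]
  · obtain ⟨g, gs, h2, h3⟩ := splitBy_append_singleton_of_rel (r := fun a b => decide (a < b))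
      (n := n) hx0 (fun b hb => by simpa using hx b hb)
    rw [incRuns, h2, h3, List.map_append, List.map_append, List.map_singleton, List.map_singleton,
      insertLast_append_singleton]
    congr 2
    ext; simp

theorem isChain_decRuns (x : List ℕ) :
    (decRuns x).IsChain (fun A B => ∃ a ∈ A, ∃ b ∈ B, a ≤ b) := by
  rw [decRuns, List.isChain_map]
  refine (List.isChain_getLast_head_splitBy _ x).imp ?_
  rintro l m ⟨hl, hm, h⟩
  exact ⟨_, List.mem_toFinset.2 (List.getLast_mem hl), _, List.mem_toFinset.2 (List.head_mem hm),
    by simpa using h⟩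

theorem isChain_incRuns (x : List ℕ) :
    (incRuns x).IsChain (fun A B => ∃ a ∈ A, ∃ b ∈ B, b ≤ a) := by
  rw [incRuns, List.isChain_map]
  refine (List.isChain_getLast_head_splitBy _ x).imp ?_
  rintro l m ⟨hl, hm, h⟩
  exact ⟨_, List.mem_toFinset.2 (List.getLast_mem hl), _, List.mem_toFinset.2 (List.head_mem hm),
    by simpa using h⟩

theorem isPartition_decRuns {x : List ℕ} (hx : x.Nodup) : IsPartition x.toFinset (decRuns x) :=
  runs_aux _ hx

theorem isPartition_incRuns {x : List ℕ} (hx : x.Nodup) : IsPartition x.toFinset (incRuns x) :=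
  runs_aux _ hx

theorem splitBy_cons_cons_of_not_rel {r : ℕ → ℕ → Bool} {a b : ℕ} {l : List ℕ}
    (h : r a b = false) : (a :: b :: l).splitBy r = [a] :: (b :: l).splitBy r := by
  have := List.splitBy_append_cons (r := r) (l := [a]) (a := b) l (by simpa using h)
  simpa [List.splitBy, List.splitBy.loop] using this

/-- The runs of the two kinds of an ordering of `k` elements are `k + 1` in number. -/
theorem length_decRuns_add_length_incRuns {x : List ℕ} (hx : x.Nodup) (h0 : x ≠ []) :
    (decRuns x).length + (incRuns x).length = x.length + 1 := by
  induction x with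
  | nil => exact absurd rfl h0
  | cons a l ih =>
    match l with
    | [] => simp [decRuns, incRuns, List.splitBy, List.splitBy.loop]
    | b :: l =>
      have ih := ih hx.tail (by simp)
      have hab : a ≠ b := by
        rw [List.nodup_cons] at hx
        exact fun h => hx.1 (by simp [h])
      simp only [decRuns, incRuns, List.length_map] at ih ⊢
      rcases hab.lt_or_gt with h | h
      · obtain ⟨g, gs, h2, h3⟩ := splitBy_cons_cons_of_rel (r := fun a b => decide (a < b)) (a := a)
          (b := b) (l := l) (by simpa using h)
        have h4 := splitBy_cons_cons_of_not_rel (r := fun a b => decide (b < a)) (a := a)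
          (b := b) (l := l) (by simpa using h.le)
        rw [h2] at ih
        rw [h3, h4]
        simp only [List.length_cons] at ih ⊢
        omega
      · obtain ⟨g, gs, h2, h3⟩ := splitBy_cons_cons_of_rel (r := fun a b => decide (b < a)) (a := a)
          (b := b) (l := l) (by simpa using h)
        have h4 := splitBy_cons_cons_of_not_rel (r := fun a b => decide (a < b)) (a := a)
          (b := b) (l := l) (by simpa using h.le)
        rw [h2] at ih
        rw [h3, h4]
        simp only [List.length_cons] at ih ⊢
        omega

/-! ### Inversions -/

theorem neg_one_pow_inversions_append {l m : List ℕ} (hl : l.Nodup) (hm : m.Nodup) :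
    (-1 : ℤ) ^ inversions (l ++ m) =
      shuff l.toFinset m.toFinset * (-1) ^ inversions l * (-1) ^ inversions m := by
  have hcount : ∀ (a : ℕ) (m : List ℕ), m.Nodup →
      ∏ b ∈ m.toFinset, (if b < a then (-1 : ℤ) else 1) =
        (-1) ^ m.countP (fun b => decide (b < a)) := by
    intro a m hm
    rw [List.prod_toFinset _ hm]
    clear hm
    induction m with
    | nil => simp
    | cons b m ih =>
      rw [List.map_cons, List.prod_cons, ih, List.countP_cons]
      by_cases h : b < a <;> simp [h, pow_succ]
  rw [shuff_eq_prod, List.prod_toFinset _ hl]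
  induction l with
  | nil => simp [inversions]
  | cons a l ih =>
    rw [List.cons_append, inversions, inversions, pow_add, ih hl.tail, List.countP_append, pow_add,
      List.map_cons, List.prod_cons, hcount a m hm, pow_add]
    ring

theorem inversions_append_cons {n : ℕ} {l m : List ℕ} (hl : ∀ a ∈ l, a < n) (hm : ∀ a ∈ m, a < n) :
    inversions (l ++ n :: m) = inversions (l ++ m) + m.length := by
  induction l with
  | nil =>
    rw [List.nil_append, List.nil_append, inversions, List.countP_eq_length.2, add_comm]
    intro a ha
    simpa using hm a ha
  | cons a l ih =>
    have := hl a (by simp)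
    simp only [List.cons_append, inversions, ih fun b hb => hl b (by simp [hb]), List.countP_append,
      List.countP_cons, decide_eq_true_eq, this.not_gt, if_false]
    omega

/-- The concatenation of the increasing lists of the blocks of a word. -/
def flat (a : Word) : List ℕ := a.flatMap fun A => A.sort (· ≤ ·)

theorem mem_flat {a : Word} {x : ℕ} : x ∈ flat a ↔ x ∈ carrier a := by
  simp [flat, mem_carrier]

theorem flat_cons (A : Finset ℕ) (t : Word) : flat (A :: t) = A.sort (· ≤ ·) ++ flat t := rfl

theorem flat_append (a b : Word) : flat (a ++ b) = flat a ++ flat b := List.flatMap_append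

theorem length_flat (a : Word) : (flat a).length = (a.map Finset.card).sum := by
  simp [flat, List.length_flatMap]

theorem IsPartition.nodup_flat {S : Finset ℕ} {a : Word} (h : IsPartition S a) :
    (flat a).Nodup := by
  rw [flat, List.nodup_flatMap]
  refine ⟨fun A _ => Finset.sort_nodup _ _, h.2.1.imp fun {A B} hAB => ?_⟩
  rw [Function.onFun, List.disjoint_left]
  intro x hx hx'
  exact Finset.disjoint_left.1 hAB ((Finset.mem_sort _).1 hx) ((Finset.mem_sort _).1 hx')

theorem IsPartition.toFinset_flat {S : Finset ℕ} {a : Word} (h : IsPartition S a) :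
    (flat a).toFinset = S := by
  ext x; rw [List.mem_toFinset, mem_flat, h.2.2]

theorem IsPartition.size {S : Finset ℕ} {a : Word} (h : IsPartition S a) :
    (a.map Finset.card).sum = S.card := by
  rw [← length_flat, ← h.toFinset_flat, List.toFinset_card_of_nodup h.nodup_flat]

theorem sort_insert_of_lt {n : ℕ} {A : Finset ℕ} (hA : ∀ a ∈ A, a < n) :
    (insert n A).sort (· ≤ ·) = A.sort (· ≤ ·) ++ [n] := by
  have hn : n ∉ A := fun h => lt_irrefl n (hA n h)
  have hnd : (A.sort (· ≤ ·) ++ [n]).Nodup := by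
    rw [List.nodup_append]
    refine ⟨Finset.sort_nodup _ _, by simp, fun a ha b hb => ?_⟩
    rw [List.mem_singleton.1 hb]
    exact (hA a ((Finset.mem_sort _).1 ha)).ne
  have h := (List.toFinset_sort (· ≤ ·) hnd).2 (by
    rw [List.pairwise_append]
    refine ⟨Finset.pairwise_sort _ _, by simp, fun a ha b hb => ?_⟩
    rw [List.mem_singleton.1 hb]
    exact (hA a ((Finset.mem_sort _).1 ha)).le)
  rw [← h]
  congr 1
  ext x; simp

/-! ### Behaviour of the signs of words -/

theorem psgn_append {A M V : Finset ℕ} {a b : Word} (hAM : Disjoint A M) (ha : IsPartition V a)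
    (hV : V ⊆ A) (hb : IsPartition M b) :
    psgn (A ∪ M) (a ++ b) = shuff A M * psgn A a * psgn M b := by
  have h1 : (A ∪ M) \ carrier (a ++ b) = A \ carrier a := by
    ext x
    have : x ∈ A → x ∉ M := fun h => Finset.disjoint_left.1 hAM h
    simp only [carrier_append, hb.2.2, Finset.mem_sdiff, Finset.mem_union]
    tauto
  have h2 : M \ carrier b = ∅ := by rw [hb.2.2, Finset.sdiff_self]
  have h3 : ((A \ carrier a).sort (· ≥ ·) ++ flat a).Nodup := by
    rw [List.nodup_append']
    refine ⟨Finset.sort_nodup _ _, ha.nodup_flat, ?_⟩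
    rw [List.disjoint_left]
    intro x hx hx'
    exact (Finset.mem_sdiff.1 ((Finset.mem_sort _).1 hx)).2 (mem_flat.1 hx')
  have h4 : ((A \ carrier a).sort (· ≥ ·) ++ flat a).toFinset = A := by
    rw [List.toFinset_append, Finset.sort_toFinset, ha.toFinset_flat, ha.2.2,
      Finset.sdiff_union_of_subset hV]
  rw [psgn, psgn, psgn, h1, h2, Finset.sort_empty, List.nil_append, ← flat, ← flat, ← flat,
    flat_append, ← List.append_assoc, neg_one_pow_inversions_append h3 hb.nodup_flat, h4,
    hb.toFinset_flat]

theorem psgn_insert_of_notMem {n : ℕ} {S V : Finset ℕ} {a : Word} (hS : ∀ s ∈ S, s < n)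
    (ha : IsPartition V a) (hV : V ⊆ S) : psgn (insert n S) a = (-1) ^ S.card * psgn S a := by
  have hn : n ∉ S := fun h => lt_irrefl n (hS n h)
  have h1 : insert n S \ carrier a = insert n (S \ carrier a) := by
    rw [Finset.insert_sdiff_of_notMem]
    rw [ha.2.2]
    exact fun h => hn (hV h)
  have h2 : (insert n (S \ carrier a)).sort (· ≥ ·) = n :: (S \ carrier a).sort (· ≥ ·) :=
    Finset.sort_insert (· ≥ ·) (fun b hb => (hS b (Finset.mem_sdiff.1 hb).1).le)
      fun h => hn (Finset.mem_sdiff.1 h).1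
  rw [psgn, psgn, h1, h2, ← flat, List.cons_append]
  have h3 := inversions_append_cons (n := n) (l := []) (m := (S \ carrier a).sort (· ≥ ·) ++ flat a)
    (by simp) (by
      intro x hx
      rcases List.mem_append.1 hx with h | h
      · exact hS x (Finset.mem_sdiff.1 ((Finset.mem_sort _).1 h)).1
      · rw [mem_flat, ha.2.2] at h
        exact hS x (hV h))
  rw [List.nil_append, List.nil_append] at h3
  rw [h3, List.length_append, Finset.length_sort, length_flat, ha.size, ha.2.2,
    Finset.card_sdiff_add_card_eq_card hV, pow_add, mul_comm]

/-- The exponent `ε₁`, defined by recursion on the word. -/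
def eps : Word → ℕ
  | [] => 0
  | A :: t => t.length * A.card + eps t

theorem epsOne_eq (a : Word) : epsOne a = eps a := by
  induction a with
  | nil => simp [epsOne, eps]
  | cons A t ih =>
    rw [eps, ← ih, epsOne, epsOne, List.length_cons, Nat.add_sub_cancel]
    rcases t.eq_nil_or_concat' with rfl | ⟨L, B, rfl⟩
    · simp
    · generalize ht : L ++ [B] = t
      obtain ⟨k, hk⟩ : ∃ k, t.length = k + 1 := ⟨L.length, by simp [← ht]⟩
      rw [hk, Nat.add_sub_cancel, Finset.sum_Icc_succ_top (by omega), Nat.sub_self, add_comm]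
      congr 1
      refine Finset.sum_congr rfl fun i hi => ?_
      rw [Finset.mem_Icc] at hi
      rw [show k + 1 - i = (k - i) + 1 by omega, List.getD_cons_succ]

theorem eps_append (a b : Word) :
    eps (a ++ b) = eps a + b.length * (a.map Finset.card).sum + eps b := by
  induction a with
  | nil => simp [eps]
  | cons A t ih =>
    simp only [List.cons_append, eps, ih, List.length_append, List.map_cons, List.sum_cons]
    ring

theorem sgnOne_eq (S : Finset ℕ) (a : Word) : sgnOne S a = (-1) ^ eps a * psgn S a := by
  rw [sgnOne, epsOne_eq]

theorem sgnOne_append {A M V : Finset ℕ} {a b : Word} (hAM : Disjoint A M) (ha : IsPartition V a)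
    (hV : V ⊆ A) (hb : IsPartition M b) :
    sgnOne (A ∪ M) (a ++ b) =
      (-1) ^ (b.length * V.card) * shuff A M * sgnOne A a * sgnOne M b := by
  rw [sgnOne_eq, sgnOne_eq, sgnOne_eq, psgn_append hAM ha hV hb, eps_append, ha.size, pow_add,
    pow_add]
  ring

theorem isPartition_joins {n : ℕ} {a : Word} : ∀ {V : Finset ℕ} {p : ℕ × Word},
    IsPartition V a → n ∉ V → p ∈ joins n a →
    IsPartition (insert n V) p.2 ∧ p.2.length = a.length := by
  induction a with
  | nil => intro V p _ _ hp; simp [joins] at hp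
  | cons A t ih =>
    intro V p hV hn hp
    obtain ⟨hA, hd, rfl, ht⟩ := hV.cons_inv
    simp only [Finset.mem_union, not_or] at hn
    rw [joins, List.mem_cons] at hp
    rcases hp with rfl | hp
    · refine ⟨?_, rfl⟩
      rw [← Finset.insert_union]
      refine (isPartition_singleton (Finset.insert_nonempty n A)).append ht ?_
      rw [Finset.disjoint_insert_left]
      exact ⟨hn.2, hd⟩
    · obtain ⟨q, hq, rfl⟩ := List.mem_map.1 hp
      obtain ⟨h1, h2⟩ := ih ht hn.2 hq
      refine ⟨?_, by simp [h2]⟩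
      rw [← Finset.union_insert]
      refine (isPartition_singleton hA).append h1 ?_
      rw [Finset.disjoint_insert_right]
      exact ⟨hn.1, hd⟩

theorem inversions_joins {n : ℕ} {a : Word} : ∀ {V : Finset ℕ} {p : ℕ × Word} (l : List ℕ),
    IsPartition V a → (∀ x ∈ V, x < n) → (∀ x ∈ l, x < n) → p ∈ joins n a →
    ∃ b, eps p.2 = eps a + b ∧ inversions (l ++ flat p.2) = inversions (l ++ flat a) + p.1 + b := by
  induction a with
  | nil => intro V p l _ _ _ hp; simp [joins] at hp
  | cons A t ih =>
    intro V p l hV hn hl hp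
    obtain ⟨hA, hd, rfl, ht⟩ := hV.cons_inv
    have hA' : ∀ x ∈ A, x < n := fun x hx => hn x (Finset.mem_union_left _ hx)
    have ht' : ∀ x ∈ carrier t, x < n := fun x hx => hn x (Finset.mem_union_right _ hx)
    have hlA : ∀ x ∈ l ++ A.sort (· ≤ ·), x < n := by
      intro x hx
      rcases List.mem_append.1 hx with h | h
      exacts [hl x h, hA' x ((Finset.mem_sort _).1 h)]
    rw [joins, List.mem_cons] at hp
    rcases hp with rfl | hp
    · refine ⟨t.length, ?_, ?_⟩
      · simp only [eps, Finset.card_insert_of_notMem fun h => lt_irrefl n (hA' n h)]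
        ring
      · simp only [flat_cons, sort_insert_of_lt hA']
        rw [List.append_assoc, ← List.append_assoc, List.singleton_append,
          inversions_append_cons hlA fun x hx => ht' x (mem_flat.1 hx), length_flat, ht.size,
          ← ht.dim_add_length, List.append_assoc, add_assoc]
    · obtain ⟨q, hq, rfl⟩ := List.mem_map.1 hp
      obtain ⟨b, h1, h2⟩ := ih (l ++ A.sort (· ≤ ·)) ht ht' hlA hq
      have h3 := (isPartition_joins ht (fun h => lt_irrefl n (ht' n h)) hq).2
      refine ⟨b, by simp only [eps, h1, h3]; ring, ?_⟩
      simp only [flat_cons, ← List.append_assoc]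
      exact h2

theorem sgnOne_joins {n : ℕ} {S V : Finset ℕ} {a : Word} {p : ℕ × Word} (hS : ∀ s ∈ S, s < n)
    (ha : IsPartition V a) (hV : V ⊆ S) (hp : p ∈ joins n a) :
    sgnOne (insert n S) p.2 = (-1) ^ p.1 * sgnOne S a := by
  have hn : n ∉ S := fun h => lt_irrefl n (hS n h)
  have h1 : insert n S \ carrier p.2 = S \ carrier a := by
    rw [(isPartition_joins ha (fun h => hn (hV h)) hp).1.2.2, ha.2.2,
      insert_sdiff_insert_of_notMem hn]
  obtain ⟨b, h2, h3⟩ := inversions_joins ((S \ carrier a).sort (· ≥ ·)) ha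
    (fun x hx => hS x (hV hx))
    (fun x hx => hS x (Finset.mem_sdiff.1 ((Finset.mem_sort _).1 hx)).1) hp
  rw [sgnOne_eq, sgnOne_eq, psgn, psgn, h1, ← flat, ← flat, h2, h3, pow_add, pow_add, pow_add]
  have : (-1 : ℤ) ^ b * (-1) ^ b = 1 := by rw [← mul_pow]; simp
  linear_combination ((-1) ^ eps a * (-1) ^ inversions ((S \ carrier a).sort (· ≥ ·) ++ flat a) *
    (-1) ^ p.1) * this

theorem rsgn_eq {S : Finset ℕ} {a : Word} (ha : IsPartition S a) :
    rsgn S a = (-1) ^ (a.map fun A => A.card.choose 2).sum := by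
  have h : (a.map fun A => A.card ^ 2).sum =
      2 * (a.map fun A => A.card.choose 2).sum + (a.map Finset.card).sum := by
    clear ha
    induction a with
    | nil => simp
    | cons A t ih =>
      simp only [List.map_cons, List.sum_cons, ih]
      have : A.card ^ 2 = 2 * A.card.choose 2 + A.card := by
        induction A.card with
        | zero => simp
        | succ k ih => rw [Nat.choose_succ_succ', Nat.choose_one_right]; nlinarith
      rw [this]; ring
  rw [rsgn, h, ha.size]
  congr 1
  omega

/-- The part of the sign of a complementary pair that depends only on the strong pair. -/
noncomputable def vertexSign (S : Finset ℕ) (a : Word) : ℤ := rsgn S a * sgnOne S a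

theorem vertexSign_append {A M : Finset ℕ} {a b : Word} (hAM : Disjoint A M) (ha : IsPartition A a)
    (hb : IsPartition M b) :
    vertexSign (A ∪ M) (a ++ b) =
      (-1) ^ (b.length * A.card) * shuff A M * vertexSign A a * vertexSign M b := by
  rw [vertexSign, vertexSign, vertexSign, sgnOne_append hAM ha subset_rfl hb,
    rsgn_eq (ha.append hb hAM), rsgn_eq ha, rsgn_eq hb, List.map_append, List.sum_append, pow_add]
  ring

theorem isPartition_insertHead {n : ℕ} {S : Finset ℕ} {a : Word} (ha : IsPartition S a)
    (hn : n ∉ S) : IsPartition (insert n S) (insertHead n a) := by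
  cases a with
  | nil =>
    obtain rfl : ∅ = S := ha.2.2
    exact isPartition_singleton (Finset.singleton_nonempty n)
  | cons A t =>
    exact (isPartition_joins (p := (dim t, insert n A :: t)) ha hn (by simp [joins])).1

theorem vertexSign_insertHead {n : ℕ} {S : Finset ℕ} {a : Word} (hS : ∀ s ∈ S, s < n)
    (ha : IsPartition S a) :
    vertexSign (insert n S) (insertHead n a) =
      (-1) ^ (S.card + (insertHead n a).length + 1) * vertexSign S a := by
  have hn : n ∉ S := fun h => lt_irrefl n (hS n h)
  have hp := isPartition_insertHead ha hn
  cases a with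
  | nil =>
    obtain rfl : ∅ = S := ha.2.2
    simp [vertexSign, insertHead, rsgn, sgnOne, epsOne, psgn, inversions, carrier]
  | cons A t =>
    obtain ⟨hA, hd, rfl, ht⟩ := ha.cons_inv
    have h1 := sgnOne_joins (p := (dim t, insert n A :: t)) hS ha subset_rfl (by simp [joins])
    have hnA : n ∉ A := fun h => hn (Finset.mem_union_left _ h)
    rw [vertexSign, vertexSign, rsgn_eq hp, rsgn_eq ha, insertHead, h1, List.map_cons,
      List.map_cons, List.sum_cons, List.sum_cons, Finset.card_insert_of_notMem hnA,
      Nat.choose_succ_succ',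
      Nat.choose_one_right, Finset.card_union_of_disjoint hd, ← ht.dim_add_length]
    have : (-1 : ℤ) ^ (A.card + (dim t + t.length) + (insert n A :: t).length + 1) =
        (-1) ^ (A.card + dim t) := by
      rw [List.length_cons]
      apply neg_one_pow_congr
      simp only [Nat.even_add_one, Nat.even_add]
      grind
    rw [this]
    ring

theorem isPartition_joinsNew {n : ℕ} {V : Finset ℕ} {a : Word} {p : ℕ × Word} (ha : IsPartition V a)
    (hn : n ∉ V) (hp : p ∈ joinsNew n a) : IsPartition (insert n V) p.2 := by
  unfold joinsNew at hp
  split_ifs at hp with h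
  · subst h
    obtain rfl : ∅ = V := ha.2.2
    rw [List.mem_singleton] at hp
    subst hp
    exact isPartition_singleton (Finset.singleton_nonempty n)
  · exact (isPartition_joins ha hn hp).1

theorem length_joinsNew {n : ℕ} {V : Finset ℕ} {a : Word} {p : ℕ × Word} (ha : IsPartition V a)
    (hn : n ∉ V) (hp : p ∈ joinsNew n a) :
    p.2.length = (if a = [] then 1 else a.length) := by
  unfold joinsNew at hp
  split_ifs at hp ⊢ with h
  · rw [List.mem_singleton] at hp
    simp [hp]
  · exact (isPartition_joins ha hn hp).2

theorem sgnOne_joinsNew {n : ℕ} {S V : Finset ℕ} {a : Word} {p : ℕ × Word} (hS : ∀ s ∈ S, s < n)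
    (ha : IsPartition V a) (hV : V ⊆ S) (h0 : a = [] → S = ∅) (hp : p ∈ joinsNew n a) :
    sgnOne (insert n S) p.2 = (-1) ^ p.1 * sgnOne S a := by
  unfold joinsNew at hp
  split_ifs at hp with h
  · subst h
    obtain rfl := h0 rfl
    rw [List.mem_singleton] at hp
    subst hp
    simp [sgnOne, epsOne, psgn, inversions, carrier]
  · exact sgnOne_joins hS ha hV hp

theorem neg_one_pow_choose_two_add (a b : ℕ) : (-1 : ℤ) ^ (a + b).choose 2 =
    (-1) ^ a.choose 2 * (-1) ^ b.choose 2 * (-1) ^ (a * b) := by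
  rw [← pow_add, ← pow_add]
  congr 1
  induction b with
  | zero => simp
  | succ b ih =>
    rw [← add_assoc, Nat.choose_succ_succ', Nat.choose_one_right, ih, Nat.choose_succ_succ',
      Nat.choose_one_right]
    ring

theorem blockSign_eq {S : Finset ℕ} {x : List ℕ} {u v : Word}
    (h : u.length = (strongLeft S x).length) :
    blockSign S (x, u, v) =
      (-1) ^ v.length.choose 2 * sgnOne S v * sgnOne S u * vertexSign S (strongLeft S x) := by
  rw [blockSign, vertexSign, sgnTwo, sgnTwo, pow_add, pow_add, h, sgnOne, sgnOne, sgnOne]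
  have : (-1 : ℤ) ^ ((strongLeft S x).length - 1).choose 2 *
      (-1) ^ ((strongLeft S x).length - 1).choose 2 = 1 := by
    rw [← mul_pow]; simp
  linear_combination ((-1) ^ v.length.choose 2 * rsgn S (strongLeft S x) *
    ((-1) ^ epsOne v * psgn S v) * ((-1) ^ epsOne u * psgn S u) *
    ((-1) ^ epsOne (strongLeft S x) * psgn S (strongLeft S x))) * this

theorem shuff_mul_self (A M : Finset ℕ) : shuff A M * shuff A M = 1 := by
  rw [shuff, ← mul_pow]; simp

/-- The sign of a complementary pair for `A ∪ M ∪ {n}`, where `n` is maximal, in terms of those for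
`A` and `M`. -/
theorem blockSign_split {n : ℕ} {A M V : Finset ℕ} {x x₁ x₂ : List ℕ} {u₁ v₁ u₂ v₂ : Word}
    {p q : ℕ × Word} (hA : ∀ a ∈ A, a < n) (hM : ∀ a ∈ M, a < n) (hAM : Disjoint A M)
    (hx₁ : IsPartition A (strongLeft A x₁)) (hx₂ : IsPartition M (strongLeft M x₂))
    (hx : strongLeft (insert n (A ∪ M)) x = strongLeft A x₁ ++ insertHead n (strongLeft M x₂))
    (hu₁ : IsPartition A u₁) (hl₁ : u₁.length = (strongLeft A x₁).length)
    (hu₂ : IsPartition M u₂) (hl₂ : u₂.length = (strongLeft M x₂).length)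
    (hv₁ : IsPartition V v₁) (hV : V ⊆ A) (hV0 : v₁ = [] → A = ∅) (hv₂ : IsPartition M v₂)
    (hlen : M.Nonempty → u₂.length + v₂.length = M.card + 1)
    (hp : p ∈ joinsNew n v₁) (hq : q ∈ joinsNew n u₂) :
    blockSign (insert n (A ∪ M)) (x, u₁ ++ q.2, p.2 ++ v₂) =
      shuff A M * (-1) ^ (p.1 + q.1 + dim v₂ + dim p.2 * dim q.2) *
        blockSign A (x₁, u₁, v₁) * blockSign M (x₂, u₂, v₂) := by
  have hnA : n ∉ A := fun h => lt_irrefl n (hA n h)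
  have hnM : n ∉ M := fun h => lt_irrefl n (hM n h)
  have hnV : n ∉ V := fun h => hnA (hV h)
  have hM0 : ∀ w, IsPartition M w → w = [] → M = ∅ := by
    rintro w hw rfl; exact hw.2.2.symm
  have hd1 : Disjoint A (insert n M) := by
    rw [Finset.disjoint_insert_right]; exact ⟨hnA, hAM⟩
  have hd2 : Disjoint (insert n A) M := by
    rw [Finset.disjoint_insert_left]; exact ⟨hnM, hAM⟩
  have hp' := isPartition_joinsNew hv₁ hnV hp
  have hq' := isPartition_joinsNew hu₂ hnM hq
  have hlp := length_joinsNew hv₁ hnV hp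
  have hlq := length_joinsNew hu₂ hnM hq
  have hih := isPartition_insertHead hx₂ hnM
  have hlih : (insertHead n (strongLeft M x₂)).length = q.2.length := by
    rw [hlq]
    have : u₂ = [] ↔ strongLeft M x₂ = [] := by
      rw [← List.length_eq_zero_iff, ← List.length_eq_zero_iff, hl₂]
    cases h : strongLeft M x₂ with
    | nil => rw [if_pos (this.2 h)]; rfl
    | cons B t =>
      rw [if_neg (fun h' => by simp [h] at this; exact this h'), hl₂, h]; rfl
  have hlu : (u₁ ++ q.2).length = (strongLeft (insert n (A ∪ M)) x).length := by
    rw [hx, List.length_append, List.length_append, hl₁, hlih]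
  rw [blockSign_eq hlu, blockSign_eq hl₁, blockSign_eq hl₂, hx]
  have e1 : sgnOne (insert n (A ∪ M)) (p.2 ++ v₂) =
      (-1) ^ (v₂.length * (V.card + 1)) * ((-1) ^ M.card * shuff A M) *
        ((-1) ^ p.1 * sgnOne A v₁) * sgnOne M v₂ := by
    rw [← Finset.insert_union, sgnOne_append hd2 hp' (Finset.insert_subset_insert n hV) hv₂,
      Finset.card_insert_of_notMem hnV, shuff_insert_left hM hnA, sgnOne_joinsNew hA hv₁ hV hV0 hp]
  have e2 : sgnOne (insert n (A ∪ M)) (u₁ ++ q.2) =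
      (-1) ^ (q.2.length * A.card) * shuff A M * sgnOne A u₁ * ((-1) ^ q.1 * sgnOne M u₂) := by
    rw [← Finset.union_insert, sgnOne_append hd1 hu₁ subset_rfl hq', shuff_insert_right hA hnM,
      sgnOne_joinsNew hM hu₂ subset_rfl (hM0 u₂ hu₂) hq]
  have e3 : vertexSign (insert n (A ∪ M)) (strongLeft A x₁ ++ insertHead n (strongLeft M x₂)) =
      (-1) ^ (q.2.length * A.card) * shuff A M * vertexSign A (strongLeft A x₁) *
        ((-1) ^ (M.card + q.2.length + 1) * vertexSign M (strongLeft M x₂)) := by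
    rw [← Finset.union_insert, vertexSign_append hd1 hx₁ hih, shuff_insert_right hA hnM,
      vertexSign_insertHead hM hx₂, hlih]
  have e4 : (-1 : ℤ) ^ (p.2 ++ v₂).length.choose 2 = (-1) ^ v₁.length.choose 2 *
      (-1) ^ v₂.length.choose 2 * (-1) ^ (p.2.length * v₂.length) := by
    rw [List.length_append, neg_one_pow_choose_two_add, hlp]
    congr 3
    split_ifs with h
    · simp [h]
    · rfl
  have hsq : shuff A M * shuff A M = 1 := shuff_mul_self A M
  have hsq2 : (-1 : ℤ) ^ (q.2.length * A.card) * (-1) ^ (q.2.length * A.card) = 1 := by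
    rw [← mul_pow]; simp
  have hdp := hp'.dim_add_length
  have hdq := hq'.dim_add_length
  have hdv := hv₂.dim_add_length
  rw [Finset.card_insert_of_notMem hnV] at hdp
  rw [Finset.card_insert_of_notMem hnM] at hdq
  have hlen' : q.2.length + v₂.length = M.card + 1 := by
    rw [hlq]
    rcases M.eq_empty_or_nonempty with h | h
    · subst h
      have : u₂ = [] := by
        rw [← List.length_eq_zero_iff]
        have := hu₂.dim_add_length
        rw [Finset.card_empty] at this
        omega
      rw [if_pos this]
      rw [Finset.card_empty] at hdv
      rw [Finset.card_empty]
      omega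
    · rw [if_neg fun h' => h.ne_empty (hM0 u₂ hu₂ h')]
      exact hlen h
  have hE : (-1 : ℤ) ^ (p.2.length * v₂.length) * (-1) ^ (v₂.length * (V.card + 1)) *
      (-1) ^ M.card * (-1) ^ (M.card + q.2.length + 1) * (-1) ^ p.1 * (-1) ^ q.1 =
      (-1) ^ (p.1 + q.1 + dim v₂ + dim p.2 * dim q.2) := by
    have h1 : dim q.2 = v₂.length := by omega
    have h2 : dim v₂ + 1 = q.2.length := by omega
    rw [h1, ← h2, ← hdp, ← pow_add, ← pow_add, ← pow_add, ← pow_add, ← pow_add]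
    apply neg_one_pow_congr
    simp only [Nat.even_add, Nat.even_mul, Nat.even_add_one]
    grind
  rw [e1, e2, e3, e4, ← hE]
  set s := shuff A M
  set k := (-1 : ℤ) ^ (q.2.length * A.card)
  linear_combination ((-1 : ℤ) ^ (p.2.length * v₂.length) * (-1) ^ (v₂.length * (V.card + 1)) *
      (-1) ^ M.card * (-1) ^ (M.card + q.2.length + 1) * (-1) ^ p.1 * (-1) ^ q.1 *
      (-1) ^ v₁.length.choose 2 * (-1) ^ v₂.length.choose 2 * sgnOne A v₁ * sgnOne M v₂ *
      sgnOne A u₁ * sgnOne M u₂ * vertexSign A (strongLeft A x₁) *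
      vertexSign M (strongLeft M x₂) * s) * (k * k * hsq + hsq2)

/-- The sign of a complementary pair of the permutocube on `S ∪ {n}`, where `n` is maximal and is
deleted in the vertex `x`, in terms of the sign for `S`. -/
theorem blockSign_delete {n : ℕ} {S V : Finset ℕ} {x : List ℕ} {u v : Word} {q : ℕ × Word}
    (hS : ∀ s ∈ S, s < n) (hx : IsPartition S (strongLeft S x))
    (hx' : strongLeft (insert n S) x = insertHead n (strongLeft S x))
    (hu : IsPartition S u) (hu0 : u ≠ []) (hl : u.length = (strongLeft S x).length)
    (hv : IsPartition V v) (hV : V ⊆ S) (hdim : dim u + dim v + 1 = S.card)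
    (hq : q ∈ joins n u) :
    blockSign (insert n S) (x, q.2, v) = (-1) ^ (q.1 + dim v) * blockSign S (x, u, v) := by
  have hn : n ∉ S := fun h => lt_irrefl n (hS n h)
  have hlq := (isPartition_joins hu hn hq).2
  have hlih : (insertHead n (strongLeft S x)).length = u.length := by
    cases h : strongLeft S x with
    | nil => rw [h, List.length_nil, List.length_eq_zero_iff] at hl; exact absurd hl hu0
    | cons B t => rw [hl, h]; rfl
  rw [blockSign_eq (by rw [hx', hlih, hlq]), blockSign_eq hl, hx', vertexSign_insertHead hS hx,
    sgnOne_joins hS hu subset_rfl hq, sgnOne_eq (insert n S), psgn_insert_of_notMem hS hv hV, hlih,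
    sgnOne_eq S v]
  have hd := hu.dim_add_length
  have hE : (-1 : ℤ) ^ S.card * (-1) ^ q.1 * (-1) ^ (S.card + u.length + 1) =
      (-1) ^ (q.1 + dim v) := by
    rw [← pow_add, ← pow_add]
    have : u.length = dim v + 1 := by omega
    rw [this]
    apply neg_one_pow_congr
    simp only [Nat.even_add, Nat.even_add_one]
    grind
  rw [← hE]
  ring

/-! ### Vertices and their strong pairs -/

theorem mem_orderings_iff {T : Finset ℕ} {x : List ℕ} :
    x ∈ orderings T ↔ x.Nodup ∧ x.toFinset = T := by
  refine ⟨mem_orderings, ?_⟩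
  rintro ⟨h, rfl⟩
  rw [orderings, List.mem_toFinset, List.mem_permutations]
  exact ((List.toFinset_toList (s := x) h).symm.trans
    (List.perm_of_nodup_nodup_toFinset_eq (Finset.nodup_toList _) (Finset.sort_nodup _ _)
      (by simp)))

theorem mem_blockVertices {S : Finset ℕ} {x : List ℕ} :
    x ∈ blockVertices S ↔ x.Nodup ∧ if 0 ∈ S then x.toFinset ⊆ S.erase 0 else x.toFinset = S := by
  unfold blockVertices
  split_ifs with h
  · simp only [Finset.mem_biUnion, Finset.mem_powerset, mem_orderings_iff]
    exact ⟨fun ⟨T, h1, h2, h3⟩ => ⟨h2, h3 ▸ h1⟩, fun ⟨h1, h2⟩ => ⟨_, h2, h1, rfl⟩⟩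
  · exact mem_orderings_iff

theorem toFinset_subset_of_mem_blockVertices {S : Finset ℕ} {x : List ℕ}
    (hx : x ∈ blockVertices S) : x.toFinset ⊆ S := by
  have h := (mem_blockVertices.1 hx).2
  split_ifs at h
  exacts [h.trans (Finset.erase_subset _ _), h.subset]

theorem isPartition_strongLeft {S : Finset ℕ} {x : List ℕ} (hx : x ∈ blockVertices S) :
    IsPartition S (strongLeft S x) := by
  obtain ⟨h1, h2, h3⟩ := isBlockFace_strongLeft hx
  refine ⟨h1, h2, ?_⟩
  by_cases h0 : 0 ∈ S
  · rw [strongLeft, if_pos h0, carrier_cons,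
      (isPartition_decRuns (mem_blockVertices.1 hx).1).2.2,
      Finset.sdiff_union_of_subset (toFinset_subset_of_mem_blockVertices hx)]
  · rwa [if_neg h0] at h3

/-- The second member of a strong pair partitions a subset of the block, and the numbers of blocks
of the two members are complementary. -/
theorem isPartition_strongRight {S : Finset ℕ} {x : List ℕ} (hx : x ∈ blockVertices S) :
    ∃ V ⊆ S, IsPartition V (strongRight S x) ∧ (0 ∉ S → V = S) ∧ (S.Nonempty → V.Nonempty) ∧
      (S.Nonempty → (strongLeft S x).length + (strongRight S x).length = V.card + 1) := by
  obtain ⟨h1, h2⟩ := mem_blockVertices.1 hx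
  by_cases h0 : 0 ∈ S
  · rw [if_pos h0] at h2
    have h0x : 0 ∉ x := fun h => (Finset.mem_erase.1 (h2 (List.mem_toFinset.2 h))).1 rfl
    have hnd : (0 :: x).Nodup := List.nodup_cons.2 ⟨h0x, h1⟩
    refine ⟨(0 :: x).toFinset, ?_, ?_, fun h => absurd h0 h, fun _ => ⟨0, by simp⟩, fun _ => ?_⟩
    · rw [List.toFinset_cons]
      exact Finset.insert_subset h0 (h2.trans (Finset.erase_subset _ _))
    · rw [strongRight, if_pos h0]
      exact isPartition_incRuns hnd
    · have h3 := length_decRuns_add_length_incRuns hnd (by simp)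
      have h4 : (decRuns (0 :: x)).length = (decRuns x).length + 1 := by
        match x with
        | [] => simp [decRuns, List.splitBy, List.splitBy.loop]
        | b :: l =>
          have := splitBy_cons_cons_of_not_rel (r := fun a b => decide (b < a)) (a := 0) (b := b)
            (l := l) (by simp)
          rw [decRuns, this]
          simp [decRuns]
      rw [strongLeft, strongRight, if_pos h0, if_pos h0, List.toFinset_card_of_nodup hnd,
        List.length_cons, ← h4, h3]
  · rw [if_neg h0] at h2
    subst h2
    refine ⟨x.toFinset, subset_rfl, ?_, fun _ => rfl, id, fun h => ?_⟩
    · rw [strongRight, if_neg h0]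
      exact isPartition_incRuns h1
    · rw [strongLeft, strongRight, if_neg h0, if_neg h0, List.toFinset_card_of_nodup h1]
      exact length_decRuns_add_length_incRuns h1 (List.toFinset_nonempty_iff x |>.1 h)

theorem isChain_strongLeft {S : Finset ℕ} {x : List ℕ} (hx : x ∈ blockVertices S) :
    (strongLeft S x).IsChain (fun A B => ∃ a ∈ A, ∃ b ∈ B, a ≤ b) := by
  have hne := (isPartition_strongLeft hx).1
  unfold strongLeft at hne ⊢
  split_ifs at hne ⊢ with h0
  · rw [List.isChain_cons]
    refine ⟨fun B hB => ?_, isChain_decRuns x⟩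
    obtain ⟨b, hb⟩ := hne B (List.mem_cons_of_mem _ (List.mem_of_mem_head? hB))
    have h := (mem_blockVertices.1 hx).2
    rw [if_pos h0] at h
    refine ⟨0, Finset.mem_sdiff.2 ⟨h0, fun h' => (Finset.mem_erase.1 (h h')).1 rfl⟩, b, hb, ?_⟩
    exact Nat.zero_le b
  · exact isChain_decRuns x

theorem isChain_strongRight (S : Finset ℕ) (x : List ℕ) :
    (strongRight S x).IsChain (fun A B => ∃ a ∈ A, ∃ b ∈ B, b ≤ a) := by
  unfold strongRight
  split_ifs
  exacts [isChain_incRuns _, isChain_incRuns _]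

theorem strongLeft_append_cons {n : ℕ} {A M : Finset ℕ} {x₁ x₂ : List ℕ} (h0 : n ≠ 0) (hM0 : 0 ∉ M)
    (hA : ∀ a ∈ A, a < n) (hM : ∀ a ∈ M, a < n) (hAM : Disjoint A M)
    (hx₁ : x₁ ∈ blockVertices A) (hx₂ : x₂ ∈ blockVertices M) :
    strongLeft (insert n (A ∪ M)) (x₁ ++ n :: x₂) =
      strongLeft A x₁ ++ insertHead n (strongLeft M x₂) := by
  have h1 := toFinset_subset_of_mem_blockVertices hx₁
  have h2 := (mem_blockVertices.1 hx₂).2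
  rw [if_neg hM0] at h2
  have h3 := decRuns_append_cons (n := n) (x := x₁) (y := x₂)
    (fun a ha => hA a (h1 (List.mem_toFinset.2 ha)))
    (fun a ha => hM a (h2.subset (List.mem_toFinset.2 ha)))
  have h4 : 0 ∈ insert n (A ∪ M) ↔ 0 ∈ A := by simp [hM0, h0.symm]
  simp only [strongLeft, h4, hM0, if_false]
  split_ifs
  · rw [h3, List.cons_append]
    congr 1
    ext a
    have i1 : a ∈ A → a ∉ M := fun h => Finset.disjoint_left.1 hAM h
    have i2 : a ∈ A → a ≠ n := fun h => (hA a h).ne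
    simp only [Finset.mem_sdiff, Finset.mem_insert, Finset.mem_union, List.toFinset_append,
      List.toFinset_cons, h2]
    tauto
  · exact h3

theorem strongRight_append_cons {n : ℕ} {A M : Finset ℕ} {x₁ x₂ : List ℕ} (h0 : n ≠ 0)
    (hM0 : 0 ∉ M) (hA : ∀ a ∈ A, a < n) (hM : ∀ a ∈ M, a < n)
    (hx₁ : x₁ ∈ blockVertices A) (hx₂ : x₂ ∈ blockVertices M) :
    strongRight (insert n (A ∪ M)) (x₁ ++ n :: x₂) =
      insertLast n (strongRight A x₁) ++ strongRight M x₂ := by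
  have h1 := toFinset_subset_of_mem_blockVertices hx₁
  have h2 := toFinset_subset_of_mem_blockVertices hx₂
  have h4 : 0 ∈ insert n (A ∪ M) ↔ 0 ∈ A := by simp [hM0, h0.symm]
  have i1 : ∀ a ∈ x₁, a < n := fun a ha => hA a (h1 (List.mem_toFinset.2 ha))
  have i2 : ∀ a ∈ x₂, a < n := fun a ha => hM a (h2 (List.mem_toFinset.2 ha))
  simp only [strongRight, h4, hM0, if_false]
  split_ifs
  · rw [← List.cons_append]
    refine incRuns_append_cons (fun a ha => ?_) i2
    rcases List.mem_cons.1 ha with rfl | ha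
    exacts [Nat.pos_of_ne_zero h0, i1 a ha]
  · exact incRuns_append_cons i1 i2

theorem strongLeft_insert {n : ℕ} {S : Finset ℕ} {x : List ℕ} (h0 : 0 ∈ S) (hx : n ∉ x) :
    strongLeft (insert n S) x = insertHead n (strongLeft S x) := by
  rw [strongLeft, strongLeft, if_pos h0, if_pos (Finset.mem_insert_of_mem h0), insertHead,
    Finset.insert_sdiff_of_notMem _ (by simpa using hx)]

theorem strongRight_insert {n : ℕ} {S : Finset ℕ} {x : List ℕ} (h0 : 0 ∈ S) :
    strongRight (insert n S) x = strongRight S x := by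
  rw [strongRight, strongRight, if_pos h0, if_pos (Finset.mem_insert_of_mem h0)]

/-- The vertices in which the maximal element `n` occurs are the concatenations of a vertex of a
smaller block, the element `n`, and a vertex of a permutahedron. -/
theorem sum_blockVertices_insert {M : Type*} [AddCommMonoid M] {n : ℕ} {S : Finset ℕ} (h0 : n ≠ 0)
    (hn : n ∉ S) (f : List ℕ → M) :
    ∑ x ∈ (blockVertices (insert n S)).filter (n ∈ ·), f x =
      ∑ A ∈ S.powerset.filter (fun A => 0 ∈ S → 0 ∈ A), ∑ x₁ ∈ blockVertices A,
        ∑ x₂ ∈ blockVertices (S \ A), f (x₁ ++ n :: x₂) := by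
  have hS0 : 0 ∈ insert n S ↔ 0 ∈ S := by simp [h0.symm]
  simp only [← Finset.sum_product']
  rw [Finset.sum_sigma']
  symm
  refine Finset.sum_bij (fun p _ => p.2.1 ++ n :: p.2.2) ?_ ?_ ?_ fun _ _ => rfl
  · rintro ⟨A, x₁, x₂⟩ h
    simp only [Finset.mem_sigma, Finset.mem_filter, Finset.mem_powerset, Finset.mem_product] at h
    obtain ⟨⟨hA, hA0⟩, hx₁, hx₂⟩ := h
    have i1 := toFinset_subset_of_mem_blockVertices hx₁
    have i2 := toFinset_subset_of_mem_blockVertices hx₂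
    have n1 : n ∉ x₁ := fun h => hn (hA (i1 (List.mem_toFinset.2 h)))
    have n2 : n ∉ x₂ := fun h => hn ((Finset.mem_sdiff.1 (i2 (List.mem_toFinset.2 h))).1)
    have hd : List.Disjoint x₁ x₂ := by
      rw [List.disjoint_left]
      intro a h1 h2
      exact (Finset.mem_sdiff.1 (i2 (List.mem_toFinset.2 h2))).2 (i1 (List.mem_toFinset.2 h1))
    rw [mem_blockVertices] at hx₁ hx₂
    rw [Finset.mem_filter, mem_blockVertices]
    refine ⟨⟨?_, ?_⟩, by simp⟩
    · rw [List.nodup_append', List.nodup_cons, List.disjoint_cons_right]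
      exact ⟨hx₁.1, ⟨n2, hx₂.1⟩, n1, hd⟩
    · rw [List.toFinset_append, List.toFinset_cons]
      simp only [hS0]
      split_ifs with hS
      · have h1 := hx₁.2
        have h2 := hx₂.2
        rw [if_pos (hA0 hS)] at h1
        rw [if_neg (by simp [hA0 hS])] at h2
        intro a ha
        simp only [Finset.mem_union, Finset.mem_insert] at ha
        rw [Finset.mem_erase, Finset.mem_insert]
        rcases ha with h | rfl | h
        · have := Finset.mem_erase.1 (h1 h)
          exact ⟨this.1, Or.inr (hA this.2)⟩
        · exact ⟨h0, Or.inl rfl⟩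
        · rw [h2, Finset.mem_sdiff] at h
          exact ⟨fun h' => h.2 (h' ▸ hA0 hS), Or.inr h.1⟩
      · have h1 := hx₁.2
        have h2 := hx₂.2
        rw [if_neg fun h => hS (hA h)] at h1
        rw [if_neg fun h => hS (Finset.mem_sdiff.1 h).1] at h2
        rw [h1, h2, Finset.union_insert, Finset.union_sdiff_of_subset hA]
  · rintro ⟨A, x₁, x₂⟩ h ⟨A', x₁', x₂'⟩ h' he
    simp only [Finset.mem_sigma, Finset.mem_filter, Finset.mem_powerset, Finset.mem_product] at h h'
    obtain ⟨⟨hA, hA0⟩, hx₁, hx₂⟩ := h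
    obtain ⟨⟨hA', hA0'⟩, hx₁', hx₂'⟩ := h'
    have n1 : n ∉ x₁ := fun h =>
      hn (hA (toFinset_subset_of_mem_blockVertices hx₁ (List.mem_toFinset.2 h)))
    have n3 : n ∉ x₂ := fun h => hn (Finset.mem_sdiff.1
      (toFinset_subset_of_mem_blockVertices hx₂ (List.mem_toFinset.2 h))).1
    obtain ⟨rfl, -, rfl⟩ := (List.append_cons_inj_of_notMem n1 n3).1 he
    have key : ∀ B ⊆ S, (0 ∈ S → 0 ∈ B) → x₂ ∈ blockVertices (S \ B) → B = S \ x₂.toFinset := by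
      intro B hB hB0 hx
      have := (mem_blockVertices.1 hx).2
      rw [if_neg fun h => (Finset.mem_sdiff.1 h).2 (hB0 (Finset.mem_sdiff.1 h).1)] at this
      rw [this, Finset.sdiff_sdiff_eq_self hB]
    obtain rfl : A = A' := (key A hA hA0 hx₂).trans (key A' hA' hA0' hx₂').symm
    rfl
  · intro x hx
    rw [Finset.mem_filter, mem_blockVertices] at hx
    obtain ⟨⟨hnd, hx⟩, hnx⟩ := hx
    obtain ⟨x₁, x₂, rfl⟩ := List.append_of_mem hnx
    rw [List.nodup_append', List.nodup_cons, List.disjoint_cons_right] at hnd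
    obtain ⟨d1, ⟨n2, d2⟩, n1, d3⟩ := hnd
    simp only [hS0, List.toFinset_append, List.toFinset_cons] at hx
    have hs2 : x₂.toFinset ⊆ S := by
      intro a ha
      have han : a ≠ n := fun h => n2 (by simpa [h] using ha)
      split_ifs at hx
      · have := Finset.mem_erase.1 (hx (Finset.mem_union_right _ (Finset.mem_insert_of_mem ha)))
        exact (Finset.mem_insert.1 this.2).resolve_left han
      · have : a ∈ insert n S := hx ▸ Finset.mem_union_right _ (Finset.mem_insert_of_mem ha)
        exact (Finset.mem_insert.1 this).resolve_left han
    have hs1 : x₁.toFinset ⊆ S \ x₂.toFinset := by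
      intro a ha
      have han : a ≠ n := fun h => n1 (by simpa [h] using ha)
      rw [Finset.mem_sdiff]
      refine ⟨?_, fun h => d3 (List.mem_toFinset.1 ha) (List.mem_toFinset.1 h)⟩
      split_ifs at hx
      · have := Finset.mem_erase.1 (hx (Finset.mem_union_left _ ha))
        exact (Finset.mem_insert.1 this.2).resolve_left han
      · have : a ∈ insert n S := hx ▸ Finset.mem_union_left _ ha
        exact (Finset.mem_insert.1 this).resolve_left han
    have h02 : 0 ∈ S → 0 ∉ x₂.toFinset := by
      intro hS h
      rw [if_pos hS] at hx
      exact (Finset.mem_erase.1 (hx (Finset.mem_union_right _ (Finset.mem_insert_of_mem h)))).1 rfl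
    refine ⟨⟨S \ x₂.toFinset, x₁, x₂⟩, ?_, rfl⟩
    simp only [Finset.mem_sigma, Finset.mem_filter, Finset.mem_powerset, Finset.mem_product,
      mem_blockVertices]
    refine ⟨⟨Finset.sdiff_subset, fun hS => Finset.mem_sdiff.2 ⟨hS, h02 hS⟩⟩, ⟨d1, ?_⟩, d2, ?_⟩
    · split_ifs with h
      · have hS := (Finset.mem_sdiff.1 h).1
        rw [if_pos hS] at hx
        intro a ha
        exact Finset.mem_erase.2 ⟨(Finset.mem_erase.1 (hx (Finset.mem_union_left _ ha))).1, hs1 ha⟩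
      · have hS : 0 ∉ S := fun hS => h (Finset.mem_sdiff.2 ⟨hS, h02 hS⟩)
        rw [if_neg hS] at hx
        refine hs1.antisymm fun a ha => ?_
        rw [Finset.mem_sdiff] at ha
        have : a ∈ x₁.toFinset ∪ insert n x₂.toFinset := hx ▸ Finset.mem_insert_of_mem ha.1
        simp only [Finset.mem_union, Finset.mem_insert] at this
        rcases this with h | rfl | h
        exacts [h, absurd ha.1 hn, absurd h ha.2]
    · rw [Finset.sdiff_sdiff_eq_self hs2, if_neg]
      intro h
      exact h02 (hs2 h) h

/-! ### The diagonal of the top cell of a block -/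

/-- The diagonal of the top cell of the block `S`: the signed sum over its orthogonal streams. -/
noncomputable def streamSum (S : Finset ℕ) : BiChain :=
  ∑ t ∈ blockStream S, blockSign S t • pair t.2.1 t.2.2

theorem streamSum_eq (S : Finset ℕ) :
    streamSum S = ∑ x ∈ blockVertices S, ∑ u ∈ rightShifts (strongLeft S x),
      ∑ v ∈ leftShifts (strongRight S x), blockSign S (x, u, v) • pair u v := by
  rw [streamSum, blockStream, Finset.sum_biUnion]
  · refine Finset.sum_congr rfl fun x _ => ?_
    rw [Finset.sum_product, Finset.sum_singleton, Finset.sum_product]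
  · intro x _ y _ hxy
    rw [Function.onFun, Finset.disjoint_left]
    rintro t ht ht'
    rw [Finset.mem_product, Finset.mem_singleton] at ht ht'
    exact hxy (ht.1.symm.trans ht'.1)

theorem sum_rightShifts_insertHead {M : Type*} [AddCommMonoid M] {n : ℕ} {b : Word} (f : Word → M)
    (hlt : ∀ C ∈ b, ∀ a ∈ C, a < n) (hch : b.IsChain (fun A B => ∃ a ∈ A, ∃ b ∈ B, a ≤ b)) :
    ∑ c ∈ rightShifts (insertHead n b), f c =
      ∑ c ∈ rightShifts b, ((joinsNew n c).map fun p => f p.2).sum := by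
  cases b with
  | nil => simp [insertHead, joinsNew]
  | cons A t =>
    rw [insertHead, sum_rightShifts_insert t A f hlt hch]
    refine Finset.sum_congr rfl fun c hc => ?_
    have := length_of_mem_rightShifts _ _ c rfl hc
    rw [joinsNew, if_neg]
    rintro rfl
    simp at this

theorem sum_leftShifts_joinsNew {M : Type*} [AddCommMonoid M] {n : ℕ} {V : Finset ℕ} {a : Word}
    (f : Word → M) (ha : IsPartition V a) (hlt : ∀ x ∈ V, x < n)
    (hch : a.IsChain (fun A B => ∃ a ∈ A, ∃ b ∈ B, b ≤ a)) :
    ∑ c ∈ leftShifts (insertLast n a), f c =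
      ∑ c ∈ leftShifts a, ((joinsNew n c).map fun p => f p.2).sum := by
  by_cases h : a = []
  · subst h; simp [insertLast, joinsNew]
  · rw [sum_leftShifts_insertLast a f h ha.1 ha.2.1
      (fun C hC x hx => hlt x (ha.subset C hC hx)) hch]
    refine Finset.sum_congr rfl fun c hc => ?_
    have := length_of_mem_leftShifts _ c hc
    rw [joinsNew, if_neg]
    rintro rfl
    exact h (List.length_eq_zero_iff.1 this.symm)

theorem mem_getLast_insertLast {n : ℕ} {a : Word} {A : Finset ℕ}
    (h : A ∈ (insertLast n a).getLast?) : n ∈ A := by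
  rcases a.eq_nil_or_concat' with rfl | ⟨L, B, rfl⟩
  · simp [insertLast] at h; simp [← h]
  · rw [insertLast_append_singleton] at h
    simp at h; simp [← h]

theorem mem_head_insertHead {n : ℕ} {a : Word} {A : Finset ℕ}
    (h : A ∈ (insertHead n a).head?) : n ∈ A := by
  cases a <;> simp [insertHead] at h <;> simp [← h]

/-! ### The recursion for the orthogonal streams -/

/-- The members of the complementary pairs of the stream of a vertex. -/
theorem isPartition_of_mem_shifts {S : Finset ℕ} {x : List ℕ} {u v : Word}
    (hx : x ∈ blockVertices S) (hu : u ∈ rightShifts (strongLeft S x))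
    (hv : v ∈ leftShifts (strongRight S x)) :
    IsPartition S u ∧ u.length = (strongLeft S x).length ∧ ∃ V ⊆ S, IsPartition V v ∧
      (0 ∉ S → V = S) ∧ (S.Nonempty → V.Nonempty) ∧
      (S.Nonempty → u.length + v.length = V.card + 1) := by
  obtain ⟨V, h1, h2, h3, h4, h5⟩ := isPartition_strongRight hx
  have hl := length_of_mem_rightShifts _ _ u rfl hu
  refine ⟨(isPartition_strongLeft hx).rightShift hu, hl, V, h1, h2.leftShift hv, h3, h4, ?_⟩
  rw [hl, length_of_mem_leftShifts _ v hv]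
  exact h5

theorem dim_add_dim_of_mem_shifts {S : Finset ℕ} {x : List ℕ} {u v : Word}
    (hx : x ∈ blockVertices S) (hS : S.Nonempty) (hu : u ∈ rightShifts (strongLeft S x))
    (hv : v ∈ leftShifts (strongRight S x)) : dim u + dim v + 1 = S.card := by
  obtain ⟨h1, -, V, -, h2, -, -, h3⟩ := isPartition_of_mem_shifts hx hu hv
  have := h1.dim_add_length
  have := h2.dim_add_length
  have := h3 hS
  omega

theorem IsPartition.ne_nil {S : Finset ℕ} {w : Word} (h : IsPartition S w) (hS : S.Nonempty) :
    w ≠ [] := by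
  rintro rfl
  exact hS.ne_empty h.2.2.symm

/-- The chain obtained by joining `n` to the right members of the complementary pairs of the stream
of a vertex. -/
noncomputable def rightTerm (n : ℕ) (S : Finset ℕ) (x : List ℕ) : BiChain :=
  ∑ u ∈ rightShifts (strongLeft S x), ∑ v ∈ leftShifts (strongRight S x), blockSign S (x, u, v) •
    ((joinsNew n v).map fun p => (-1 : ℤ) ^ p.1 • pair u p.2).sum

/-- The chain obtained by joining `n` to the left members of the complementary pairs of the stream
of a vertex. -/
noncomputable def leftTerm (n : ℕ) (S : Finset ℕ) (x : List ℕ) : BiChain :=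
  ∑ u ∈ rightShifts (strongLeft S x), ∑ v ∈ leftShifts (strongRight S x), blockSign S (x, u, v) •
    ((joinsNew n u).map fun q => (-1 : ℤ) ^ (q.1 + dim v) • pair q.2 v).sum

/-- The signed sum over the blocks to which `n` is joined, without the global sign of `wordDer`. -/
theorem wordDer_joinLetter {n : ℕ} {w : Word} : ∀ {S : Finset ℕ}, IsPartition S w → n ∉ S →
    wordDer (joinLetter n) w =
      (-1 : ℤ) ^ dim w • ((joins n w).map fun p => Finsupp.single p.2 ((-1 : ℤ) ^ p.1)).sum := by
  induction w with
  | nil => intro S _ _; simp [wordDer, joins]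
  | cons A t ih =>
    intro S hS hn
    obtain ⟨hA, hd, rfl, ht⟩ := hS.cons_inv
    simp only [Finset.mem_union, not_or] at hn
    have hmap : ∀ L : List (ℕ × Word),
        ((L.map fun p => Finsupp.single p.2 ((-1 : ℤ) ^ p.1)).sum).mapDomain (A :: ·) =
          (L.map fun p => Finsupp.single (A :: p.2) ((-1 : ℤ) ^ p.1)).sum := by
      intro L
      induction L with
      | nil => simp
      | cons p L ih => simp [Finsupp.mapDomain_add, ih, Finsupp.mapDomain_single]
    have hsq : (-1 : ℤ) ^ dim t * (-1) ^ dim t = 1 := by rw [← mul_pow]; simp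
    rw [wordDer, ih ht hn.2, joinLetter, if_neg (by simp [hn.1, hA.ne_empty]), joins,
      Finsupp.mapDomain_single, Finsupp.mapDomain_smul, hmap, List.map_cons, List.sum_cons,
      smul_add, List.map_map, dim_cons, smul_smul, ← pow_add, Finsupp.smul_single,
      smul_eq_mul, pow_add,
      mul_assoc, hsq, mul_one, ← pow_add]
    rfl

theorem map_list_sum_smul {M : Type*} [AddCommGroup M] (f : (Word →₀ ℤ) →ₗ[ℤ] M)
    (L : List (ℕ × Word)) :
    f (L.map fun p => Finsupp.single p.2 ((-1 : ℤ) ^ p.1)).sum =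
      (L.map fun p => (-1 : ℤ) ^ p.1 • f (Finsupp.single p.2 1)).sum := by
  induction L with
  | nil => simp
  | cons p L ih =>
    rw [List.map_cons, List.sum_cons, map_add, ih, List.map_cons, List.sum_cons, ← map_smul,
      Finsupp.smul_single, smul_eq_mul, mul_one]

/-- The value of `extendRight` on a pair of total dimension `#S - 1`, as a sum over blocks. -/
theorem joinRight_pair {n : ℕ} {V : Finset ℕ} {u v : Word} (hv : IsPartition V v) (hn : n ∉ V)
    (h0 : v ≠ []) :
    -((-1 : ℤ) ^ (dim u + dim v + 1) • joinRight n (pair u v)) =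
      ((joinsNew n v).map fun p => (-1 : ℤ) ^ p.1 • pair u p.2).sum := by
  have h := map_list_sum_smul (LinearMap.mulLeft ℤ (pair u []) ∘ₗ inr) (joins n v)
  simp only [LinearMap.comp_apply, LinearMap.mulLeft_apply, inr_single, one_smul, pair_mul_pair,
    dim_nil, zero_mul, pow_zero, List.append_nil, List.nil_append] at h
  rw [joinRight, der_pair, wordDer_zero, map_zero, zero_mul, zero_add, wordDer_joinLetter hv hn,
    map_smul, mul_smul_comm, h, joinsNew, if_neg h0, smul_smul, smul_smul, ← neg_smul]
  have : -((-1 : ℤ) ^ (dim u + dim v + 1) * ((-1) ^ dim u * (-1) ^ dim v)) = 1 := by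
    rw [pow_succ, ← pow_add, mul_neg_one, neg_mul, neg_neg, ← mul_pow]; simp
  rw [← mul_assoc] at this
  rw [mul_assoc, ← mul_assoc, this, one_smul]

/-- The value of `extendLeft` on a pair of total dimension `#S - 1`, as a sum over blocks. -/
theorem joinLeft_pair {n : ℕ} {S : Finset ℕ} {u v : Word} (hu : IsPartition S u) (hn : n ∉ S)
    (h0 : u ≠ []) :
    -((-1 : ℤ) ^ (dim u + dim v + 1) • joinLeft n (pair u v)) =
      ((joinsNew n u).map fun q => (-1 : ℤ) ^ (q.1 + dim v) • pair q.2 v).sum := by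
  have h := map_list_sum_smul (LinearMap.mulRight ℤ (pair [] v) ∘ₗ inl) (joins n u)
  simp only [LinearMap.comp_apply, LinearMap.mulRight_apply, inl_single, one_smul, pair_mul_pair,
    dim_nil, zero_mul, pow_zero, List.append_nil, List.nil_append] at h
  rw [joinLeft, der_pair, wordDer_zero, map_zero, mul_zero, smul_zero, add_zero,
    wordDer_joinLetter hu hn, map_smul, smul_mul_assoc, h, joinsNew, if_neg h0, smul_smul,
    ← neg_smul]
  have : -((-1 : ℤ) ^ (dim u + dim v + 1) * (-1) ^ dim u) = (-1) ^ dim v := by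
    rw [pow_succ, pow_add, mul_neg_one, neg_mul, neg_neg, mul_right_comm, ← mul_pow]; simp
  rw [this, List.smul_sum, List.map_map]
  simp only [Function.comp_def, smul_smul, pow_add, mul_comm]

theorem blockVertices_empty : blockVertices ∅ = {[]} := by
  ext x
  rw [mem_blockVertices]
  simp +contextual

theorem strongLeft_empty : strongLeft ∅ [] = [] := by simp [strongLeft, decRuns]

theorem strongRight_empty : strongRight ∅ [] = [] := by simp [strongRight, incRuns]

theorem blockSign_empty : blockSign ∅ ([], [], []) = 1 := by
  simp [blockSign, strongLeft_empty, rsgn, sgnOne, sgnTwo, epsOne, psgn, inversions, carrier]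

theorem streamSum_empty : streamSum ∅ = 1 := by
  simp [streamSum_eq, blockVertices_empty, strongLeft_empty, strongRight_empty, blockSign_empty,
    one_def, -zsmul_eq_mul]

theorem extend_of_nonempty (D : BiChain →ₗ[ℤ] BiChain) (b : BiChain) (τ : Finset ℕ → BiChain)
    {S : Finset ℕ} (hS : S.Nonempty) : extend D b τ S = -((-1 : ℤ) ^ S.card • D (τ S)) := by
  simp [extend, atEmpty, hS.ne_empty, alt]

theorem extend_empty (D : BiChain →ₗ[ℤ] BiChain) (b : BiChain) {τ : Finset ℕ → BiChain}
    (h : D (τ ∅) = 0) : extend D b τ ∅ = b := by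
  simp [extend, atEmpty, alt, h]

theorem sum_rightTerm {n : ℕ} {S : Finset ℕ} (hn : n ∉ S) :
    ∑ x ∈ blockVertices S, rightTerm n S x = extendRight n streamSum S := by
  rcases S.eq_empty_or_nonempty with rfl | hS
  · rw [extendRight, extend_empty _ _ (by
      simp [streamSum_empty, one_def, der_pair, wordDer])]
    simp [blockVertices_empty, rightTerm, strongLeft_empty, strongRight_empty, blockSign_empty,
      joinsNew]
  · rw [extendRight, extend_of_nonempty _ _ _ hS, streamSum_eq]
    simp only [map_sum, Finset.smul_sum, ← Finset.sum_neg_distrib]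
    refine Finset.sum_congr rfl fun x hx => Finset.sum_congr rfl fun u hu =>
      Finset.sum_congr rfl fun v hv => ?_
    obtain ⟨-, -, V, hV, h2, -, h3, -⟩ := isPartition_of_mem_shifts hx hu hv
    rw [← joinRight_pair h2 (fun h => hn (hV h)) (h2.ne_nil (h3 hS)),
      dim_add_dim_of_mem_shifts hx hS hu hv, map_smul, smul_neg, smul_comm]

theorem sum_leftTerm {n : ℕ} {S : Finset ℕ} (hn : n ∉ S) :
    ∑ x ∈ blockVertices S, leftTerm n S x = extendLeft n streamSum S := by
  rcases S.eq_empty_or_nonempty with rfl | hS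
  · rw [extendLeft, extend_empty _ _ (by
      simp [streamSum_empty, one_def, der_pair, wordDer])]
    simp [blockVertices_empty, leftTerm, strongLeft_empty, strongRight_empty, blockSign_empty,
      joinsNew]
  · rw [extendLeft, extend_of_nonempty _ _ _ hS, streamSum_eq]
    simp only [map_sum, Finset.smul_sum, ← Finset.sum_neg_distrib]
    refine Finset.sum_congr rfl fun x hx => Finset.sum_congr rfl fun u hu =>
      Finset.sum_congr rfl fun v hv => ?_
    obtain ⟨h1, -⟩ := isPartition_of_mem_shifts hx hu hv
    rw [← joinLeft_pair h1 hn (h1.ne_nil hS),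
      dim_add_dim_of_mem_shifts hx hS hu hv, map_smul, smul_neg, smul_comm]

theorem list_sum_mul_list_sum {ι κ : Type*} (L : List ι) (L' : List κ) (f : ι → BiChain)
    (g : κ → BiChain) :
    (L.map f).sum * (L'.map g).sum = (L.map fun p => (L'.map fun q => f p * g q).sum).sum := by
  induction L with
  | nil => simp
  | cons p L ih => rw [List.map_cons, List.sum_cons, add_mul, ih, List.map_cons, List.sum_cons,
      List.sum_map_mul_left]

theorem list_map_congr {ι : Type*} {L : List ι} {f g : ι → BiChain} (h : ∀ p ∈ L, f p = g p) :
    (L.map f).sum = (L.map g).sum := by rw [List.map_congr_left h]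

/-- The stream of a vertex in which the maximal element `n` occurs is the product of the streams of
the two parts of the vertex, with `n` joined to the right members of the first one and to the left
members of the second one. -/
theorem vertex_sum_append {n : ℕ} {A M : Finset ℕ} {x₁ x₂ : List ℕ} (h0 : n ≠ 0) (hM0 : 0 ∉ M)
    (hA : ∀ a ∈ A, a < n) (hM : ∀ a ∈ M, a < n) (hAM : Disjoint A M)
    (hx₁ : x₁ ∈ blockVertices A) (hx₂ : x₂ ∈ blockVertices M) :
    ∑ u ∈ rightShifts (strongLeft (insert n (A ∪ M)) (x₁ ++ n :: x₂)),
      ∑ v ∈ leftShifts (strongRight (insert n (A ∪ M)) (x₁ ++ n :: x₂)),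
        blockSign (insert n (A ∪ M)) (x₁ ++ n :: x₂, u, v) • pair u v =
      shuff A M • (rightTerm n A x₁ * leftTerm n M x₂) := by
  have hL := strongLeft_append_cons h0 hM0 hA hM hAM hx₁ hx₂
  have hR := strongRight_append_cons h0 hM0 hA hM hx₁ hx₂
  have hp₁ := isPartition_strongLeft hx₁
  have hp₂ := isPartition_strongLeft hx₂
  obtain ⟨V₁, hV₁, hr₁, -⟩ := isPartition_strongRight hx₁
  obtain ⟨V₂, hV₂, hr₂, -⟩ := isPartition_strongRight hx₂
  have hright : ∀ f : Word → BiChain,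
      ∑ c ∈ rightShifts (strongLeft A x₁ ++ insertHead n (strongLeft M x₂)), f c =
        ∑ c₁ ∈ rightShifts (strongLeft A x₁), ∑ c₂ ∈ rightShifts (strongLeft M x₂),
          ((joinsNew n c₂).map fun q => f (c₁ ++ q.2)).sum := by
    intro f
    rw [sum_rightShifts_append _ _ _ f rfl hp₁.1]
    · refine Finset.sum_congr rfl fun c₁ _ => ?_
      exact sum_rightShifts_insertHead (fun c => f (c₁ ++ c))
        (fun C hC a ha => hM a (hp₂.subset C hC ha)) (isChain_strongLeft hx₂)
    · intro B hB
      refine ⟨n, mem_head_insertHead hB, fun x hx => hA x ?_⟩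
      rwa [hp₁.2.2] at hx
  have hleft : ∀ f : Word → BiChain,
      ∑ c ∈ leftShifts (insertLast n (strongRight A x₁) ++ strongRight M x₂), f c =
        ∑ c₁ ∈ leftShifts (strongRight A x₁), ∑ c₂ ∈ leftShifts (strongRight M x₂),
          ((joinsNew n c₁).map fun p => f (p.2 ++ c₂)).sum := by
    intro f
    have hne : ∀ B ∈ insertLast n (strongRight A x₁), B.Nonempty := by
      rcases (strongRight A x₁).eq_nil_or_concat' with h | ⟨L, B, h⟩
      · rw [h]; simp [insertLast]
      · intro C hC
        have := hr₁.1
        rw [h] at hC this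
        rw [insertLast_append_singleton] at hC
        rcases List.mem_append.1 hC with hC | hC
        · exact this C (by simp [hC])
        · rw [List.mem_singleton.1 hC]; exact Finset.insert_nonempty _ _
    rw [sum_leftShifts_append hr₂.1 hr₂.2.1 _ f hne]
    · rw [sum_leftShifts_joinsNew (fun c => ∑ c₂ ∈ leftShifts (strongRight M x₂), f (c ++ c₂))
        hr₁ (fun x hx => hA x (hV₁ hx)) (isChain_strongRight A x₁)]
      refine Finset.sum_congr rfl fun c₁ _ => ?_
      generalize joinsNew n c₁ = L
      induction L with
      | nil => simp
      | cons p L ih => simp only [List.map_cons, List.sum_cons, ih, Finset.sum_add_distrib]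
    · intro B hB
      refine ⟨n, mem_getLast_insertLast hB, fun x hx => hM x (hV₂ ?_)⟩
      rwa [hr₂.2.2] at hx
  rw [hL, hR, hright]
  simp only [hleft]
  simp only [rightTerm, leftTerm, Finset.sum_mul_sum, Finset.smul_sum]
  refine Finset.sum_congr rfl fun u₁ hu₁ => ?_
  have hswap : ∀ (L : List (ℕ × Word)) (s t : Finset Word) (g : ℕ × Word → Word → Word → BiChain),
      (L.map fun q => ∑ c₁ ∈ s, ∑ c₂ ∈ t, g q c₁ c₂).sum =
        ∑ c₁ ∈ s, ∑ c₂ ∈ t, (L.map fun q => g q c₁ c₂).sum := by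
    intro L s t g
    induction L with
    | nil => simp
    | cons p L ih => simp only [List.map_cons, List.sum_cons, ih, Finset.sum_add_distrib]
  refine Finset.sum_congr rfl fun u₂ hu₂ => ?_
  rw [hswap]
  refine Finset.sum_congr rfl fun v₁ hv₁ => Finset.sum_congr rfl fun v₂ hv₂ => ?_
  obtain ⟨i1, i2, V, i3, i4, i5, i6, i7⟩ := isPartition_of_mem_shifts hx₁ hu₁ hv₁
  obtain ⟨j1, j2, W, j3, j4, j5, j6, j7⟩ := isPartition_of_mem_shifts hx₂ hu₂ hv₂
  obtain rfl := j5 hM0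
  rw [smul_mul_smul_comm, list_sum_mul_list_sum]
  have hcomm : ((joinsNew n v₁).map fun p => ((joinsNew n u₂).map fun q =>
      ((-1 : ℤ) ^ p.1 • pair u₁ p.2) * ((-1 : ℤ) ^ (q.1 + dim v₂) • pair q.2 v₂)).sum).sum =
      ((joinsNew n u₂).map fun q => ((joinsNew n v₁).map fun p =>
      ((-1 : ℤ) ^ p.1 • pair u₁ p.2) * ((-1 : ℤ) ^ (q.1 + dim v₂) • pair q.2 v₂)).sum).sum := by
    generalize joinsNew n v₁ = L
    generalize joinsNew n u₂ = L'
    induction L with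
    | nil => simp
    | cons p L ih => simp only [List.map_cons, List.sum_cons, ih, List.sum_map_add]
  rw [hcomm, smul_smul, List.smul_sum, List.map_map]
  refine list_map_congr fun q hq => ?_
  rw [Function.comp_apply, List.smul_sum, List.map_map]
  refine list_map_congr fun p hp => ?_
  rw [Function.comp_apply, blockSign_split hA hM hAM hp₁ hp₂ hL i1 i2 j1 j2 i4 i3 ?_ j4 j7 hp hq,
    smul_mul_smul_comm, pair_mul_pair, smul_smul, smul_smul]
  · congr 1
    simp only [pow_add]
    ring
  · rintro rfl
    by_contra hne
    exact i4.ne_nil (i6 (Finset.nonempty_iff_ne_empty.2 hne)) rfl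

/-- The stream of a vertex in which the maximal element `n` is deleted. -/
theorem vertex_sum_delete {n : ℕ} {S : Finset ℕ} {x : List ℕ} (h0 : 0 ∈ S) (hS : ∀ a ∈ S, a < n)
    (hx : x ∈ blockVertices S) (hnx : n ∉ x) :
    ∑ u ∈ rightShifts (strongLeft (insert n S) x), ∑ v ∈ leftShifts (strongRight (insert n S) x),
        blockSign (insert n S) (x, u, v) • pair u v = leftTerm n S x := by
  have hp := isPartition_strongLeft hx
  have hL := strongLeft_insert h0 hnx
  rw [leftTerm, hL, strongRight_insert h0,
    sum_rightShifts_insertHead _ (fun C hC a ha => hS a (hp.subset C hC ha))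
      (isChain_strongLeft hx)]
  refine Finset.sum_congr rfl fun u hu => ?_
  have hswap : ∀ (L : List (ℕ × Word)) (s : Finset Word) (g : ℕ × Word → Word → BiChain),
      (L.map fun q => ∑ c ∈ s, g q c).sum = ∑ c ∈ s, (L.map fun q => g q c).sum := by
    intro L s g
    induction L with
    | nil => simp
    | cons p L ih => simp only [List.map_cons, List.sum_cons, ih, Finset.sum_add_distrib]
  rw [hswap]
  refine Finset.sum_congr rfl fun v hv => ?_
  obtain ⟨i1, i2, V, i3, i4, i5, i6, i7⟩ := isPartition_of_mem_shifts hx hu hv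
  have hu0 := i1.ne_nil ⟨0, h0⟩
  rw [List.smul_sum, List.map_map]
  refine list_map_congr fun q hq => ?_
  rw [joinsNew, if_neg hu0] at hq
  rw [Function.comp_apply, blockSign_delete hS hp hL i1 hu0 i2 i4 i3
    (dim_add_dim_of_mem_shifts hx ⟨0, h0⟩ hu hv) hq, smul_smul, mul_comm]

/-- The recursion for the diagonal of a block on its maximal element `n`. -/
theorem streamSum_insert {n : ℕ} {S : Finset ℕ} (hn : n ≠ 0) (hS : ∀ a ∈ S, a < n) :
    streamSum (insert n S) =
      ∑ A ∈ S.powerset.filter (fun A => 0 ∈ S → 0 ∈ A), shuff A (S \ A) •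
        (extendRight n streamSum A * extendLeft n streamSum (S \ A)) +
      if 0 ∈ S then extendLeft n streamSum S else 0 := by
  have hnS : n ∉ S := fun h => lt_irrefl n (hS n h)
  rw [streamSum_eq, ← Finset.sum_filter_add_sum_filter_not _ (n ∈ ·),
    sum_blockVertices_insert hn hnS]
  congr 1
  · refine Finset.sum_congr rfl fun A hA => ?_
    rw [Finset.mem_filter, Finset.mem_powerset] at hA
    rw [← sum_rightTerm fun h => hnS (hA.1 h),
      ← sum_leftTerm fun h => hnS (Finset.mem_sdiff.1 h).1, Finset.sum_mul_sum, Finset.smul_sum]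
    refine Finset.sum_congr rfl fun x₁ hx₁ => ?_
    rw [Finset.smul_sum]
    refine Finset.sum_congr rfl fun x₂ hx₂ => ?_
    have := vertex_sum_append (A := A) (M := S \ A) hn
      (fun h => (Finset.mem_sdiff.1 h).2 (hA.2 (Finset.mem_sdiff.1 h).1))
      (fun a ha => hS a (hA.1 ha)) (fun a ha => hS a (Finset.mem_sdiff.1 ha).1)
      Finset.disjoint_sdiff hx₁ hx₂
    rwa [Finset.union_sdiff_of_subset hA.1] at this
  · split_ifs with h0
    · have : (blockVertices (insert n S)).filter (fun x => ¬ n ∈ x) = blockVertices S := by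
        ext x
        rw [Finset.mem_filter, mem_blockVertices, mem_blockVertices, if_pos h0,
          if_pos (Finset.mem_insert_of_mem h0), Finset.erase_insert_of_ne hn,
          and_assoc, and_congr_right_iff]
        intro _
        constructor
        · rintro ⟨h1, h2⟩
          rwa [Finset.subset_insert_iff_of_notMem (by simpa using h2)] at h1
        · intro h
          exact ⟨h.trans (Finset.subset_insert _ _),
            fun h' => hnS (Finset.mem_erase.1 (h (List.mem_toFinset.2 h'))).2⟩
      rw [this, ← sum_leftTerm hnS]
      refine Finset.sum_congr rfl fun x hx => vertex_sum_delete h0 hS hx fun h => hnS ?_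
      exact toFinset_subset_of_mem_blockVertices hx (List.mem_toFinset.2 h)
    · rw [Finset.filter_eq_empty_iff.2, Finset.sum_empty]
      intro x hx
      have h := (mem_blockVertices.1 hx).2
      rw [if_neg (by simp [hn.symm, h0])] at h
      rw [not_not, ← List.mem_toFinset, h]
      exact Finset.mem_insert_self _ _

theorem extend_congr (D : BiChain →ₗ[ℤ] BiChain) (b : BiChain) {τ τ' : Finset ℕ → BiChain}
    {S : Finset ℕ} (h : D (τ S) = D (τ' S)) : extend D b τ S = extend D b τ' S := by
  simp [extend, alt, h]

/-- The signed sum over the orthogonal streams of a permutahedron satisfies the recursion that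
defines `permDiag`. -/
theorem streamSum_eq_permDiag (n : ℕ) : ∀ S ⊆ Finset.range n, 0 ∉ S → S.Nonempty →
    streamSum S = permDiag n S := by
  induction n with
  | zero => intro S hS _ hne; simp at hS; exact absurd hS hne.ne_empty
  | succ n ih =>
    intro S hS h0 hne
    rw [Finset.range_add_one] at hS
    rw [permDiag]
    split_ifs with hnS
    · obtain rfl | hn := eq_or_ne n 0
      · exact absurd hnS h0
      · have hS' : S.erase n ⊆ Finset.range n := by rwa [← Finset.subset_insert_iff]
        have h0' : 0 ∉ S.erase n := fun h => h0 (Finset.mem_erase.1 h).2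
        have e1 := streamSum_insert hn (S := S.erase n) fun a ha => Finset.mem_range.1 (hS' ha)
        rw [Finset.insert_erase hnS, if_neg h0', add_zero, Finset.filter_true_of_mem
          fun A _ h => absurd h h0'] at e1
        -- At `∅` the two sides are `1` and `0`, but both vanish when `n` is joined.
        have key : ∀ D : BiChain →ₗ[ℤ] BiChain, D 1 = 0 → ∀ A ⊆ S.erase n,
            D (streamSum A) = D (permDiag n A) := by
          intro D hD A hA
          rcases A.eq_empty_or_nonempty with rfl | hAne
          · rw [streamSum_empty, permDiag_empty, hD, map_zero]
          · rw [ih A (hA.trans hS') (fun h => h0' (hA h)) hAne]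
        rw [e1, conv]
        refine Finset.sum_congr rfl fun A hA => ?_
        rw [extendRight, extendLeft,
          extend_congr _ _ (key _ (by simp [one_def, der_pair, wordDer]) A
            (Finset.mem_powerset.1 hA)),
          extend_congr _ _ (key _ (by simp [one_def, der_pair, wordDer]) _ Finset.sdiff_subset)]
    · exact ih S ((Finset.subset_insert_iff_of_notMem hnS).1 hS) h0 hne

/-- The signed sum over the orthogonal streams of a permutocube is the projection of the diagonal of
a permutahedron. -/
theorem streamSum_eq_cubeDiag (n : ℕ) : ∀ S ⊆ Finset.range n, 0 ∈ S →
    streamSum S = cubeDiag n S := by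
  induction n with
  | zero => intro S hS h0; simp at hS; simp [hS] at h0
  | succ n ih =>
    intro S hS h0
    rw [Finset.range_add_one] at hS
    by_cases hnS : n ∈ S
    · obtain rfl | hn := eq_or_ne n 0
      · obtain rfl : S = {0} := by
          rw [Finset.range_zero, insert_empty_eq] at hS
          exact hS.antisymm (by simpa using h0)
        rw [cubeDiag, permDiag_singleton (by norm_num), biProject_pair, streamSum_eq]
        have hv : blockVertices {0} = {[]} := by
          ext x
          rw [mem_blockVertices]
          simp +contextual
        have hl : strongLeft {0} [] = [{0}] := by simp [strongLeft, decRuns]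
        have hr : strongRight {0} [] = [{0}] := by
          simp [strongRight, incRuns, List.splitBy, List.splitBy.loop]
        have hs : blockSign {0} ([], [{0}], [{0}]) = 1 := by
          simp [blockSign, hl, rsgn, sgnOne, sgnTwo, epsOne, psgn, inversions, carrier]
        simp [hv, hl, hr, hs, project, pair_mul_pair]
      · have hS' : S.erase n ⊆ Finset.range n := by rwa [← Finset.subset_insert_iff]
        have h0' : 0 ∈ S.erase n := Finset.mem_erase.2 ⟨hn.symm, h0⟩
        have e1 := streamSum_insert hn (S := S.erase n) fun a ha => Finset.mem_range.1 (hS' ha)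
        have e2 := cubeDiag_succ hn h0' (Finset.notMem_erase n S)
        rw [Finset.insert_erase hnS] at e1 e2
        have e3 : extendLeft n streamSum (S.erase n) = extendLeft n (cubeDiag n) (S.erase n) :=
          extend_congr _ _ (by rw [ih _ hS' h0'])
        rw [if_pos h0', e3] at e1
        rw [e1, e2]
        refine congrArg (· + _) (Finset.sum_congr (by simp only [h0', true_imp_iff]) fun A hA => ?_)
        rw [Finset.mem_filter, Finset.mem_powerset] at hA
        have e4 : extendRight n streamSum A = extendRight n (cubeDiag n) A :=
          extend_congr _ _ (by rw [ih A (hA.1.trans hS') hA.2])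
        have e5 : extendLeft n streamSum (S.erase n \ A) =
            extendLeft n (permDiag n) (S.erase n \ A) := by
          apply extend_congr
          rcases (S.erase n \ A).eq_empty_or_nonempty with h | hne
          · rw [h, streamSum_empty, permDiag_empty, map_zero]
            simp [one_def, der_pair, wordDer]
          · rw [streamSum_eq_permDiag n _ (Finset.sdiff_subset.trans hS')
              (fun h => (Finset.mem_sdiff.1 h).2 hA.2) hne]
        rw [e4, e5]
    · rw [ih S ((Finset.subset_insert_iff_of_notMem hnS).1 hS) h0, cubeDiag, cubeDiag, permDiag,
        if_neg hnS]

/-! ### The diagonal of product cells -/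

theorem streamSum_singleton (s : ℕ) : streamSum {s} = pair [{s}] [{s}] := by
  rcases eq_or_ne s 0 with rfl | hs
  · rw [streamSum_eq_cubeDiag 1 {0} (by simp) (by simp), cubeDiag,
      permDiag_singleton (by norm_num), biProject_pair]
    simp [project, pair_mul_pair]
  · rw [streamSum_eq_permDiag (s + 1) {s} (by simp) (by simpa using hs.symm) (by simp),
      permDiag_singleton (by omega)]

theorem grade_streamSum {S : Finset ℕ} (hS : S.Nonempty) :
    grade (streamSum S) = (-1 : ℤ) ^ (S.card - 1) • streamSum S := by
  rw [streamSum_eq]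
  simp only [map_sum, Finset.smul_sum]
  refine Finset.sum_congr rfl fun x hx => Finset.sum_congr rfl fun u hu =>
    Finset.sum_congr rfl fun v hv => ?_
  have := dim_add_dim_of_mem_shifts hx hS hu hv
  rw [map_smul, grade_pair, smul_comm, ← this, Nat.add_sub_cancel]

/-- The diagonal of the cell `e`, as the product of the diagonals of its blocks. -/
noncomputable def wordDiag (e : Word) : BiChain := (e.map streamSum).prod

@[simp] theorem wordDiag_nil : wordDiag [] = 1 := rfl

theorem wordDiag_cons (S : Finset ℕ) (e : Word) :
    wordDiag (S :: e) = streamSum S * wordDiag e := by simp [wordDiag]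

theorem wordDiag_append (e f : Word) : wordDiag (e ++ f) = wordDiag e * wordDiag f := by
  simp [wordDiag]

/-- The linear extension of `wordDiag`. -/
noncomputable def wordDiagLin : (Word →₀ ℤ) →ₗ[ℤ] BiChain := Finsupp.linearCombination ℤ wordDiag

@[simp] theorem wordDiagLin_single (e : Word) (k : ℤ) :
    wordDiagLin (Finsupp.single e k) = k • wordDiag e := by simp [wordDiagLin]

theorem wordDiagLin_mapDomain_append (x : Word →₀ ℤ) (e : Word) :
    wordDiagLin (x.mapDomain (· ++ e)) = wordDiagLin x * wordDiag e := by
  induction x using Finsupp.induction_linear with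
  | zero => simp
  | add x y hx hy => simp only [Finsupp.mapDomain_add, map_add, hx, hy, add_mul]
  | single w k => simp [Finsupp.mapDomain_single, wordDiag_append, -zsmul_eq_mul]

theorem wordDiagLin_mapDomain_cons (x : Word →₀ ℤ) (S : Finset ℕ) :
    wordDiagLin (x.mapDomain (S :: ·)) = streamSum S * wordDiagLin x := by
  induction x using Finsupp.induction_linear with
  | zero => simp
  | add x y hx hy => simp only [Finsupp.mapDomain_add, map_add, hx, hy, mul_add]
  | single w k => simp [Finsupp.mapDomain_single, wordDiag_cons, -zsmul_eq_mul]

theorem wordDiag_eq_sum_stream (e : Word) :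
    wordDiag e = ∑ ts ∈ stream e, streamSign e ts • pair (left ts) (right ts) := by
  induction e with
  | nil => simp [stream, streamSign, left, right, one_def, -zsmul_eq_mul]
  | cons S e ih =>
    rw [wordDiag_cons, ih, streamSum, stream, Finset.sum_image (by
      rintro ⟨a, b⟩ _ ⟨a', b'⟩ _ h
      obtain ⟨rfl, rfl⟩ := List.cons.inj h
      rfl), Finset.sum_product, Finset.sum_mul_sum]
    refine Finset.sum_congr rfl fun t _ => Finset.sum_congr rfl fun ts _ => ?_
    rw [smul_mul_smul_comm, pair_mul_pair, smul_smul]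
    simp [streamSign, left, right]

theorem exists_subset_range (S : Finset ℕ) : ∃ n, S ⊆ Finset.range n :=
  ⟨S.sup id + 1, fun _ ha => Finset.mem_range.2 (Nat.lt_succ_of_le (Finset.le_sup (f := id) ha))⟩

theorem wordDiagLin_single_pair (A B : Finset ℕ) (k : ℤ) :
    wordDiagLin (Finsupp.single [A, B] k) = k • (streamSum A * streamSum B) := by
  rw [wordDiagLin_single, wordDiag_cons, wordDiag_cons, wordDiag_nil, mul_one]

/-- The diagonal of a block commutes with the differential. -/
theorem cellDer_streamSum {S : Finset ℕ} (hS : S.Nonempty) :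
    cellDer (streamSum S) = wordDiagLin (blockBoundary S) := by
  obtain ⟨n, hn⟩ := exists_subset_range S
  by_cases h0 : 0 ∈ S
  · rw [streamSum_eq_cubeDiag n S hn h0, cellDer_cubeDiag hn h0, blockBoundary, if_pos h0, map_add,
      map_sum, map_sum]
    congr 1
    · refine Finset.sum_congr rfl fun j hj => ?_
      rw [wordDiagLin_single, wordDiag_cons, wordDiag_nil, mul_one,
        streamSum_eq_cubeDiag n _ ((Finset.erase_subset _ _).trans hn)]
      exact Finset.mem_erase.2 ⟨(Finset.mem_erase.1 hj).1.symm, h0⟩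
    · refine Finset.sum_congr rfl fun A hA => ?_
      simp only [Finset.mem_filter, Finset.mem_powerset] at hA
      rw [wordDiagLin_single_pair, streamSum_eq_cubeDiag n A (hA.1.trans hn) hA.2.1,
        streamSum_eq_permDiag n (S \ A) (Finset.sdiff_subset.trans hn)
          (fun h => (Finset.mem_sdiff.1 h).2 hA.2.1)]
      exact Finset.sdiff_nonempty.2 fun h => hA.2.2 (hA.1.antisymm h)
  · rw [streamSum_eq_permDiag n S hn h0 hS, cellDer_eq_permDer h0 h0 (permDiag_mem_partSpan n S),
      permDer_permDiag n S hn, blockBoundary, if_neg h0, map_sum, conv]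
    symm
    refine (Finset.sum_congr rfl fun A hA => ?_).trans (Finset.sum_filter_of_ne fun A hA h => ?_)
    · simp only [Finset.mem_filter, Finset.mem_powerset] at hA
      rw [wordDiagLin_single_pair, streamSum_eq_permDiag n A (hA.1.trans hn) (fun h => h0 (hA.1 h))
          (Finset.nonempty_iff_ne_empty.2 hA.2.1),
        streamSum_eq_permDiag n (S \ A) (Finset.sdiff_subset.trans hn)
          (fun h => h0 (Finset.mem_sdiff.1 h).1)
          (Finset.sdiff_nonempty.2 fun h => hA.2.2 (hA.1.antisymm h)),
        alt_apply, smul_mul_assoc, smul_smul, mul_comm]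
    · constructor <;> rintro rfl <;> apply h
      · rw [alt_apply, permDiag_empty, smul_zero, zero_mul, smul_zero]
      · rw [Finset.sdiff_self, permDiag_empty, mul_zero, smul_zero]

/-- The diagonal of a cell commutes with the differential. -/
theorem cellDer_wordDiag {e : Word} (he : ∀ A ∈ e, A.Nonempty) :
    cellDer (wordDiag e) = wordDiagLin (cellBoundary e) := by
  induction e with
  | nil => simp [cellBoundary, one_def, der_pair, wordDer]
  | cons S e ih =>
    have hS := he S (by simp)
    rw [wordDiag_cons, isOddDerivation_cellDer.leibniz, cellDer_streamSum hS, grade_streamSum hS,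
      ih fun A hA => he A (by simp [hA]), cellBoundary, map_add, map_smul,
      wordDiagLin_mapDomain_append, wordDiagLin_mapDomain_cons, smul_mul_assoc]

/-! ### The square of the differential -/

theorem inl_injective : Function.Injective inl := by
  have h : (lift fun u v => if v = [] then Finsupp.single u (1 : ℤ) else 0) ∘ₗ inl =
      LinearMap.id := by
    ext1 w
    ext1
    simp
  intro x y hxy
  have := congrArg (lift fun u v => if v = [] then Finsupp.single u (1 : ℤ) else 0) hxy
  rw [← LinearMap.comp_apply, ← LinearMap.comp_apply, h] at this
  exact this

theorem der_inl (f g : Finset ℕ → (Word →₀ ℤ)) (x : Word →₀ ℤ) :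
    der f g (inl x) = inl (wordDerLin f x) := by
  induction x using Finsupp.induction_linear with
  | zero => simp
  | add x y hx hy => simp only [map_add, hx, hy]
  | single w k =>
    rw [inl_single, map_smul, der_pair, wordDerLin_single, map_smul]
    simp [wordDer, ← one_def]

theorem der_inr (f g : Finset ℕ → (Word →₀ ℤ)) (x : Word →₀ ℤ) :
    der f g (inr x) = inr (wordDerLin g x) := by
  induction x using Finsupp.induction_linear with
  | zero => simp
  | add x y hx hy => simp only [map_add, hx, hy]
  | single w k =>
    rw [inr_single, map_smul, der_pair, wordDerLin_single, map_smul]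
    simp [wordDer, ← one_def]

theorem wordDerLin_permBoundary (S : Finset ℕ) : wordDerLin permBoundary (permBoundary S) = 0 := by
  apply inl_injective
  rw [← der_inl permBoundary permBoundary, ← der_pair_left permBoundary permBoundary,
    permDer_permDer, map_zero]

/-- The square of the differential vanishes on a block: if the block contains `0`, it is the
projection of the square of the differential of a permutahedron. -/
theorem wordDerLin_blockBoundary {S : Finset ℕ} (hS : S.Nonempty) :
    wordDerLin blockBoundary (blockBoundary S) = 0 := by
  have hpart : ∀ A ∈ S.powerset.filter (fun A => A ≠ ∅ ∧ A ≠ S), IsPartition S [A, S \ A] := by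
    intro A hA
    simp only [Finset.mem_filter, Finset.mem_powerset] at hA
    have := (isPartition_singleton (Finset.nonempty_iff_ne_empty.2 hA.2.1)).append
      (isPartition_singleton (Finset.sdiff_nonempty.2 fun h => hA.2.2 (hA.1.antisymm h)))
      Finset.disjoint_sdiff
    rwa [Finset.union_sdiff_of_subset hA.1] at this
  by_cases h0 : 0 ∈ S
  · have h1 := projectLin_wordDer (isPartition_singleton hS)
    rw [wordDer_singleton, project, if_pos h0, wordDerLin_single, one_smul, wordDer_singleton] at h1
    have h2 := congrArg projectLin (wordDerLin_permBoundary S)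
    rw [← h1]
    refine Eq.trans ?_ (h2.trans (map_zero projectLin))
    rw [permBoundary]
    simp only [map_sum, projectLin_single, wordDerLin_single, map_smul]
    exact Finset.sum_congr rfl fun A hA => by rw [projectLin_wordDer (hpart A hA)]
  · refine Eq.trans ?_ (wordDerLin_permBoundary S)
    rw [blockBoundary_of_notMem h0, permBoundary]
    simp only [map_sum, wordDerLin_single]
    refine Finset.sum_congr rfl fun A hA => ?_
    have h : wordDer blockBoundary [A, S \ A] = wordDer permBoundary [A, S \ A] :=
      wordDer_congr fun B hB => blockBoundary_of_notMem fun h => h0 ((hpart A hA).subset B hB h)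
    rw [h]

theorem cellDer_cellDer_pair {u v : Word} (hu : ∀ A ∈ u, A.Nonempty) (hv : ∀ A ∈ v, A.Nonempty) :
    cellDer (cellDer (pair u v)) = 0 := by
  refine eq_zero_of_derivation (E := cellDer ∘ₗ cellDer) isOddDerivation_cellDer.sq
    (fun S hS => ?_) (fun S hS => ?_)
  · rw [LinearMap.comp_apply, der_pair_left, der_inl, wordDerLin_blockBoundary (hu S hS), map_zero]
  · rw [LinearMap.comp_apply, der_pair_right, der_inr, wordDerLin_blockBoundary (hv S hS), map_zero]

theorem wordDerLin_cellBoundary {e : Word} (he : ∀ A ∈ e, A.Nonempty) :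
    wordDerLin blockBoundary (cellBoundary e) = 0 := by
  have h := cellDer_cellDer_pair he (v := []) (by simp)
  have h1 : pair e [] = inl (Finsupp.single e 1) := by simp
  rw [h1, der_inl, der_inl, wordDerLin_single, one_smul, ← cellBoundary_eq_wordDer] at h
  exact inl_injective (h.trans (map_zero _).symm)

/-! ### Dimensions -/

theorem dim_of_mem_blockBoundary {S : Finset ℕ} {w : Word} (hw : w ∈ (blockBoundary S).support) :
    dim w + 1 = S.card - 1 := by
  have key : ∀ {ι : Type} (s : Finset ι) (f : ι → Word) (g : ι → ℤ),
      w ∈ (∑ i ∈ s, Finsupp.single (f i) (g i)).support → ∃ i ∈ s, w = f i := by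
    intro ι s f g h
    classical
    obtain ⟨i, hi, h⟩ := Finset.mem_biUnion.1 (Finsupp.support_finsetSum h)
    exact ⟨i, hi, Finset.mem_singleton.1 (Finsupp.support_single_subset h)⟩
  have two : ∀ A ⊆ S, A.Nonempty → A ≠ S → dim [A, S \ A] + 1 = S.card - 1 := by
    intro A hA hne hAS
    have h1 := Finset.card_sdiff_add_card_eq_card hA
    have h2 := Finset.card_pos.2 hne
    have h3 := Finset.card_pos.2 (Finset.sdiff_nonempty.2 fun h => hAS (hA.antisymm h))
    simp only [dim_cons, dim_nil]
    omega
  unfold blockBoundary at hw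
  split_ifs at hw with h0
  · rcases Finset.mem_union.1 (Finsupp.support_add hw) with hw | hw
    · obtain ⟨j, hj, rfl⟩ := key _ _ _ hw
      have hj' := Finset.mem_erase.1 hj
      have h1 := Finset.card_erase_add_one hj'.2
      have h2 : 0 < (S.erase j).card :=
        Finset.card_pos.2 ⟨0, Finset.mem_erase.2 ⟨hj'.1.symm, h0⟩⟩
      simp only [dim_cons, dim_nil]
      omega
    · obtain ⟨A, hA, rfl⟩ := key _ _ _ hw
      simp only [Finset.mem_filter, Finset.mem_powerset] at hA
      exact two A hA.1 ⟨0, hA.2.1⟩ hA.2.2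
  · obtain ⟨A, hA, rfl⟩ := key _ _ _ hw
    simp only [Finset.mem_filter, Finset.mem_powerset] at hA
    exact two A hA.1 (Finset.nonempty_iff_ne_empty.2 hA.2.1) hA.2.2

theorem dim_of_mem_cellBoundary {e w : Word} (hw : w ∈ (cellBoundary e).support) :
    dim w + 1 = dim e := by
  induction e generalizing w with
  | nil => simp [cellBoundary] at hw
  | cons S e ih =>
    rw [cellBoundary] at hw
    classical
    rcases Finset.mem_union.1 (Finsupp.support_add hw) with hw | hw
    · obtain ⟨c, hc, rfl⟩ := Finset.mem_image.1 (Finsupp.mapDomain_support hw)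
      have := dim_of_mem_blockBoundary hc
      simp only [dim_append, dim_cons]
      omega
    · obtain ⟨c, hc, rfl⟩ :=
        Finset.mem_image.1 (Finsupp.mapDomain_support (Finsupp.support_smul hw))
      have := ih hc
      simp only [dim_cons]
      omega

theorem dim_of_mem_stream {e : Word} (he : ∀ A ∈ e, A.Nonempty)
    {ts : List (List ℕ × Word × Word)} (h : ts ∈ stream e) :
    dim (left ts) + dim (right ts) = dim e := by
  induction e generalizing ts with
  | nil =>
    rw [stream, Finset.mem_singleton] at h
    subst h
    rfl
  | cons S e ih =>
    rw [stream] at h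
    obtain ⟨⟨p, ps⟩, hp, rfl⟩ := Finset.mem_image.1 h
    obtain ⟨hp, hps⟩ := Finset.mem_product.1 hp
    obtain ⟨x, hx, hp⟩ := Finset.mem_biUnion.1 hp
    simp only [Finset.mem_product, Finset.mem_singleton] at hp
    have h1 := dim_add_dim_of_mem_shifts hx (he S (by simp)) hp.2.1 hp.2.2
    have h2 := ih (fun A hA => he A (by simp [hA])) hps
    have h3 : left (p :: ps) = p.2.1 ++ left ps := by simp [left]
    have h4 : right (p :: ps) = p.2.2 ++ right ps := by simp [right]
    have h5 := Finset.card_pos.2 (he S (by simp))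
    rw [h3, h4, dim_append, dim_append, dim_cons]
    change dim (left ps) + dim (right ps) = dim e at h2
    omega

theorem wordDiag_of_dim_eq_zero {e : Word} (he : ∀ A ∈ e, A.Nonempty) (h : dim e = 0) :
    wordDiag e = pair e e := by
  induction e with
  | nil => rfl
  | cons S e ih =>
    rw [dim_cons] at h
    have hS := Finset.card_pos.2 (he S (by simp))
    obtain ⟨s, rfl⟩ := Finset.card_eq_one.1 (show S.card = 1 by omega)
    rw [wordDiag_cons, ih (fun A hA => he A (by simp [hA])) (by omega), streamSum_singleton,
      pair_mul_pair, show dim e = 0 by omega]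
    simp [-zsmul_eq_mul]

/-! ### Chains on cells -/

/-- Chains on the cells of `X`, regarded as chains on words. -/
noncomputable def toWords (X : Word) : Chains X →ₗ[ℤ] (Word →₀ ℤ) :=
  Finsupp.lmapDomain ℤ ℤ Subtype.val

/-- Elements of `C_*(X) ⊗ C_*(X)`, regarded as combinations of pairs of words. -/
noncomputable def toBiChain (X : Word) : Chains X ⊗[ℤ] Chains X →ₗ[ℤ] BiChain :=
  TensorProduct.lift ((LinearMap.mul ℤ BiChain).compl₁₂ (inl ∘ₗ toWords X) (inr ∘ₗ toWords X))

@[simp] theorem toWords_single {X : Word} (c : Cell X) (k : ℤ) :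
    toWords X (Finsupp.single c k) = Finsupp.single c.1 k := by
  simp [toWords, Finsupp.mapDomain_single]

@[simp] theorem toBiChain_tmul {X : Word} (x y : Chains X) :
    toBiChain X (x ⊗ₜ[ℤ] y) = inl (toWords X x) * inr (toWords X y) := rfl

theorem toWords_injective (X : Word) : Function.Injective (toWords X) :=
  Finsupp.mapDomain_injective Subtype.val_injective

theorem toBiChain_single_tmul_single {X : Word} (u v : Cell X) (k l : ℤ) :
    toBiChain X (Finsupp.single u k ⊗ₜ[ℤ] Finsupp.single v l) = (k * l) • pair u.1 v.1 := by
  simp [pair_mul_pair, smul_smul, mul_comm, -zsmul_eq_mul]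

theorem toBiChain_injective (X : Word) : Function.Injective (toBiChain X) := by
  classical
  let c : Word → Chains X := fun w => if h : IsFace w X then Finsupp.single ⟨w, h⟩ 1 else 0
  have hc : ∀ u : Cell X, c u.1 = Finsupp.single u 1 := fun u => dif_pos u.2
  refine Function.LeftInverse.injective (g := lift fun u v => c u ⊗ₜ[ℤ] c v) fun t => ?_
  induction t using TensorProduct.induction_on with
  | zero => rw [map_zero, map_zero]
  | add x y hx hy => rw [map_add, map_add, hx, hy]
  | tmul x y =>
    induction x using Finsupp.induction_linear with
    | zero => rw [TensorProduct.zero_tmul, map_zero, map_zero]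
    | add x x' hx hx' => rw [TensorProduct.add_tmul, map_add, map_add, hx, hx']
    | single u k =>
      induction y using Finsupp.induction_linear with
      | zero => rw [TensorProduct.tmul_zero, map_zero, map_zero]
      | add x x' hx hx' => rw [TensorProduct.tmul_add, map_add, map_add, hx, hx']
      | single v l =>
        rw [toBiChain_single_tmul_single, map_smul, lift_pair, hc, hc]
        have h := TensorProduct.smul_tmul_smul k l (Finsupp.single u (1 : ℤ))
          (Finsupp.single v (1 : ℤ))
        rw [Finsupp.smul_single, Finsupp.smul_single, smul_eq_mul, smul_eq_mul, mul_one,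
          mul_one] at h
        exact h.symm

theorem toWords_boundary_single {X : Word} (e : Cell X) :
    toWords X (boundary X (Finsupp.single e 1)) = cellBoundary e.1 := by
  rw [boundary, Finsupp.linearCombination_single, one_smul, toWords, Finsupp.lmapDomain_apply]
  ext w
  by_cases hw : IsFace w X
  · exact Finsupp.mapDomain_apply Subtype.val_injective _ (⟨w, hw⟩ : Cell X)
  · rw [Finsupp.mapDomain_of_notMem_range _ _ (by simpa using hw), eq_comm,
      ← Finsupp.notMem_support_iff]
    exact fun h => hw ((isFace_of_mem_cellBoundary e.2.nonempty h).trans e.2)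

theorem toWords_boundary {X : Word} (x : Chains X) :
    toWords X (boundary X x) = wordDerLin blockBoundary (toWords X x) := by
  induction x using Finsupp.induction_linear with
  | zero => simp
  | add x y hx hy => simp only [map_add, hx, hy]
  | single e k =>
    have : Finsupp.single e k = k • Finsupp.single e (1 : ℤ) := by simp
    rw [this, map_smul, map_smul, toWords_boundary_single, map_smul, toWords_single, map_smul,
      wordDerLin_single, one_smul, cellBoundary_eq_wordDer]

theorem toBiChain_tensorBoundary {X : Word} (t : Chains X ⊗[ℤ] Chains X) :
    toBiChain X (tensorBoundary X t) = cellDer (toBiChain X t) := by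
  induction t using TensorProduct.induction_on with
  | zero => simp
  | add x y hx hy => simp only [map_add, hx, hy]
  | tmul x y =>
    have h : tensorBoundary X (x ⊗ₜ[ℤ] y) =
        boundary X x ⊗ₜ[ℤ] y + gradeSign X x ⊗ₜ[ℤ] boundary X y := rfl
    rw [h, map_add,
      toBiChain_tmul, toBiChain_tmul, toBiChain_tmul, toWords_boundary,
      toWords_boundary]
    clear h
    generalize toWords X y = z
    induction x using Finsupp.induction_linear with
    | zero => simp
    | add x y hx hy => simp only [map_add, add_mul, ← hx, ← hy]; abel
    | single e k =>
      induction z using Finsupp.induction_linear with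
      | zero => simp
      | add x y hx hy => simp only [map_add, mul_add, ← hx, ← hy]; abel
      | single w l =>
        rw [gradeSign, Finsupp.linearCombination_single, Finsupp.smul_single, toWords_single,
          toWords_single, wordDerLin_single, wordDerLin_single, map_smul, map_smul, inl_single,
          inl_single, inr_single, smul_mul_smul_comm, smul_mul_smul_comm, smul_mul_smul_comm,
          pair_mul_pair, dim_nil, zero_mul, pow_zero, one_smul, List.nil_append, List.append_nil,
          map_smul, der_pair, smul_add, smul_smul, smul_eq_mul]
        congr 2
        ring

theorem toBiChain_diagonal_single {X : Word} (e : Cell X) :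
    toBiChain X (diagonal X (Finsupp.single e 1)) = wordDiag e.1 := by
  rw [diagonal, Finsupp.linearCombination_single, one_smul, wordDiag_eq_sum_stream,
    ← Finset.sum_attach (stream e.1)]
  refine (map_sum (toBiChain X) _ _).trans (Finset.sum_congr rfl fun ts _ => ?_)
  refine (map_smul (toBiChain X) _ _).trans ?_
  rw [toBiChain_single_tmul_single, mul_one, one_smul]

theorem toBiChain_diagonal {X : Word} (x : Chains X) :
    toBiChain X (diagonal X x) = wordDiagLin (toWords X x) := by
  induction x using Finsupp.induction_linear with
  | zero => simp
  | add x y hx hy => simp only [map_add, hx, hy]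
  | single e k =>
    have : Finsupp.single e k = k • Finsupp.single e (1 : ℤ) := by simp
    rw [this, map_smul, map_smul, toBiChain_diagonal_single, map_smul, toWords_single, map_smul,
      wordDiagLin_single, one_smul]

theorem isCellularDifferential_boundary (X : Word) : IsCellularDifferential X (boundary X) where
  supported e := by
    rw [← Finsupp.sum_single (boundary X (Finsupp.single e 1))]
    refine Submodule.sum_mem _ fun f hf => ?_
    have hf' : f.1 ∈ (cellBoundary e.1).support := by
      rw [boundary, Finsupp.linearCombination_single, one_smul] at hf
      simpa using hf
    rw [← mul_one ((boundary X (Finsupp.single e 1)) f), ← smul_eq_mul, ← Finsupp.smul_single]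
    exact Submodule.smul_mem _ _ (Submodule.subset_span
      ⟨f, isFace_of_mem_cellBoundary e.2.nonempty hf', dim_of_mem_cellBoundary hf', rfl⟩)
  comp_self := by
    refine Finsupp.lhom_ext' fun e => LinearMap.ext_ring ?_
    apply toWords_injective X
    simp only [LinearMap.comp_apply, Finsupp.lsingle_apply, LinearMap.zero_apply, map_zero]
    rw [toWords_boundary, toWords_boundary_single, wordDerLin_cellBoundary e.2.nonempty]

theorem isCellularDiagonal_diagonal (X : Word) : IsCellularDiagonal X (diagonal X) where
  supported e := by
    rw [diagonal, Finsupp.linearCombination_single, one_smul]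
    refine Submodule.sum_mem _ fun ts _ => Submodule.smul_mem _ _ (Submodule.subset_span
      ⟨_, _, (isFace_of_mem_stream ts.2).1, (isFace_of_mem_stream ts.2).2,
        dim_of_mem_stream e.2.nonempty ts.2, rfl⟩)
  vertex x hx := by
    apply toBiChain_injective X
    rw [toBiChain_diagonal_single, wordDiag_of_dim_eq_zero x.2.nonempty hx]
    simp [pair_mul_pair, -zsmul_eq_mul]
  chain_map := by
    refine Finsupp.lhom_ext' fun e => LinearMap.ext_ring ?_
    apply toBiChain_injective X
    simp only [LinearMap.comp_apply, Finsupp.lsingle_apply]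
    rw [toBiChain_tensorBoundary, toBiChain_diagonal_single, toBiChain_diagonal,
      toWords_boundary_single, cellDer_wordDiag e.2.nonempty]

/-! ### The inclusion of the permutahedron -/

theorem toWords_chainInclusion (n : ℕ) (x : Chains (permutahedron n)) :
    toWords _ (chainInclusion n x) = (toWords _ x).mapDomain ({0} :: ·) := by
  rw [chainInclusion, toWords, toWords, Finsupp.lmapDomain_apply, Finsupp.lmapDomain_apply,
    Finsupp.lmapDomain_apply, ← Finsupp.mapDomain_comp, ← Finsupp.mapDomain_comp]
  rfl

theorem toBiChain_map_chainInclusion (n : ℕ)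
    (t : Chains (permutahedron n) ⊗[ℤ] Chains (permutahedron n)) :
    toBiChain _ (TensorProduct.map (chainInclusion n) (chainInclusion n) t) =
      pair [{0}] [{0}] * toBiChain _ t := by
  induction t using TensorProduct.induction_on with
  | zero => simp
  | add x y hx hy => simp only [map_add, mul_add, hx, hy]
  | tmul x y =>
    rw [TensorProduct.map_tmul, toBiChain_tmul, toBiChain_tmul, toWords_chainInclusion,
      toWords_chainInclusion, inl_mapDomain_cons, inr_mapDomain_cons]
    have h1 : pair [{0}] [{0}] = pair [{0}] [] * pair [] [{0}] := by simp [pair_mul_pair]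
    -- The block `{0}` has dimension `0`, so it commutes with everything without a sign.
    have h2 : ∀ z, pair [] [{0}] * inl z = inl z * pair [] [{0}] := by
      intro z
      induction z using Finsupp.induction_linear with
      | zero => simp
      | add x y hx hy => simp only [map_add, mul_add, add_mul, hx, hy]
      | single w k => simp [pair_mul_pair, -zsmul_eq_mul]
    rw [h1, mul_assoc, mul_assoc, ← mul_assoc (pair [] [{0}]) (inl _), h2, mul_assoc]

theorem blockBoundary_singleton_zero : blockBoundary {0} = 0 := by
  have h : (({0} : Finset ℕ).powerset.filter fun A => 0 ∈ A ∧ A ≠ {0}) = ∅ := by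
    rw [Finset.filter_eq_empty_iff]
    rintro A hA ⟨h0, hne⟩
    exact hne ((Finset.mem_powerset.1 hA).antisymm (by simpa using h0))
  rw [blockBoundary, if_pos (Finset.mem_singleton_self 0), h]
  simp

theorem boundary_comp_chainInclusion (n : ℕ) :
    boundary (permutocube n) ∘ₗ chainInclusion n =
      chainInclusion n ∘ₗ boundary (permutahedron n) := by
  refine Finsupp.lhom_ext' fun c => LinearMap.ext_ring ?_
  apply toWords_injective
  simp only [LinearMap.comp_apply, Finsupp.lsingle_apply]
  rw [toWords_chainInclusion, toWords_boundary_single, chainInclusion, Finsupp.lmapDomain_apply,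
    Finsupp.mapDomain_single, toWords_boundary_single]
  simp [faceInclusion, cellBoundary, blockBoundary_singleton_zero]

theorem diagonal_comp_chainInclusion (n : ℕ) :
    diagonal (permutocube n) ∘ₗ chainInclusion n =
      TensorProduct.map (chainInclusion n) (chainInclusion n) ∘ₗ diagonal (permutahedron n) := by
  refine Finsupp.lhom_ext' fun c => LinearMap.ext_ring ?_
  apply toBiChain_injective
  change toBiChain _ (diagonal _ (chainInclusion n (Finsupp.single c 1))) =
    toBiChain _ (TensorProduct.map (chainInclusion n) (chainInclusion n)
      (diagonal _ (Finsupp.single c 1)))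
  rw [toBiChain_map_chainInclusion, toBiChain_diagonal_single, chainInclusion,
    Finsupp.lmapDomain_apply, Finsupp.mapDomain_single, toBiChain_diagonal_single, faceInclusion,
    wordDiag_cons, streamSum_singleton]

end Permutocube

theorem mainTheorem5 (n : ℕ) :
    Permutocube.IsCellularDifferential (Permutocube.permutocube n)
      (Permutocube.boundary (Permutocube.permutocube n)) ∧
    Permutocube.IsCellularDiagonal (Permutocube.permutocube n)
      (Permutocube.diagonal (Permutocube.permutocube n)) ∧
    Permutocube.boundary (Permutocube.permutocube n) ∘ₗ Permutocube.chainInclusion n =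
      Permutocube.chainInclusion n ∘ₗ Permutocube.boundary (Permutocube.permutahedron n) ∧
    Permutocube.diagonal (Permutocube.permutocube n) ∘ₗ Permutocube.chainInclusion n =
      TensorProduct.map (Permutocube.chainInclusion n) (Permutocube.chainInclusion n) ∘ₗ
        Permutocube.diagonal (Permutocube.permutahedron n) :=
  ⟨Permutocube.isCellularDifferential_boundary _, Permutocube.isCellularDiagonal_diagonal _,
    Permutocube.boundary_comp_chainInclusion n, Permutocube.diagonal_comp_chainInclusion n⟩
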